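/- Let $k$ be a field of characteristic $0$, let $\mathbf{V}=\bigcup_{n\ge 1}k^n$, and let $\mathbf{GL}=\bigcup_{n\ge1}\mathrm{GL}_n(k)$ act on it. For a partition $\mu$ of $m$ let $S^\mu$ be the Specht module of $\mathfrak S_m$ over $k$ and let $\mathbf S_\mu(\mathbf V)=(S^\mu\otimes_k\mathbf V^{\otimes m})_{\mathfrak S_m}$ be the value of the Schur functor; each $x\in S^\mu$ gives a projection $\mathbf V^{\otimes m}\to\mathbf S_\mu(\mathbf V)$, $v\mapsto[x\otimes v]$. Let $\sigma_1,\dots,\sigma_r$ be non-empty partitions, and let $K=\operatorname{Frac}\bigl(\operatorname{Sym}(\bigoplus_{i=1}^r\mathbf S_{\sigma_i}(\mathbf V))\bigr)$, a field with an action of $\mathbf{GL}$. A representation of $\mathbf{GL}$ over $k$ is polynomial if it is a subquotient of a direct sum of tensor powers of $\mathbf V$. A $K$-module is a semi-linear representation of $\mathbf{GL}$ over $K$ in which every element has the form $ax$ with $a\in K$ and $x$ an element that generates a polynomial $k$-linear subrepresentation; maps of $K$-modules are the $K$-linear $\mathbf{GL}$-equivariant maps. For a partition $\mu$ put $K^{\oplus\mu}=K\otimes_k\mathbf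 S_\mu(\mathbf V)$, and let $L_\mu\subset K^{\oplus\mu}$ be the intersection of the kernels of all maps of $K$-modules $K^{\oplus\mu}\to K^{\oplus\nu}$ with $|\nu|<|\mu|$. Let $T^n=K\otimes_k\mathbf V^{\otimes n}$. For $1\le i\le r$ and $x\in S^{\sigma_i}$ let $\phi_{i,x}$ be the composite $K\otimes\mathbf V^{\otimes|\sigma_i|}\to K\otimes\mathbf S_{\sigma_i}(\mathbf V)\to K$, in which the first map is the projection given by $x$ and the second is $a\otimes w\mapsto aw$, using $\mathbf S_{\sigma_i}(\mathbf V)\subset K$. For $S\subset\{1,\dots,n\}$ of size $|\sigma_i|$ let $\phi_{i,x,S}\colon T^n\to T^{n-|\sigma_i|}$ apply $\phi_{i,x}$ to the tensor factors indexed by $S$. Let $T^{[n]}\subset T^n$ be the intersection of the kernels of all $\phi_{i,x,S}$; it is stable under $\mathbf{GL}$ and $\mathfrak S_n$. Let $\lambda$ be a partition of $n$. Then $L_\lambda$ is a simple $K$-module, and it is the $S^\lambda$-isotypic piece of $T^{[n]}$: there is an isomorphism of $K$-modules $\operatorname{Hom}_{\mathfrak S_n}(S^\lambda,T^{[n]})\cong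 L_\lambda$, and the $S^\lambda$-isotypic component of $T^{[n]}$ (the sum of all $\mathfrak S_n$-subrepresentations isomorphic to $S^\lambda$) is isomorphic to $L_\lambda\otimes_kS^\lambda$, $K$-linearly and compatibly with the actions of $\mathbf{GL}$ and $\mathfrak S_n$. -/

import Mathlib

open scoped TensorProduct DirectSum
open Equiv (Perm)

universe u

noncomputable section

namespace WeylConstruction

/-! ### The infinite general linear group and tensor powers of its standard representation -/

section Standard

variable (k : Type u) [Field k]

/-- The standard representation `V = ⋃ kⁿ`, with basis `e₀, e₁, …`. -/
abbrev StdV : Type u := ℕ →₀ k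

/-- The group `GL = ⋃ GLₙ(k)`: the automorphisms `g` of `V` whose matrix is, for some `n`, block
diagonal with blocks an `n × n` matrix and an infinite identity matrix. The first condition says
that the columns of index `≥ n` are those of the identity matrix, the second one says the same about
the rows of index `≥ n`. -/
def GLInf : Subgroup (StdV k ≃ₗ[k] StdV k) where
  carrier := {g | ∃ n : ℕ, (∀ i, n ≤ i → g (Finsupp.single i 1) = Finsupp.single i 1) ∧
    ∀ i, n ≤ i → ∀ v : StdV k, g v i = v i}
  one_mem' := ⟨0, fun _ _ => rfl, fun _ _ _ => rfl⟩
  mul_mem' := by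
    rintro a b ⟨n, h1, h2⟩ ⟨m, h3, h4⟩
    refine ⟨max n m, fun i hi => ?_, fun i hi v => ?_⟩
    · rw [LinearEquiv.mul_apply, h3 i (le_trans (le_max_right _ _) hi),
        h1 i (le_trans (le_max_left _ _) hi)]
    · rw [LinearEquiv.mul_apply, h2 i (le_trans (le_max_left _ _) hi),
        h4 i (le_trans (le_max_right _ _) hi)]
  inv_mem' := by
    rintro a ⟨n, h1, h2⟩
    refine ⟨n, fun i hi => ?_, fun i hi v => ?_⟩
    · have := congrArg (a⁻¹ : StdV k ≃ₗ[k] StdV k) (h1 i hi)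
      rw [← LinearEquiv.mul_apply, inv_mul_cancel] at this
      exact this.symm
    · have := h2 i hi ((a⁻¹ : StdV k ≃ₗ[k] StdV k) v)
      rw [← LinearEquiv.mul_apply, mul_inv_cancel] at this
      exact this.symm

/-- The tensor power `V^{⊗ n}`. -/
def TPow (n : ℕ) : Type u := ⨂[k] _ : Fin n, StdV k

instance (n : ℕ) : AddCommGroup (TPow k n) :=
  inferInstanceAs (AddCommGroup (⨂[k] _ : Fin n, StdV k))

instance (n : ℕ) : Module k (TPow k n) :=
  inferInstanceAs (Module k (⨂[k] _ : Fin n, StdV k))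

variable {k} in
/-- The pureTensor tensor `v₀ ⊗ ⋯ ⊗ vₙ₋₁`. -/
def pureTensor {n : ℕ} (v : Fin n → StdV k) : TPow k n := PiTensorProduct.tprod k v

variable {k} in
theorem pure_ext {n : ℕ} {M : Type*} [AddCommGroup M] [Module k M] {f g : TPow k n →ₗ[k] M}
    (h : ∀ v, f (pureTensor v) = g (pureTensor v)) : f = g := by
  refine LinearMap.ext fun x => ?_
  refine PiTensorProduct.induction_on (R := k) (s := fun _ : Fin n => StdV k)
    (motive := fun x => f x = g x) x ?_ ?_
  · intro c v
    exact (f.map_smul c (pureTensor v)).trans ((congrArg (c • ·) (h v)).trans (g.map_smul c (pureTensor v)).symm)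
  · intro x y hx hy
    exact (f.map_add x y).trans ((congrArg₂ (· + ·) hx hy).trans (g.map_add x y).symm)

variable {k} in
/-- The map `V^{⊗ n} → V^{⊗ n}` given by `v₀ ⊗ ⋯ ⊗ vₙ₋₁ ↦ g v₀ ⊗ ⋯ ⊗ g vₙ₋₁`. -/
def glMap (n : ℕ) (g : GLInf k) : TPow k n →ₗ[k] TPow k n :=
  PiTensorProduct.map (R := k) (s := fun _ : Fin n => StdV k) (t := fun _ : Fin n => StdV k)
    fun _ => (g : StdV k ≃ₗ[k] StdV k).toLinearMap

variable {k} in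
@[simp] theorem glMap_pure (n : ℕ) (g : GLInf k) (v : Fin n → StdV k) :
    glMap n g (pureTensor v) = pureTensor fun i => (g : StdV k ≃ₗ[k] StdV k) (v i) :=
  PiTensorProduct.map_tprod _ _

/-- The map `V^{⊗ n} → V^{⊗ n}` that moves the factor in position `i` to position `τ i`. -/
def permMap (n : ℕ) (τ : Perm (Fin n)) : TPow k n →ₗ[k] TPow k n :=
  (PiTensorProduct.reindex k (fun _ : Fin n => StdV k) τ).toLinearMap

@[simp] theorem permMap_pure (n : ℕ) (τ : Perm (Fin n)) (v : Fin n → StdV k) :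
    permMap k n τ (pureTensor v) = pureTensor fun i => v (τ.symm i) :=
  PiTensorProduct.reindex_tprod _ _

/-- The action of `GL` on `V^{⊗ n}`. -/
def glTPow (n : ℕ) : Representation k (GLInf k) (TPow k n) where
  toFun g := glMap n g
  map_one' := pure_ext fun v => by rw [glMap_pure]; rfl
  map_mul' g h := pure_ext fun v => by
    rw [glMap_pure, Module.End.mul_apply, glMap_pure, glMap_pure]; rfl

/-- The action of the symmetric group on `V^{⊗ n}` by permutation of the tensor factors. -/
def permTPow (n : ℕ) : Representation k (Perm (Fin n)) (TPow k n) where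
  toFun τ := permMap k n τ
  map_one' := pure_ext fun v => by rw [permMap_pure]; rfl
  map_mul' τ τ' := pure_ext fun v => by
    rw [permMap_pure, Module.End.mul_apply, permMap_pure, permMap_pure]; rfl

variable {k}

theorem glTPow_pure (n : ℕ) (g : GLInf k) (v : Fin n → StdV k) :
    glTPow k n g (pureTensor v) = pureTensor fun i => (g : StdV k ≃ₗ[k] StdV k) (v i) :=
  glMap_pure n g v

theorem permTPow_pure (n : ℕ) (τ : Perm (Fin n)) (v : Fin n → StdV k) :
    permTPow k n τ (pureTensor v) = pureTensor fun i => v (τ.symm i) :=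
  permMap_pure k n τ v

theorem perm_gl_comm (n : ℕ) (τ : Perm (Fin n)) (g : GLInf k) (x : TPow k n) :
    permTPow k n τ (glTPow k n g x) = glTPow k n g (permTPow k n τ x) := by
  refine LinearMap.congr_fun (f := permTPow k n τ ∘ₗ glTPow k n g)
    (g := glTPow k n g ∘ₗ permTPow k n τ) (pure_ext fun v => ?_) x
  simp only [LinearMap.comp_apply, glTPow_pure, permTPow_pure]

end Standard

/-! ### Specht modules and Schur functors -/

section Schur

/-- A bijective tableau of shape `μ`: a numbering of the cells of `μ` (any one will do). -/
def tableau (μ : YoungDiagram) : Fin μ.card ≃ μ.cells := μ.cells.equivFin.symm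

/-- The permutations that preserve each row of the tableau. -/
def rowGroup (μ : YoungDiagram) : Set (Perm (Fin μ.card)) :=
  {p | ∀ i, (tableau μ (p i)).1.1 = (tableau μ i).1.1}

/-- The permutations that preserve each column of the tableau. -/
def colGroup (μ : YoungDiagram) : Set (Perm (Fin μ.card)) :=
  {p | ∀ i, (tableau μ (p i)).1.2 = (tableau μ i).1.2}

variable (k : Type u) [Field k]

open Classical in
/-- The Young symmetrizer `b a` of the tableau, with `a` the sum of the row permutations and `b` the
signed sum of the column permutations. -/
def youngSymmetrizer (μ : YoungDiagram) : MonoidAlgebra k (Perm (Fin μ.card)) :=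
  (∑ q : Perm (Fin μ.card) with q ∈ colGroup μ,
    MonoidAlgebra.single q (((Equiv.Perm.sign q : ℤ) : k))) *
  ∑ p : Perm (Fin μ.card) with p ∈ rowGroup μ, MonoidAlgebra.single p (1 : k)

/-- The left ideal of the group algebra generated by the Young symmetrizer. -/
def spechtIdeal (μ : YoungDiagram) : Ideal (MonoidAlgebra k (Perm (Fin μ.card))) :=
  Ideal.span {youngSymmetrizer k μ}

/-- The Specht module `S^μ`, as the left ideal of the group algebra generated by `b a`. (The left
ideal generated by `a` is the permutation module on tabloids; the element `b a` of it is the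
polytabloid of the tableau.) -/
def Specht (μ : YoungDiagram) : Type u := spechtIdeal k μ

instance (μ : YoungDiagram) : AddCommGroup (Specht k μ) :=
  inferInstanceAs (AddCommGroup (spechtIdeal k μ))

instance (μ : YoungDiagram) : Module (MonoidAlgebra k (Perm (Fin μ.card))) (Specht k μ) :=
  inferInstanceAs (Module (MonoidAlgebra k (Perm (Fin μ.card))) (spechtIdeal k μ))

instance (μ : YoungDiagram) : Module k (Specht k μ) :=
  inferInstanceAs (Module k (spechtIdeal k μ))

instance (μ : YoungDiagram) :
    IsScalarTower k (MonoidAlgebra k (Perm (Fin μ.card))) (Specht k μ) :=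
  inferInstanceAs (IsScalarTower k (MonoidAlgebra k (Perm (Fin μ.card))) (spechtIdeal k μ))

/-- The action of the symmetric group on the Specht module. -/
def spechtRep (μ : YoungDiagram) : Representation k (Perm (Fin μ.card)) (Specht k μ) :=
  Representation.ofModule' (Specht k μ)

/-- The tensor product `S^μ ⊗ V^{⊗ |μ|}`. -/
abbrev SpechtTensor (μ : YoungDiagram) : Type u := Specht k μ ⊗[k] TPow k μ.card

/-- The diagonal action of the symmetric group on `S^μ ⊗ V^{⊗ |μ|}`. -/
def diagRep (μ : YoungDiagram) : Representation k (Perm (Fin μ.card)) (SpechtTensor k μ) :=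
  (spechtRep k μ).tprod (permTPow k μ.card)

/-- The value on `V` of the Schur functor of `μ`: the coinvariants
`S_μ(V) = (S^μ ⊗ V^{⊗ |μ|})_{Sym}`. -/
def Schur (μ : YoungDiagram) : Type u := (diagRep k μ).Coinvariants

instance (μ : YoungDiagram) : AddCommGroup (Schur k μ) :=
  inferInstanceAs (AddCommGroup (diagRep k μ).Coinvariants)

instance (μ : YoungDiagram) : Module k (Schur k μ) :=
  inferInstanceAs (Module k (diagRep k μ).Coinvariants)

/-- The quotient map `S^μ ⊗ V^{⊗ |μ|} → S_μ(V)`. -/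
def schurMk (μ : YoungDiagram) : SpechtTensor k μ →ₗ[k] Schur k μ :=
  Representation.Coinvariants.mk (diagRep k μ)

variable {k} in
/-- The projection `V^{⊗ |μ|} → S_μ(V)` provided by an element `x` of the Specht module. -/
def schurProj {μ : YoungDiagram} (x : Specht k μ) : TPow k μ.card →ₗ[k] Schur k μ :=
  schurMk k μ ∘ₗ TensorProduct.mk k (Specht k μ) (TPow k μ.card) x

variable {k} in
theorem schur_ext {μ : YoungDiagram} {M : Type*} [AddCommGroup M] [Module k M]
    {f g : Schur k μ →ₗ[k] M} (h : ∀ x v, f (schurProj x v) = g (schurProj x v)) : f = g := by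
  exact Representation.Coinvariants.hom_ext (ρ := diagRep k μ) (TensorProduct.ext' h)

variable {k} in
/-- The action of `g ∈ GL` on `S^μ ⊗ V^{⊗ |μ|}`, as an intertwiner for the symmetric group. -/
def glIntertwiner (μ : YoungDiagram) (g : GLInf k) :
    (diagRep k μ).IntertwiningMap (diagRep k μ) :=
  Representation.IntertwiningMap.lTensor (spechtRep k μ)
    { toLinearMap := glTPow k μ.card g
      isIntertwining' := fun τ => LinearMap.ext fun x => (perm_gl_comm μ.card τ g x).symm }

variable {k} in
/-- The map `S_μ(V) → S_μ(V)` induced by `g ∈ GL`. -/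
def glSchurMap (μ : YoungDiagram) (g : GLInf k) : Schur k μ →ₗ[k] Schur k μ :=
  Representation.Coinvariants.map (diagRep k μ) (diagRep k μ) (glIntertwiner μ g)

variable {k} in
theorem glSchurMap_schurProj {μ : YoungDiagram} (g : GLInf k) (x : Specht k μ)
    (v : TPow k μ.card) :
    glSchurMap μ g (schurProj x v) = schurProj x (glTPow k μ.card g v) := rfl

/-- The action of `GL` on `S_μ(V)`. -/
def glSchur (μ : YoungDiagram) : Representation k (GLInf k) (Schur k μ) where
  toFun g := glSchurMap μ g
  map_one' := schur_ext fun x v => by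
    rw [glSchurMap_schurProj, map_one]; rfl
  map_mul' g h := schur_ext fun x v => by
    rw [Module.End.mul_apply, glSchurMap_schurProj, glSchurMap_schurProj, glSchurMap_schurProj,
      map_mul]; rfl

variable {k}

theorem glSchur_schurProj {μ : YoungDiagram} (g : GLInf k) (x : Specht k μ)
    (v : TPow k μ.card) :
    glSchur k μ g (schurProj x v) = schurProj x (glTPow k μ.card g v) := rfl

theorem schurProj_perm {μ : YoungDiagram} (τ : Perm (Fin μ.card)) (x : Specht k μ)
    (v : TPow k μ.card) :
    schurProj (spechtRep k μ τ x) (permTPow k μ.card τ v) = schurProj x v :=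
  Representation.Coinvariants.mk_self_apply (diagRep k μ) τ (x ⊗ₜ[k] v)

end Schur

/-! ### The rational `GL`-field -/

section GLField

variable {k : Type u} [Field k] {r : ℕ} (σ : Fin r → YoungDiagram)

variable (k) in
/-- The representation `k^{⊕ σ} = ⨁ S_{σ i}(V)` of a tuple of partitions `σ`. -/
abbrev SchurSum : Type u := ⨁ i : Fin r, Schur k (σ i)

variable (k) in
/-- The action of `GL` on `k^{⊕ σ}`. -/
def glSchurSum : Representation k (GLInf k) (SchurSum k σ) :=
  Representation.directSum fun i => glSchur k (σ i)

variable (k) in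
/-- The `GL`-algebra `R = Sym(k^{⊕ σ})`. -/
abbrev SymR : Type u := SymmetricAlgebra k (SchurSum k σ)

variable (k) in
/-- The map `R → R` induced by an element of `GL`. -/
def symMap (g : GLInf k) : SymR k σ →ₐ[k] SymR k σ :=
  SymmetricAlgebra.lift (SymmetricAlgebra.ι k (SchurSum k σ) ∘ₗ glSchurSum k σ g)

theorem symMap_one : symMap k σ 1 = AlgHom.id k _ := by
  apply SymmetricAlgebra.algHom_ext
  rw [symMap, SymmetricAlgebra.lift_comp_ι, map_one]
  rfl

theorem symMap_mul (g h : GLInf k) : symMap k σ (g * h) = (symMap k σ g).comp (symMap k σ h) := by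
  apply SymmetricAlgebra.algHom_ext
  ext x
  simp [symMap]

variable (k) in
/-- The action of `GL` on `R` by algebra automorphisms. -/
def glSymR : GLInf k →* (SymR k σ ≃ₐ[k] SymR k σ) where
  toFun g := AlgEquiv.ofAlgHom (symMap k σ g) (symMap k σ g⁻¹)
    (by rw [← symMap_mul, mul_inv_cancel, symMap_one])
    (by rw [← symMap_mul, inv_mul_cancel, symMap_one])
  map_one' := AlgEquiv.ext fun x => congrArg (fun f => f x) (symMap_one σ)
  map_mul' g h := AlgEquiv.ext fun x => congrArg (fun f => f x) (symMap_mul σ g h)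

variable (k) in
/-- The rational `GL`-field `K = Frac(Sym(k^{⊕ σ}))`. -/
abbrev RatK : Type u := FractionRing (SymR k σ)

variable (k) in
/-- The action of `GL` on `K` by field automorphisms. -/
def glRatK : GLInf k →* (RatK k σ ≃ₐ[k] RatK k σ) :=
  (IsFractionRing.fieldEquivOfAlgEquivHom k (RatK k σ)).comp (glSymR k σ)

variable (k) in
/-- The action of `GL` on `K`, as a representation over `k`. -/
def glRatKRep : Representation k (GLInf k) (RatK k σ) where
  toFun g := (glRatK k σ g).toLinearMap
  map_one' := by rw [map_one]; rfl
  map_mul' g h := by rw [map_mul]; rfl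

theorem glRatK_algebraMap (g : GLInf k) (a : SymR k σ) :
    glRatK k σ g (algebraMap (SymR k σ) (RatK k σ) a) =
      algebraMap (SymR k σ) (RatK k σ) (glSymR k σ g a) :=
  IsFractionRing.fieldEquivOfAlgEquiv_algebraMap k (RatK k σ) (RatK k σ) (glSymR k σ g) a

end GLField

/-! ### `K`-modules -/

section KModule

variable {k : Type u} [Field k]

/-- A representation of `GL` is polynomial if it is a quotient of a subrepresentation of a (possibly
infinite) direct sum of tensor powers of `V`. -/
def IsPolynomialRep {W : Type u} [AddCommGroup W] [Module k W]
    (ρ : Representation k (GLInf k) W) : Prop :=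
  ∃ (ι : Type u) (d : ι → ℕ)
    (N : Subrepresentation (Representation.directSum fun i : ι => glTPow k (d i)))
    (f : N.toRepresentation.IntertwiningMap ρ), Function.Surjective f

/-- The subrepresentation generated by an element. -/
def generatedRep {W : Type u} [AddCommGroup W] [Module k W]
    (ρ : Representation k (GLInf k) W) (x : W) : Subrepresentation ρ where
  toSubmodule := Submodule.span k (Set.range fun g => ρ g x)
  apply_mem_toSubmodule g v hv := by
    refine (Submodule.span_le (p := (Submodule.span k (Set.range fun g => ρ g x)).comap (ρ g))).mpr
      ?_ hv
    rintro _ ⟨h, rfl⟩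
    refine Submodule.subset_span ⟨g * h, ?_⟩
    change ρ (g * h) x = ρ g (ρ h x)
    rw [map_mul]; rfl

/-- An element is polynomial if the subrepresentation that it generates is polynomial. -/
def IsPolynomialElt {W : Type u} [AddCommGroup W] [Module k W]
    (ρ : Representation k (GLInf k) W) (x : W) : Prop :=
  IsPolynomialRep (generatedRep ρ x).toRepresentation

variable {r : ℕ} (σ : Fin r → YoungDiagram)

/-- A `K`-module: a semi-linear representation of `GL` over `K` in which every element is a
`K`-multiple of a polynomial element. -/
structure IsKModule {M : Type u} [AddCommGroup M] [Module k M] [Module (RatK k σ) M]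
    [IsScalarTower k (RatK k σ) M] (ρ : Representation k (GLInf k) M) : Prop where
  semilinear : ∀ (g : GLInf k) (a : RatK k σ) (m : M), ρ g (a • m) = glRatK k σ g a • ρ g m
  polynomial : ∀ m : M, ∃ (a : RatK k σ) (x : M), IsPolynomialElt ρ x ∧ m = a • x

/-- A simple `K`-module: a non-zero `K`-module whose only `GL`-stable `K`-subspaces are zero and the
whole module. (If `m = a x` is a non-zero element of a `GL`-stable `K`-subspace with `x` polynomial,
then `x` is in the subspace too; so such subspaces are exactly the sub-`K`-modules.) -/
structure IsSimpleKModule {M : Type u} [AddCommGroup M] [Module k M] [Module (RatK k σ) M]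
    [IsScalarTower k (RatK k σ) M] (ρ : Representation k (GLInf k) M) : Prop where
  isKModule : IsKModule σ ρ
  nontrivial : Nontrivial M
  eq_bot_or_eq_top : ∀ N : Submodule (RatK k σ) M,
    (∀ (g : GLInf k), ∀ x ∈ N, ρ g x ∈ N) → N = ⊥ ∨ N = ⊤

/-- The restriction of an action to a stable `K`-subspace. -/
def restrictRep {G M : Type*} [Group G] [AddCommGroup M] [Module k M] [Module (RatK k σ) M]
    [IsScalarTower k (RatK k σ) M] (ρ : Representation k G M) (N : Submodule (RatK k σ) M)
    (h : ∀ g, ∀ x ∈ N, ρ g x ∈ N) : Representation k G N where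
  toFun g :=
    { toFun := fun x => ⟨ρ g x, h g x x.2⟩
      map_add' := fun _ _ => Subtype.ext ((ρ g).map_add _ _)
      map_smul' := fun c x => Subtype.ext ((ρ g).map_smul c (x : M)) }
  map_one' := LinearMap.ext fun x => Subtype.ext (LinearMap.congr_fun (map_one ρ) (x : M))
  map_mul' g g' := LinearMap.ext fun x =>
    Subtype.ext (LinearMap.congr_fun (map_mul ρ g g') (x : M))

/-- The semi-linear action of `GL` on `K ⊗ W`. -/
def glFree {W : Type u} [AddCommGroup W] [Module k W] (ρ : Representation k (GLInf k) W) :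
    Representation k (GLInf k) (RatK k σ ⊗[k] W) :=
  (glRatKRep k σ).tprod ρ

variable (k) in
/-- The `K`-module `K^{⊕ μ} = K ⊗ S_μ(V)`. -/
abbrev KSchur (μ : YoungDiagram) : Type u := RatK k σ ⊗[k] Schur k μ

variable (k) in
/-- The `K`-module `Tⁿ = K ⊗ V^{⊗ n}`. -/
abbrev KTensor (n : ℕ) : Type u := RatK k σ ⊗[k] TPow k n

variable (k) in
/-- The action of `GL` on `K^{⊕ μ}`. -/
def glKSchur (μ : YoungDiagram) : Representation k (GLInf k) (KSchur k σ μ) :=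
  glFree σ (glSchur k μ)

variable (k) in
/-- The action of `GL` on `Tⁿ`. -/
def glKTensor (n : ℕ) : Representation k (GLInf k) (KTensor k σ n) :=
  glFree σ (glTPow k n)

variable (k) in
/-- The action of the symmetric group on `Tⁿ`. -/
def permKTensor (n : ℕ) : Representation k (Perm (Fin n)) (KTensor k σ n) where
  toFun τ := TensorProduct.map LinearMap.id (permTPow k n τ)
  map_one' := by rw [map_one]; exact TensorProduct.map_id
  map_mul' τ τ' := by
    refine TensorProduct.ext' fun a v => ?_
    rw [map_mul]; rfl

variable (k) in
/-- The submodule `L_μ` of `K^{⊕ μ}`: the intersection of the kernels of all maps of `K`-modules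
`K^{⊕ μ} → K^{⊕ ν}` with `|ν| < |μ|`. -/
def KL (μ : YoungDiagram) : Submodule (RatK k σ) (KSchur k σ μ) :=
  ⨅ (ν : YoungDiagram) (_ : ν.card < μ.card) (f : KSchur k σ μ →ₗ[RatK k σ] KSchur k σ ν)
    (_ : ∀ (g : GLInf k) (x : KSchur k σ μ), f (glKSchur k σ μ g x) = glKSchur k σ ν g (f x)),
    LinearMap.ker f

theorem KL_stable (μ : YoungDiagram) (g : GLInf k) (x : KSchur k σ μ) (hx : x ∈ KL k σ μ) :
    glKSchur k σ μ g x ∈ KL k σ μ := by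
  simp only [KL, Submodule.mem_iInf, LinearMap.mem_ker] at hx ⊢
  intro ν hν f hf
  rw [hf, hx ν hν f hf, map_zero]

variable (k) in
/-- The action of `GL` on `L_μ`. -/
def glKL (μ : YoungDiagram) : Representation k (GLInf k) (KL k σ μ) :=
  restrictRep σ (glKSchur k σ μ) (KL k σ μ) (KL_stable σ μ)

end KModule

/-! ### Contractions and traceless tensors -/

section Contraction

variable {k : Type u} [Field k] {r : ℕ} (σ : Fin r → YoungDiagram)

variable (k) in
/-- The inclusion of `S_{σ i}(V)` in `K`. -/
def inclK (i : Fin r) : Schur k (σ i) →ₗ[k] RatK k σ :=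
  (IsScalarTower.toAlgHom k (SymR k σ) (RatK k σ)).toLinearMap ∘ₗ
    SymmetricAlgebra.ι k (SchurSum k σ) ∘ₗ
    DirectSum.lof k (Fin r) (fun i => Schur k (σ i)) i

variable (k) in
/-- The form `φ_i : K^{⊕ σ_i} → K`, `a ⊗ w ↦ a w`. -/
def form (i : Fin r) : KSchur k σ (σ i) →ₗ[RatK k σ] RatK k σ :=
  LinearMap.liftBaseChange (RatK k σ) (inclK k σ i)

/-- The map `φ_{i,x} : K ⊗ V^{⊗ |σ_i|} → K ⊗ S_{σ_i}(V) → K`. -/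
def formAt (i : Fin r) (x : Specht k (σ i)) : KTensor k σ (σ i).card →ₗ[RatK k σ] RatK k σ :=
  form k σ i ∘ₗ LinearMap.baseChange (RatK k σ) (schurProj x)

/-- The isomorphism `V^{⊗ n} ≅ V^{⊗ m} ⊗ V^{⊗ m'}` attached to a decomposition of the tensor
factors. -/
def splitTPow {n m m' : ℕ} (e : Fin m ⊕ Fin m' ≃ Fin n) :
    TPow k n →ₗ[k] TPow k m ⊗[k] TPow k m' :=
  ((PiTensorProduct.reindex k (fun _ : Fin n => StdV k) e.symm).trans
    (PiTensorProduct.tmulEquiv k (StdV k)).symm).toLinearMap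

theorem splitTPow_pure {n m m' : ℕ} (e : Fin m ⊕ Fin m' ≃ Fin n) (v : Fin n → StdV k) :
    splitTPow e (pureTensor v) =
      pureTensor (fun j => v (e (Sum.inl j))) ⊗ₜ[k] pureTensor (fun j => v (e (Sum.inr j))) := by
  change (PiTensorProduct.tmulEquiv k (StdV k)).symm
    (PiTensorProduct.reindex k (fun _ : Fin n => StdV k) e.symm (PiTensorProduct.tprod k v)) = _
  rw [PiTensorProduct.reindex_tprod]
  exact PiTensorProduct.tmulEquiv_symm_apply k (StdV k) _

/-- The map `Tⁿ → T^{m'}` that applies a `K`-linear map `T^m → K` to the tensor factors in the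
positions `e (inl j)` and keeps those in the positions `e (inr j)`. -/
def contract {n m m' : ℕ} (e : Fin m ⊕ Fin m' ≃ Fin n)
    (φ : KTensor k σ m →ₗ[RatK k σ] RatK k σ) : KTensor k σ n →ₗ[RatK k σ] KTensor k σ m' :=
  TensorProduct.AlgebraTensorModule.rTensor k (TPow k m') φ ∘ₗ
    (TensorProduct.AlgebraTensorModule.assoc k k (RatK k σ) (RatK k σ) (TPow k m)
      (TPow k m')).symm.toLinearMap ∘ₗ
    LinearMap.baseChange (RatK k σ) (splitTPow e)

/-- The map `φ_{i,x,S} : Tⁿ → T^{n - |σ_i|}`, applying `φ_{i,x}` to the tensor factors indexed by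
the subset `S`. -/
def contraction {n : ℕ} (i : Fin r) (x : Specht k (σ i)) (S : Finset (Fin n))
    (hS : S.card = (σ i).card) :
    KTensor k σ n →ₗ[RatK k σ] KTensor k σ (n - (σ i).card) :=
  contract σ (finSumEquivOfFinset hS (by rw [Finset.card_compl, Fintype.card_fin, hS]))
    (formAt σ i x)

variable (k) in
/-- The space `T^{[n]}` of traceless tensors: the intersection of the kernels of all `φ_{i,x,S}`. -/
def Traceless (n : ℕ) : Submodule (RatK k σ) (KTensor k σ n) :=
  ⨅ (i : Fin r) (x : Specht k (σ i)) (S : Finset (Fin n)) (hS : S.card = (σ i).card),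
    LinearMap.ker (contraction σ i x S hS)

theorem formAt_tmul (i : Fin r) (x : Specht k (σ i)) (a : RatK k σ) (w : TPow k (σ i).card) :
    formAt σ i x (a ⊗ₜ[k] w) = a * inclK k σ i (schurProj x w) := by
  simp [formAt, form]

theorem contract_pure {n m m' : ℕ} (e : Fin m ⊕ Fin m' ≃ Fin n)
    (φ : KTensor k σ m →ₗ[RatK k σ] RatK k σ) (a : RatK k σ) (v : Fin n → StdV k) :
    contract σ e φ (a ⊗ₜ[k] pureTensor v) =
      φ (a ⊗ₜ[k] pureTensor fun j => v (e (Sum.inl j))) ⊗ₜ[k] pureTensor fun j => v (e (Sum.inr j)) := by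
  simp only [contract, LinearMap.comp_apply, LinearMap.baseChange_tmul, splitTPow_pure]
  rfl

theorem KTensor_ext {n : ℕ} {M : Type*} [AddCommGroup M] [Module k M]
    {f g : KTensor k σ n →ₗ[k] M} (h : ∀ a v, f (a ⊗ₜ[k] pureTensor v) = g (a ⊗ₜ[k] pureTensor v)) : f = g := by
  refine TensorProduct.ext (LinearMap.ext fun a => pure_ext fun v => h a v)

theorem glRatK_inclK (g : GLInf k) (i : Fin r) (w : Schur k (σ i)) :
    glRatK k σ g (inclK k σ i w) = inclK k σ i (glSchur k (σ i) g w) := by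
  have h : glSymR k σ g (SymmetricAlgebra.ι k (SchurSum k σ)
      (DirectSum.lof k (Fin r) (fun i => Schur k (σ i)) i w)) =
      SymmetricAlgebra.ι k (SchurSum k σ)
        (DirectSum.lof k (Fin r) (fun i => Schur k (σ i)) i (glSchur k (σ i) g w)) := by
    refine (SymmetricAlgebra.lift_ι_apply _ _).trans ?_
    rw [LinearMap.comp_apply]
    congr 1
    exact DirectSum.lmap_lof _ _ _
  exact (glRatK_algebraMap σ g _).trans (congrArg (algebraMap (SymR k σ) (RatK k σ)) h)

theorem glKTensor_tmul (n : ℕ) (g : GLInf k) (a : RatK k σ) (w : TPow k n) :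
    glKTensor k σ n g (a ⊗ₜ[k] w) = glRatK k σ g a ⊗ₜ[k] glTPow k n g w := rfl

theorem permKTensor_tmul (n : ℕ) (τ : Perm (Fin n)) (a : RatK k σ) (w : TPow k n) :
    permKTensor k σ n τ (a ⊗ₜ[k] w) = a ⊗ₜ[k] permTPow k n τ w := rfl

theorem glKTensor_smul (n : ℕ) (g : GLInf k) (a : RatK k σ) (t : KTensor k σ n) :
    glKTensor k σ n g (a • t) = glRatK k σ g a • glKTensor k σ n g t := by
  induction t using TensorProduct.induction_on with
  | zero => simp
  | tmul b w =>
    rw [TensorProduct.smul_tmul', glKTensor_tmul, glKTensor_tmul, TensorProduct.smul_tmul',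
      smul_eq_mul, smul_eq_mul, map_mul]
  | add x y hx hy => rw [smul_add, map_add, hx, hy, map_add, smul_add]

theorem permKTensor_smul (n : ℕ) (τ : Perm (Fin n)) (a : RatK k σ) (t : KTensor k σ n) :
    permKTensor k σ n τ (a • t) = a • permKTensor k σ n τ t := by
  induction t using TensorProduct.induction_on with
  | zero => simp
  | tmul b w =>
    rw [TensorProduct.smul_tmul', permKTensor_tmul, permKTensor_tmul, TensorProduct.smul_tmul']
  | add x y hx hy => rw [smul_add, map_add, hx, hy, map_add, smul_add]

theorem perm_glKTensor_comm (n : ℕ) (τ : Perm (Fin n)) (g : GLInf k) (t : KTensor k σ n) :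
    permKTensor k σ n τ (glKTensor k σ n g t) = glKTensor k σ n g (permKTensor k σ n τ t) := by
  induction t using TensorProduct.induction_on with
  | zero => simp
  | tmul b w => simp only [glKTensor_tmul, permKTensor_tmul, perm_gl_comm]
  | add x y hx hy => simp only [map_add, hx, hy]

theorem formAt_gl (i : Fin r) (x : Specht k (σ i)) (g : GLInf k) (a : RatK k σ)
    (w : TPow k (σ i).card) :
    formAt σ i x (glRatK k σ g a ⊗ₜ[k] glTPow k (σ i).card g w) =
      glRatK k σ g (formAt σ i x (a ⊗ₜ[k] w)) := by
  rw [formAt_tmul, formAt_tmul, map_mul, glRatK_inclK, glSchur_schurProj]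

theorem contraction_gl {n : ℕ} (i : Fin r) (x : Specht k (σ i)) (S : Finset (Fin n))
    (hS : S.card = (σ i).card) (g : GLInf k) (t : KTensor k σ n) :
    contraction σ i x S hS (glKTensor k σ n g t) =
      glKTensor k σ (n - (σ i).card) g (contraction σ i x S hS t) := by
  refine LinearMap.congr_fun
    (f := (contraction σ i x S hS).restrictScalars k ∘ₗ glKTensor k σ n g)
    (g := glKTensor k σ (n - (σ i).card) g ∘ₗ (contraction σ i x S hS).restrictScalars k)
    (KTensor_ext σ fun a v => ?_) t
  simp only [LinearMap.comp_apply, LinearMap.restrictScalars_apply, glKTensor_tmul, glTPow_pure,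
    contraction, contract_pure]
  rw [← formAt_gl, glTPow_pure]

theorem Traceless_gl_stable (n : ℕ) (g : GLInf k) (t : KTensor k σ n) (ht : t ∈ Traceless k σ n) :
    glKTensor k σ n g t ∈ Traceless k σ n := by
  simp only [Traceless, Submodule.mem_iInf, LinearMap.mem_ker] at ht ⊢
  intro i x S hS
  rw [contraction_gl, ht i x S hS, map_zero]

theorem contraction_perm {n : ℕ} (i : Fin r) (x : Specht k (σ i)) (S : Finset (Fin n))
    (hS : S.card = (σ i).card) (τ : Perm (Fin n)) :
    ∃ (y : Specht k (σ i)) (S' : Finset (Fin n)) (hS' : S'.card = (σ i).card)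
      (ρ : Perm (Fin (n - (σ i).card))), ∀ t : KTensor k σ n,
      contraction σ i x S hS (permKTensor k σ n τ t) =
        permKTensor k σ (n - (σ i).card) ρ (contraction σ i y S' hS' t) := by
  have hc : ∀ U : Finset (Fin n), U.card = (σ i).card → Uᶜ.card = n - (σ i).card := by
    intro U hU; rw [Finset.card_compl, Fintype.card_fin, hU]
  have hS' : (S.map τ.symm.toEmbedding).card = (σ i).card := by rw [Finset.card_map, hS]
  let e := finSumEquivOfFinset hS (hc S hS)
  let e' := finSumEquivOfFinset hS' (hc _ hS')
  have hmaps : Set.MapsTo ((e.trans τ.symm).trans e'.symm) (Set.range Sum.inl)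
      (Set.range Sum.inl) := by
    rintro _ ⟨j, rfl⟩
    have h1 : τ.symm (e (Sum.inl j)) ∈ S.map τ.symm.toEmbedding := by
      refine Finset.mem_map_of_mem τ.symm.toEmbedding (?_ : e (Sum.inl j) ∈ S)
      change finSumEquivOfFinset hS (hc S hS) (Sum.inl j) ∈ S
      rw [finSumEquivOfFinset_inl]
      exact Finset.orderEmbOfFin_mem _ _ _
    have h2 : τ.symm (e (Sum.inl j)) ∈
        Set.range ((S.map τ.symm.toEmbedding).orderEmbOfFin hS') := by
      rw [Finset.range_orderEmbOfFin]; exact h1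
    obtain ⟨l, hl⟩ := h2
    refine ⟨l, ?_⟩
    change Sum.inl l = e'.symm (τ.symm (e (Sum.inl j)))
    rw [Equiv.eq_symm_apply, ← hl]
    exact finSumEquivOfFinset_inl _ _ _
  obtain ⟨⟨p, q⟩, hpq⟩ := Equiv.Perm.mem_sumCongrHom_range_of_perm_mapsTo_inl hmaps
  have hp : ∀ j, τ.symm (e (Sum.inl j)) = e' (Sum.inl (p j)) := by
    intro j
    have := congrArg (fun f => e' (f (Sum.inl j))) hpq
    simpa using this.symm
  have hq : ∀ j, τ.symm (e (Sum.inr j)) = e' (Sum.inr (q j)) := by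
    intro j
    have := congrArg (fun f => e' (f (Sum.inr j))) hpq
    simpa using this.symm
  refine ⟨spechtRep k (σ i) p x, _, hS', q⁻¹, fun t => ?_⟩
  refine LinearMap.congr_fun
    (f := (contraction σ i x S hS).restrictScalars k ∘ₗ permKTensor k σ n τ)
    (g := permKTensor k σ (n - (σ i).card) q⁻¹ ∘ₗ
      (contraction σ i (spechtRep k (σ i) p x) _ hS').restrictScalars k)
    (KTensor_ext σ fun a v => ?_) t
  simp only [LinearMap.comp_apply, LinearMap.restrictScalars_apply, permKTensor_tmul,
    permTPow_pure, contraction, contract_pure, formAt_tmul]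
  change (a * inclK k σ i (schurProj x (pureTensor fun j => v (τ.symm (e (Sum.inl j)))))) ⊗ₜ[k]
      pureTensor (fun j => v (τ.symm (e (Sum.inr j)))) =
    (a * inclK k σ i (schurProj (spechtRep k (σ i) p x) (pureTensor fun j => v (e' (Sum.inl j))))) ⊗ₜ[k]
      pureTensor (fun j => v (e' (Sum.inr (q j))))
  simp only [hp, hq]
  rw [← schurProj_perm p x, permTPow_pure]
  simp

theorem Traceless_perm_stable (n : ℕ) (τ : Perm (Fin n)) (t : KTensor k σ n)
    (ht : t ∈ Traceless k σ n) : permKTensor k σ n τ t ∈ Traceless k σ n := by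
  simp only [Traceless, Submodule.mem_iInf, LinearMap.mem_ker] at ht ⊢
  intro i x S hS
  obtain ⟨y, S', hS', ρ, h⟩ := contraction_perm σ i x S hS τ
  rw [h, ht i y S' hS', map_zero]

variable (k) in
/-- The action of `GL` on `T^{[n]}`. -/
def glTraceless (n : ℕ) : Representation k (GLInf k) (Traceless k σ n) :=
  restrictRep σ (glKTensor k σ n) (Traceless k σ n) (Traceless_gl_stable σ n)

variable (k) in
/-- The action of the symmetric group on `T^{[n]}`. -/
def permTraceless (n : ℕ) : Representation k (Perm (Fin n)) (Traceless k σ n) :=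
  restrictRep σ (permKTensor k σ n) (Traceless k σ n) (Traceless_perm_stable σ n)

variable (k) in
/-- The `S^μ`-isotypic piece of `T^{[n]}`, `n = |μ|`, as a `K`-module: the multiplicity space
`Hom_{Sym}(S^μ, T^{[n]})`. -/
def isotypicPiece (μ : YoungDiagram) :
    Submodule (RatK k σ) (Specht k μ →ₗ[k] Traceless k σ μ.card) where
  carrier := {f | ∀ (τ : Perm (Fin μ.card)) (x : Specht k μ),
    f (spechtRep k μ τ x) = permTraceless k σ μ.card τ (f x)}
  zero_mem' τ x := by simp
  add_mem' {f f'} hf hf' τ x := by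
    rw [LinearMap.add_apply, LinearMap.add_apply, hf, hf', map_add]
  smul_mem' a f hf τ x := by
    rw [LinearMap.smul_apply, LinearMap.smul_apply, hf]
    exact Subtype.ext (permKTensor_smul σ μ.card τ a _).symm

variable (k) in
/-- The action of `GL` on the `S^μ`-isotypic piece of `T^{[n]}`, by composition with its action on
`T^{[n]}`. -/
def glIsotypicPiece (μ : YoungDiagram) :
    Representation k (GLInf k) (isotypicPiece k σ μ) where
  toFun g :=
    { toFun := fun f => ⟨glTraceless k σ μ.card g ∘ₗ f.1, fun τ x => by
        rw [LinearMap.comp_apply, LinearMap.comp_apply, f.2 τ x]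
        exact Subtype.ext (perm_glKTensor_comm σ μ.card τ g (f.1 x)).symm⟩
      map_add' := fun f f' => Subtype.ext (LinearMap.comp_add _ _ _)
      map_smul' := fun c f => Subtype.ext (LinearMap.comp_smul _ _ _) }
  map_one' := LinearMap.ext fun f => Subtype.ext <| LinearMap.ext fun x =>
    LinearMap.congr_fun (map_one (glTraceless k σ μ.card)) (f.1 x)
  map_mul' g h := LinearMap.ext fun f => Subtype.ext <| LinearMap.ext fun x =>
    LinearMap.congr_fun (map_mul (glTraceless k σ μ.card) g h) (f.1 x)

/-- The isotypic component of a representation `ρ` of type `ρ'`: the sum of all subrepresentations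
of `ρ` isomorphic to `ρ'`. -/
def isotypicComp {G M S : Type*} [Group G] [AddCommGroup M] [Module k M] [AddCommGroup S]
    [Module k S] (ρ : Representation k G M) (ρ' : Representation k G S) : Submodule k M :=
  ⨆ (W : Subrepresentation ρ) (_ : Nonempty (W.toRepresentation.Equiv ρ')), W.toSubmodule

end Contraction

end WeylConstruction

end

open WeylConstruction

noncomputable section

set_option linter.unusedSectionVars false

namespace WeylConstruction

/-! Put n = |λ| and let c = ab be the product of the row sum a and the signed column sum b of the
tableau of λ. In characteristic 0, K^{⊕λ} is the image of c on T^n (`kEmb`, `kProj`). Everything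
rests on two facts: L_λ consists of the traceless tensors in this image (`mem_KL_iff`), and every
nonzero stable K-subspace of K^{⊕λ} contains all of them (`mem_of_kEmb_mem_traceless`).

One half of the first fact is formal. A contraction lands in some T^m with m < n, and the
equivariant maps from T^m to the K^{⊕ν} with |ν| = m are jointly injective, because the unit of the
group algebra is a combination of elements x c_t y with c_t a Young symmetrizer
(`one_mem_span_symmetrizers`, `eq_zero_of_forall_kSchur`). The other half and the simplicity both
follow from `single_act_symmetrizer_mem`: let Q be a stable K-subspace of a finite product of spaces
T^m with a single factor T^n of largest degree; if the components of Q in T^n lie in the image of c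
and are not all zero, then Q contains c y, placed in that factor, for every traceless y. For the
simplicity the product has one factor; for L_λ, Q is the graph of a map K^{⊕λ} → K^{⊕ν}.

The core is `exists_act_mem`. After clearing denominators, an element of Q is a k-combination of
monomials: products of forms φ_i with a basis tensor. Weights and polarization make it multilinear,
each index occurring once in each monomial. Transvections and K-linearity then allow each index to
be replaced by any vector with coefficients in K, not only in k. Fix indices B that form the output
of some monomial with nonzero total coefficient in T^n, put a traceless y at B, and put fixed
vectors h at the other indices. A form with all its arguments in B contracts y and gives 0. A form
with arguments of both kinds vanishes if h is well chosen. In the remaining monomials all of B goes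
to the output, which by maximality of the degree is a permutation of B. So Q contains z y for an
element z of the group algebra whose coefficient at 1 is the value at h of the coefficient of B.

The choice of h (`exists_selection`) expresses the independence of the forms. If it were impossible
for one vector, a linear form would be a K-combination of mixed forms. For large i, evaluate this
relation at e_i: its coefficients do not involve the coordinate i, so the translations w ↦ w + θ(w)
of the field K, with θ involving only that coordinate, turn it into a relation in K ⊗ ⨁ S_{σ_i}(V)
itself (`Separated.eventually_eq_zero`). There, endomorphisms of V separate the two sides.

Pure tensors in vectors with disjoint supports on which all forms vanish give traceless tensors on
which the group algebra acts freely (`exists_traceless_free`); hence cz ≠ 0, and the minimality of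
the right ideal of c replaces z by c. Finally, evaluation at the generator ba of S^λ identifies
Hom(S^λ, T^{[n]}) with L_λ, and evaluation identifies L_λ ⊗ S^λ with the isotypic component. -/

/-! ### Young diagrams and tableaux -/

section Counting

variable {lam mu : YoungDiagram}

/-- The cells of `mu` in the first `j` rows and column `l`. -/
theorem card_cells_lt_col (mu : YoungDiagram) (j l : ℕ) :
    (Finset.univ.filter fun v : mu.cells => v.1.1 < j ∧ v.1.2 = l).card = min j (mu.colLen l) := by
  rw [← Finset.card_range (min j (mu.colLen l))]
  refine Finset.card_bij (fun v _ => v.1.1) ?_ ?_ ?_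
  · rintro ⟨⟨a, b⟩, hv⟩ h
    simp only [Finset.mem_filter, Finset.mem_univ, true_and] at h
    obtain ⟨h1, rfl⟩ := h
    rw [Finset.mem_range, lt_min_iff]
    exact ⟨h1, YoungDiagram.mem_iff_lt_colLen.mp hv⟩
  · rintro ⟨⟨a, b⟩, hv⟩ h ⟨⟨a', b'⟩, hv'⟩ h' e
    simp only [Finset.mem_filter, Finset.mem_univ, true_and] at h h' e
    obtain ⟨h1, rfl⟩ := h
    obtain ⟨h2, rfl⟩ := h'
    subst e; rfl
  · intro a ha
    rw [Finset.mem_range, lt_min_iff] at ha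
    exact ⟨⟨(a, l), YoungDiagram.mem_iff_lt_colLen.mpr ha.2⟩, by simp [ha.1], rfl⟩

theorem exists_col_bound (mu : YoungDiagram) : ∃ B, ∀ v : mu.cells, v.1.2 < B :=
  ⟨mu.rowLen 0, fun v => YoungDiagram.mem_iff_lt_rowLen.mp
    (mu.up_left_mem (Nat.zero_le _) le_rfl v.2)⟩

/-- A bijection of the cells of two diagrams that moves the cells of each row into different
columns. -/
def SeparatesRows (y : lam.cells ≃ mu.cells) : Prop :=
  ∀ u v : lam.cells, u ≠ v → u.1.1 = v.1.1 → (y u).1.2 ≠ (y v).1.2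

variable {y : lam.cells ≃ mu.cells}

/-- Cells sent to one column lie in pairwise different rows, which gives the bound `j`; the
injectivity of `y` gives the bound `mu.colLen l`. -/
theorem SeparatesRows.card_le (hy : SeparatesRows y) (j l : ℕ) :
    (Finset.univ.filter fun u : lam.cells => u.1.1 < j ∧ (y u).1.2 = l).card ≤
      min j (mu.colLen l) := by
  refine le_min ?_ ?_
  · rw [← Finset.card_range j]
    refine Finset.card_le_card_of_injOn (fun u => u.1.1) (fun u hu => ?_) fun u hu v hv e => ?_
    · simp only [Finset.coe_filter, Finset.mem_univ, true_and, Set.mem_ofPred_eq] at hu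
      simpa using hu.1
    · simp only [Finset.coe_filter, Finset.mem_univ, true_and, Set.mem_ofPred_eq] at hu hv
      by_contra hne
      exact hy u v hne e (hu.2.trans hv.2.symm)
  · rw [YoungDiagram.colLen_eq_card]
    refine Finset.card_le_card_of_injOn (fun u => (y u).1) (fun u hu => ?_) fun u _ v _ e => ?_
    · simp only [Finset.coe_filter, Finset.mem_univ, true_and, Set.mem_ofPred_eq] at hu
      exact YoungDiagram.mem_col_iff.mpr ⟨(y u).2, hu.2⟩
    · exact y.injective (Subtype.ext e)

theorem card_rows_eq_sum (y : lam.cells ≃ mu.cells) {B : ℕ} (hB : ∀ v : mu.cells, v.1.2 < B)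
    (j : ℕ) :
    (Finset.univ.filter fun u : lam.cells => u.1.1 < j).card =
      ∑ l ∈ Finset.range B,
        (Finset.univ.filter fun u : lam.cells => u.1.1 < j ∧ (y u).1.2 = l).card := by
  rw [Finset.card_eq_sum_card_fiberwise (f := fun u => (y u).1.2) (t := Finset.range B)
    (fun u _ => by simpa using hB (y u))]
  simp only [Finset.filter_filter]

/-- This is the dominance order: summed over the columns, the bounds of `card_le` are attained by
the identity of `mu`. -/
theorem SeparatesRows.card_rows_le (hy : SeparatesRows y) (j : ℕ) :
    (Finset.univ.filter fun u : lam.cells => u.1.1 < j).card ≤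
      (Finset.univ.filter fun u : mu.cells => u.1.1 < j).card := by
  obtain ⟨B, hB⟩ := exists_col_bound mu
  rw [card_rows_eq_sum y hB, card_rows_eq_sum (Equiv.refl mu.cells) hB]
  refine Finset.sum_le_sum fun l _ => (hy.card_le j l).trans_eq ?_
  exact (card_cells_lt_col mu j l).symm

theorem card_rows_succ (mu : YoungDiagram) (j : ℕ) :
    (Finset.univ.filter fun u : mu.cells => u.1.1 < j + 1).card =
      (Finset.univ.filter fun u : mu.cells => u.1.1 < j).card + mu.rowLen j := by
  have h : mu.rowLen j = (Finset.univ.filter fun u : mu.cells => u.1.1 = j).card := by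
    rw [YoungDiagram.rowLen_eq_card]
    refine (Finset.card_bij (fun v _ => v.1) ?_ ?_ ?_).symm
    · intro v hv
      exact YoungDiagram.mem_row_iff.mpr ⟨v.2, by simpa using hv⟩
    · intro v _ w _ e
      exact Subtype.ext e
    · intro c hc
      rw [YoungDiagram.mem_row_iff] at hc
      exact ⟨⟨c, hc.1⟩, by simpa using hc.2, rfl⟩
  rw [h, ← Finset.card_union_of_disjoint]
  · congr 1
    ext u
    simp only [Finset.mem_filter, Finset.mem_univ, true_and, Finset.mem_union]
    omega
  · rw [Finset.disjoint_filter]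
    intro u _ h1 h2
    omega

theorem eq_of_card_rows_eq
    (h : ∀ j, (Finset.univ.filter fun u : lam.cells => u.1.1 < j).card =
      (Finset.univ.filter fun u : mu.cells => u.1.1 < j).card) : lam = mu := by
  have hrow : ∀ j, lam.rowLen j = mu.rowLen j := by
    intro j
    have h1 := h (j + 1)
    rw [card_rows_succ, card_rows_succ, h j] at h1
    omega
  ext ⟨a, b⟩
  rw [YoungDiagram.mem_cells, YoungDiagram.mem_cells, YoungDiagram.mem_iff_lt_rowLen,
    YoungDiagram.mem_iff_lt_rowLen, hrow]

theorem SeparatesRows.eq_of_both (hy : SeparatesRows y) {y' : mu.cells ≃ lam.cells}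
    (hy' : SeparatesRows y') : lam = mu :=
  eq_of_card_rows_eq fun j => le_antisymm (hy.card_rows_le j) (hy'.card_rows_le j)

variable {y : mu.cells ≃ mu.cells}

/-- For equal shapes the two sums over the columns agree, so each of the termwise inequalities is an
equality. -/
theorem SeparatesRows.card_eq (hy : SeparatesRows y) (j l : ℕ) :
    (Finset.univ.filter fun u : mu.cells => u.1.1 < j ∧ (y u).1.2 = l).card =
      min j (mu.colLen l) := by
  obtain ⟨B, hB⟩ := exists_col_bound mu
  have h := card_rows_eq_sum y hB j
  rw [card_rows_eq_sum (Equiv.refl mu.cells) hB] at h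
  by_cases hl : l < B
  · by_contra hne
    have hlt := lt_of_le_of_ne (hy.card_le j l) hne
    refine absurd h (ne_of_gt (Finset.sum_lt_sum (fun l' _ => ?_) ⟨l, Finset.mem_range.mpr hl, ?_⟩))
    · exact (hy.card_le j l').trans_eq (card_cells_lt_col mu j l').symm
    · exact hlt.trans_eq (card_cells_lt_col mu j l).symm
  · rw [← card_cells_lt_col, Finset.filter_false_of_mem, Finset.filter_false_of_mem]
    · intro u _ hu; exact hl (hu.2 ▸ hB u)
    · intro u _ hu; exact hl (hu.2 ▸ hB (y u))

/-- Passing from the rows above `u` to those up to the row of `u` strictly increases the count in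
the column of `y u`. Since the count is `min j (colLen l)`, this column reaches the row of `u`. -/
theorem SeparatesRows.mem (hy : SeparatesRows y) (u : mu.cells) :
    (u.1.1, (y u).1.2) ∈ mu.cells := by
  have h1 := hy.card_eq (u.1.1 + 1) (y u).1.2
  have h0 := hy.card_eq u.1.1 (y u).1.2
  have hlt : (Finset.univ.filter fun v : mu.cells => v.1.1 < u.1.1 ∧ (y v).1.2 = (y u).1.2).card <
      (Finset.univ.filter fun v : mu.cells => v.1.1 < u.1.1 + 1 ∧ (y v).1.2 = (y u).1.2).card := by
    refine Finset.card_lt_card ((Finset.ssubset_iff_of_subset ?_).mpr ⟨u, by simp, by simp⟩)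
    intro v hv
    simp only [Finset.mem_filter, Finset.mem_univ, true_and] at hv ⊢
    exact ⟨by omega, hv.2⟩
  rw [h0, h1] at hlt
  exact YoungDiagram.mem_iff_lt_colLen.mpr (by omega)

/-- A bijection that moves the cells of each row into different columns is the product of one that
preserves the rows and one that preserves the columns. -/
theorem SeparatesRows.exists_factor (hy : SeparatesRows y) :
    ∃ p q : mu.cells ≃ mu.cells, (∀ u, (p u).1.1 = u.1.1) ∧ (∀ u, (q u).1.2 = u.1.2) ∧
      ∀ u, q (p u) = y u := by
  -- The row part moves `u` inside its row to the column where `y` sends it; the column part does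
  -- the rest.
  let f : mu.cells → mu.cells := fun u => ⟨(u.1.1, (y u).1.2), hy.mem u⟩
  have hf : Function.Injective f := by
    intro u v e
    have e' : (f u).1 = (f v).1 := congrArg Subtype.val e
    have e1 : (f u).1.1 = (f v).1.1 := congrArg Prod.fst e'
    have e2 : (f u).1.2 = (f v).1.2 := congrArg Prod.snd e'
    by_contra hne
    exact hy u v hne e1 e2
  let p : mu.cells ≃ mu.cells := Equiv.ofBijective f (Finite.injective_iff_bijective.mp hf)
  refine ⟨p, p.symm.trans y, fun u => rfl, fun u => ?_, fun u => by simp⟩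
  obtain ⟨v, rfl⟩ := p.surjective u
  simp only [Equiv.trans_apply, Equiv.symm_apply_apply]
  rfl

end Counting

/-! ### Young symmetrizers -/

section Symmetrizer

variable {α : Type*} [Fintype α] [DecidableEq α] (F : Type*) [Field F]
  {lam mu : YoungDiagram}

/-- The permutations of the entries of a tableau that preserve its rows. -/
def rowSub (t : α ≃ mu.cells) : Subgroup (Perm α) where
  carrier := {p | ∀ i, (t (p i)).1.1 = (t i).1.1}
  one_mem' _ := rfl
  mul_mem' {p q} hp hq i := (hp (q i)).trans (hq i)
  inv_mem' {p} hp i := by simpa using (hp (p⁻¹ i)).symm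

/-- The permutations of the entries of a tableau that preserve its columns. -/
def colSub (t : α ≃ mu.cells) : Subgroup (Perm α) where
  carrier := {p | ∀ i, (t (p i)).1.2 = (t i).1.2}
  one_mem' _ := rfl
  mul_mem' {p q} hp hq i := (hp (q i)).trans (hq i)
  inv_mem' {p} hp i := by simpa using (hp (p⁻¹ i)).symm

open Classical in
/-- The sum of the row permutations of a tableau. -/
def rowSum (t : α ≃ mu.cells) : MonoidAlgebra F (Perm α) :=
  ∑ p : Perm α with p ∈ rowSub t, MonoidAlgebra.single p (1 : F)

open Classical in
/-- The signed sum of the column permutations of a tableau. -/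
def colSum (t : α ≃ mu.cells) : MonoidAlgebra F (Perm α) :=
  ∑ q : Perm α with q ∈ colSub t, MonoidAlgebra.single q (((Equiv.Perm.sign q : ℤ) : F))

variable {F}

theorem single_eq_smul {G : Type*} (g : G) (a : F) :
    MonoidAlgebra.single g a = a • MonoidAlgebra.single g (1 : F) := by
  rw [MonoidAlgebra.smul_single, smul_eq_mul, mul_one]

theorem eq_zero_of_eq_neg (F : Type*) [Field F] [CharZero F] {M : Type*} [AddCommGroup M]
    [Module F M] {x : M} (h : x = -x) : x = 0 := by
  have h2 : (2 : F) • x = 0 := by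
    rw [two_smul]
    nth_rewrite 2 [h]
    exact add_neg_cancel x
  exact (smul_eq_zero.mp h2).resolve_left two_ne_zero

theorem rowSum_mul_single (t : α ≃ mu.cells) {p : Perm α} (hp : p ∈ rowSub t) :
    rowSum F t * MonoidAlgebra.single p (1 : F) = rowSum F t := by
  classical
  rw [rowSum, Finset.sum_mul]
  refine Finset.sum_equiv (Equiv.mulRight p) (fun q => ?_) fun q _ => ?_
  · simp [(rowSub t).mul_mem_cancel_right hp]
  · simp [MonoidAlgebra.single_mul_single]

theorem single_mul_colSum (t : α ≃ mu.cells) {p : Perm α} (hp : p ∈ colSub t) :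
    MonoidAlgebra.single p (1 : F) * colSum F t = ((Equiv.Perm.sign p : ℤ) : F) • colSum F t := by
  classical
  rw [colSum, Finset.mul_sum, Finset.smul_sum]
  refine Finset.sum_equiv (Equiv.mulLeft p) (fun q => ?_) fun q _ => ?_
  · simp [(colSub t).mul_mem_cancel_left hp]
  · rcases Int.units_eq_one_or (Equiv.Perm.sign p) with h | h <;>
      simp [MonoidAlgebra.single_mul_single, h]

/-- Two entries in one row of `t` come from two entries in one column of `t'`. The transposition of
the former is absorbed by the row sum; carried across `w`, it becomes the transposition of the
latter, which the column sum absorbs with sign -1. -/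
theorem rowSum_mul_single_mul_colSum_eq_zero [CharZero F] (t : α ≃ lam.cells) (t' : α ≃ mu.cells)
    (w : Perm α)
    (h : ¬ SeparatesRows ((t.symm.trans w.symm).trans t')) :
    rowSum F t * MonoidAlgebra.single w (1 : F) * colSum F t' = 0 := by
  simp only [SeparatesRows, not_forall, not_not] at h
  obtain ⟨u, v, huv, hrow, hcol⟩ := h
  set i := t.symm u
  set j := t.symm v
  have hij : i ≠ j := fun e => huv (t.symm.injective e)
  have hs : Equiv.swap i j ∈ rowSub t := by
    intro l
    rcases eq_or_ne l i with rfl | hli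
    · simp [i, j, hrow]
    rcases eq_or_ne l j with rfl | hlj
    · simp [i, j, hrow]
    · rw [Equiv.swap_apply_of_ne_of_ne hli hlj]
  have hs' : Equiv.swap (w.symm i) (w.symm j) ∈ colSub t' := by
    have hcol' : (t' (w.symm i)).1.2 = (t' (w.symm j)).1.2 := hcol
    intro l
    rcases eq_or_ne l (w.symm i) with rfl | hli
    · rw [Equiv.swap_apply_left, hcol']
    rcases eq_or_ne l (w.symm j) with rfl | hlj
    · rw [Equiv.swap_apply_right, hcol']
    · rw [Equiv.swap_apply_of_ne_of_ne hli hlj]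
  have hcomm : Equiv.swap i j * w = w * Equiv.swap (w.symm i) (w.symm j) := by
    rw [Equiv.mul_swap_eq_swap_mul, Equiv.apply_symm_apply, Equiv.apply_symm_apply]
  have key : rowSum F t * MonoidAlgebra.single w (1 : F) * colSum F t' =
      -(rowSum F t * MonoidAlgebra.single w (1 : F) * colSum F t') := by
    conv_lhs => rw [← rowSum_mul_single t hs]
    rw [mul_assoc (rowSum F t), MonoidAlgebra.single_mul_single, hcomm, one_mul,
      ← one_mul (1 : F), ← MonoidAlgebra.single_mul_single, one_mul, mul_assoc, mul_assoc,
      single_mul_colSum t' hs', Equiv.Perm.sign_swap (fun e => hij (w.symm.injective e))]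
    simp [mul_assoc]
  exact eq_zero_of_eq_neg F key

/-- If `w` does not give 0, it is the product of a row permutation and a column permutation, which
the two sums absorb up to sign. -/
theorem rowSum_mul_single_mul_colSum [CharZero F] (t : α ≃ mu.cells) (w : Perm α) :
    ∃ s : F, rowSum F t * MonoidAlgebra.single w (1 : F) * colSum F t =
      s • (rowSum F t * colSum F t) := by
  by_cases h : SeparatesRows ((t.symm.trans w.symm).trans t)
  · obtain ⟨p, q, hp, hq, hpq⟩ := h.exists_factor
    let p' : Perm α := (t.trans p).trans t.symm
    let q' : Perm α := (t.trans q).trans t.symm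
    have hp' : p' ∈ rowSub t := fun i => by simp [p', hp]
    have hq' : q' ∈ colSub t := fun i => by simp [q', hq]
    have hw : w = p'⁻¹ * q'⁻¹ := by
      rw [← mul_inv_rev]
      refine eq_inv_of_mul_eq_one_right ?_
      ext i
      have := hpq (t (w i))
      simp only [Equiv.trans_apply, Equiv.symm_apply_apply] at this
      simp [p', q', this]
    refine ⟨((Equiv.Perm.sign q'⁻¹ : ℤ) : F), ?_⟩
    rw [hw, ← one_mul (1 : F), ← MonoidAlgebra.single_mul_single, ← mul_assoc,
      rowSum_mul_single t ((rowSub t).inv_mem hp'), mul_assoc,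
      single_mul_colSum t ((colSub t).inv_mem hq'), mul_smul_comm]
  · exact ⟨0, by rw [rowSum_mul_single_mul_colSum_eq_zero t t w h, zero_smul]⟩

theorem rowSum_mul_mul_colSum [CharZero F] (t : α ≃ mu.cells) (w : MonoidAlgebra F (Perm α)) :
    ∃ s : F, rowSum F t * w * colSum F t = s • (rowSum F t * colSum F t) := by
  induction w using MonoidAlgebra.induction_linear with
  | zero => exact ⟨0, by simp⟩
  | add x y hx hy =>
    obtain ⟨a, ha⟩ := hx
    obtain ⟨b, hb⟩ := hy
    exact ⟨a + b, by rw [mul_add, add_mul, ha, hb, add_smul]⟩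
  | single g a =>
    obtain ⟨s, hs⟩ := rowSum_mul_single_mul_colSum (F := F) t g
    refine ⟨a * s, ?_⟩
    rw [mul_smul, ← hs, single_eq_smul, mul_smul_comm, smul_mul_assoc]

/-- If neither order of the factors gave 0, each shape would dominate the other. -/
theorem rowSum_mul_mul_colSum_eq_zero [CharZero F] (t : α ≃ lam.cells) (t' : α ≃ mu.cells)
    (h : lam ≠ mu) :
    (∀ w : MonoidAlgebra F (Perm α), rowSum F t * w * colSum F t' = 0) ∨
      ∀ w : MonoidAlgebra F (Perm α), rowSum F t' * w * colSum F t = 0 := by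
  have aux : ∀ (lam mu : YoungDiagram) (t : α ≃ lam.cells) (t' : α ≃ mu.cells),
      (∀ w : Perm α, ¬ SeparatesRows ((t.symm.trans w.symm).trans t')) →
      ∀ w : MonoidAlgebra F (Perm α), rowSum F t * w * colSum F t' = 0 := by
    intro lam mu t t' H w
    induction w using MonoidAlgebra.induction_linear with
    | zero => simp
    | add x y hx hy => rw [mul_add, add_mul, hx, hy, add_zero]
    | single g a =>
      rw [single_eq_smul, mul_smul_comm, smul_mul_assoc, rowSum_mul_single_mul_colSum_eq_zero t t' g (H g), smul_zero]
  by_cases h1 : ∀ w : Perm α, ¬ SeparatesRows ((t.symm.trans w.symm).trans t')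
  · exact Or.inl (aux _ _ t t' h1)
  by_cases h2 : ∀ w : Perm α, ¬ SeparatesRows ((t'.symm.trans w.symm).trans t)
  · exact Or.inr (aux _ _ t' t h2)
  push Not at h1 h2
  obtain ⟨w, hw⟩ := h1
  obtain ⟨w', hw'⟩ := h2
  exact absurd (hw.eq_of_both hw') h

end Symmetrizer

/-! ### The trace form of a group algebra. -/

section GroupAlgebra

variable {G : Type*} [Group G] {F : Type*} [Field F]

theorem coeff_one_mul_comm (x y : MonoidAlgebra F G) : (x * y).coeff 1 = (y * x).coeff 1 := by
  classical
  induction x using MonoidAlgebra.induction_linear with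
  | zero => simp
  | add x x' hx hx' => simp only [add_mul, mul_add, MonoidAlgebra.coeff_add, Finsupp.add_apply, hx, hx']
  | single g a =>
    induction y using MonoidAlgebra.induction_linear with
    | zero => simp
    | add y y' hy hy' => simp only [add_mul, mul_add, MonoidAlgebra.coeff_add, Finsupp.add_apply, hy, hy']
    | single h b =>
      have : g * h = 1 ↔ h * g = 1 := mul_eq_one_comm
      simp only [MonoidAlgebra.single_mul_single, MonoidAlgebra.coeff_single, Finsupp.single_apply,
        this, mul_comm a b]

theorem eq_zero_of_coeff_one_mul {x : MonoidAlgebra F G}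
    (h : ∀ y : MonoidAlgebra F G, (x * y).coeff 1 = 0) : x = 0 := by
  ext g
  have := h (MonoidAlgebra.single g⁻¹ 1)
  simpa using this

/-- The inversion `g ↦ g⁻¹`, extended linearly to the group algebra. -/
def invMap (F : Type*) [Field F] (G : Type*) [Group G] : MonoidAlgebra F G →ₗ[F] MonoidAlgebra F G where
  toFun := MonoidAlgebra.mapDomain Inv.inv
  map_add' := MonoidAlgebra.mapDomain_add _
  map_smul' c x := by
    ext; simp [MonoidAlgebra.mapDomain, Finsupp.mapDomain_smul]

@[simp] theorem invMap_single (g : G) (a : F) :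
    invMap F G (MonoidAlgebra.single g a) = MonoidAlgebra.single g⁻¹ a :=
  MonoidAlgebra.mapDomain_single

theorem invMap_mul (x y : MonoidAlgebra F G) :
    invMap F G (x * y) = invMap F G y * invMap F G x := by
  induction x using MonoidAlgebra.induction_linear with
  | zero => simp
  | add x x' hx hx' => rw [add_mul, map_add, hx, hx', map_add, mul_add]
  | single g a =>
    induction y using MonoidAlgebra.induction_linear with
    | zero => simp
    | add y y' hy hy' => rw [mul_add, map_add, hy, hy', map_add, add_mul]
    | single h b => simp [MonoidAlgebra.single_mul_single, mul_comm a b]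

variable [Fintype G]

/-- In the basis of group elements, all diagonal entries of left multiplication by `x` are the
coefficient of `x` at 1. -/
theorem trace_mulLeft (x : MonoidAlgebra F G) :
    LinearMap.trace F _ (LinearMap.mulLeft F x) = Fintype.card G * x.coeff 1 := by
  classical
  let b : Module.Basis G F (MonoidAlgebra F G) := Module.Basis.ofRepr
    { MonoidAlgebra.coeffAddEquiv with map_smul' := fun _ _ => rfl }
  have hb : ∀ g, b g = MonoidAlgebra.single g 1 := fun g => rfl
  rw [LinearMap.trace_eq_matrix_trace F b, Matrix.trace]
  have : ∀ g, Matrix.diag (LinearMap.toMatrix b b (LinearMap.mulLeft F x)) g = x.coeff 1 := by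
    intro g
    rw [Matrix.diag_apply, LinearMap.toMatrix_apply, hb]
    change (x * MonoidAlgebra.single g 1).coeff g = _
    simp
  rw [Finset.sum_congr rfl fun g _ => this g, Finset.sum_const, Finset.card_univ, nsmul_eq_mul]

theorem coeff_one_eq_zero_of_isNilpotent [CharZero F] {x : MonoidAlgebra F G} (h : IsNilpotent x) :
    x.coeff 1 = 0 := by
  have h1 : IsNilpotent (LinearMap.mulLeft F x) := by
    obtain ⟨n, hn⟩ := h
    exact ⟨n, by rw [LinearMap.pow_mulLeft, hn, LinearMap.mulLeft_zero_eq_zero]⟩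
  have h2 := (LinearMap.isNilpotent_trace_of_isNilpotent h1).eq_zero
  rw [trace_mulLeft] at h2
  exact (mul_eq_zero.mp h2).resolve_left (Nat.cast_ne_zero.mpr Fintype.card_ne_zero)

end GroupAlgebra

/-! ### Young symmetrizers as multiples of idempotents, and the ideals that they generate. -/

section Symmetrizer

variable {α : Type*} [Fintype α] [DecidableEq α] {F : Type*} [Field F]
  {lam mu : YoungDiagram}

theorem invMap_rowSum (t : α ≃ mu.cells) : invMap F _ (rowSum F t) = rowSum F t := by
  classical
  rw [rowSum, map_sum]
  refine Finset.sum_equiv (Equiv.inv _) (fun q => ?_) fun q _ => ?_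
  · simp
  · simp

theorem invMap_colSum (t : α ≃ mu.cells) : invMap F _ (colSum F t) = colSum F t := by
  classical
  rw [colSum, map_sum]
  refine Finset.sum_equiv (Equiv.inv _) (fun q => ?_) fun q _ => ?_
  · simp
  · simp

omit [Fintype α] [DecidableEq α] in
theorem eq_one_of_mem_rowSub_of_mem_colSub (t : α ≃ mu.cells) {p : Perm α} (hr : p ∈ rowSub t)
    (hc : p ∈ colSub t) : p = 1 := by
  ext i
  exact t.injective (Subtype.ext (Prod.ext (hr i) (hc i)))

theorem coeff_rowSum (t : α ≃ mu.cells) [DecidablePred (· ∈ rowSub t)] (p : Perm α) :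
    (rowSum F t).coeff p = if p ∈ rowSub t then 1 else 0 := by
  classical
  simp only [rowSum, MonoidAlgebra.coeff_sum, MonoidAlgebra.coeff_single, Finsupp.finsetSum_apply,
    Finsupp.single_apply, Finset.sum_ite_eq', Finset.mem_filter, Finset.mem_univ, true_and]

theorem coeff_one_colSum_mul_rowSum (t : α ≃ mu.cells) :
    (colSum F t * rowSum F t).coeff 1 = 1 := by
  classical
  rw [colSum, Finset.sum_mul, MonoidAlgebra.coeff_sum, Finsupp.finsetSum_apply,
    Finset.sum_eq_single 1]
  · simp [coeff_rowSum, one_mem]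
  · intro q hq hq1
    rw [Finset.mem_filter] at hq
    rw [MonoidAlgebra.coeff_single_mul_apply, coeff_rowSum, if_neg, mul_zero]
    intro h
    rw [mul_one] at h
    exact hq1 (eq_one_of_mem_rowSub_of_mem_colSub t (by simpa using h) hq.2)
  · intro h
    exact absurd (Finset.mem_filter.mpr ⟨Finset.mem_univ _, one_mem _⟩) h

theorem coeff_one_rowSum_mul_colSum (t : α ≃ mu.cells) :
    (rowSum F t * colSum F t).coeff 1 = 1 := by
  rw [coeff_one_mul_comm, coeff_one_colSum_mul_rowSum]

variable [CharZero F]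

/-- If `κ` were 0 the product would be nilpotent, with vanishing coefficient at 1; but that
coefficient is 1, as only the identity preserves both rows and columns. The inversion of the group
carries the first identity to the second one. -/
theorem exists_sq_eq_smul (t : α ≃ mu.cells) : ∃ κ : F, κ ≠ 0 ∧
    (rowSum F t * colSum F t) * (rowSum F t * colSum F t) = κ • (rowSum F t * colSum F t) ∧
    (colSum F t * rowSum F t) * (colSum F t * rowSum F t) = κ • (colSum F t * rowSum F t) := by
  obtain ⟨κ, hκ⟩ := rowSum_mul_mul_colSum (F := F) t (colSum F t * rowSum F t)
  have h1 : (rowSum F t * colSum F t) * (rowSum F t * colSum F t) =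
      κ • (rowSum F t * colSum F t) := by rw [← hκ]; simp only [mul_assoc]
  refine ⟨κ, fun h0 => ?_, h1, ?_⟩
  · have : IsNilpotent (rowSum F t * colSum F t) := ⟨2, by rw [pow_two, h1, h0, zero_smul]⟩
    have h2 := coeff_one_eq_zero_of_isNilpotent this
    rw [coeff_one_rowSum_mul_colSum] at h2
    exact one_ne_zero h2
  · have h2 := congrArg (invMap F _) h1
    simpa only [invMap_mul, map_smul, invMap_rowSum, invMap_colSum] using h2

theorem colSum_rowSum_mul_mul (t : α ≃ mu.cells) (w : MonoidAlgebra F (Perm α)) :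
    ∃ s : F, colSum F t * rowSum F t * w * (colSum F t * rowSum F t) =
      s • (colSum F t * rowSum F t) := by
  obtain ⟨κ, -, -, h⟩ := exists_sq_eq_smul (F := F) t
  obtain ⟨s, hs⟩ := rowSum_mul_mul_colSum t w
  refine ⟨s * κ, ?_⟩
  calc _ = colSum F t * (rowSum F t * w * colSum F t) * rowSum F t := by simp only [mul_assoc]
    _ = s • ((colSum F t * rowSum F t) * (colSum F t * rowSum F t)) := by
      rw [hs, mul_smul_comm, smul_mul_assoc]; simp only [mul_assoc]
    _ = _ := by rw [h, mul_smul]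

/-- A non-zero element of the right ideal generated by the Young symmetrizer generates it. -/
theorem exists_mul_eq_of_ne_zero (t : α ≃ mu.cells) {κ : F} (hκ : κ ≠ 0)
    {z : MonoidAlgebra F (Perm α)}
    (hz : rowSum F t * colSum F t * z = κ • z) (h0 : z ≠ 0) :
    ∃ w, z * w = rowSum F t * colSum F t := by
  set c := rowSum F t * colSum F t with hc
  have hs : ∀ a, ∃ s : F, z * a * c = s • c := by
    intro a
    obtain ⟨s, hs⟩ := rowSum_mul_mul_colSum (F := F) t (colSum F t * z * a * rowSum F t)
    refine ⟨κ⁻¹ * s, ?_⟩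
    have : z = κ⁻¹ • (c * z) := by rw [hz, smul_smul, inv_mul_cancel₀ hκ, one_smul]
    rw [this, mul_smul, hc, ← hs]
    simp only [smul_mul_assoc, mul_assoc]
  by_contra hne
  push Not at hne
  have hzero : ∀ a, z * a * c = 0 := by
    intro a
    obtain ⟨s, hsa⟩ := hs a
    by_cases h : s = 0
    · rw [hsa, h, zero_smul]
    · refine absurd ?_ (hne (s⁻¹ • (a * c)))
      rw [mul_smul_comm, ← mul_assoc, hsa, smul_smul, inv_mul_cancel₀ h, one_smul]
  -- By the symmetry of the trace form, the coefficients at 1 of `c * (z * a) = κ • (z * a)` and of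
  -- `z * a * c = 0` agree.
  refine h0 (eq_zero_of_coeff_one_mul fun a => ?_)
  have h1 : (c * (z * a)).coeff 1 = 0 := by rw [coeff_one_mul_comm, hzero]; rfl
  rw [← mul_assoc, hz, smul_mul_assoc, MonoidAlgebra.coeff_smul_apply, smul_eq_mul] at h1
  exact (mul_eq_zero.mp h1).resolve_left hκ

/-- An element of the left ideal generated by the Young symmetrizer that is killed by the right
ideal generated by it is zero. -/
theorem eq_zero_of_forall_mul_eq_zero (t : α ≃ mu.cells) {x y : MonoidAlgebra F (Perm α)}
    (hx : x = y * (colSum F t * rowSum F t))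
    (h : ∀ a, colSum F t * rowSum F t * a * x = 0) : x = 0 := by
  obtain ⟨κ, hκ, -, hc⟩ := exists_sq_eq_smul (F := F) t
  -- By the symmetry of the trace form, the hypothesis also gives the vanishing of the product in
  -- the other order, which is a nonzero multiple of `x`.
  have h1 : x * (colSum F t * rowSum F t) = 0 := by
    refine eq_zero_of_coeff_one_mul fun a => ?_
    rw [mul_assoc, coeff_one_mul_comm, h]; rfl
  rw [hx, mul_assoc, hc, mul_smul_comm, ← hx] at h1
  exact (smul_eq_zero.mp h1).resolve_left hκ

/-! ### Every representation of the symmetric group is detected by the Young symmetrizers -/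

/-- The sum of the conjugates of the Young symmetrizer of a tableau. -/
def centralSum (F : Type*) [Field F] (t : α ≃ mu.cells) : MonoidAlgebra F (Perm α) :=
  ∑ τ : Perm α, MonoidAlgebra.single τ 1 * (rowSum F t * colSum F t) * MonoidAlgebra.single τ⁻¹ 1

omit [CharZero F] in
theorem single_mul_centralSum (t : α ≃ mu.cells) (g : Perm α) :
    MonoidAlgebra.single g (1 : F) * centralSum F t =
      centralSum F t * MonoidAlgebra.single g (1 : F) := by
  rw [centralSum, Finset.mul_sum, Finset.sum_mul]
  refine Finset.sum_equiv (Equiv.mulLeft g) (by simp) fun τ _ => ?_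
  rw [Equiv.coe_mulLeft, mul_assoc _ _ (MonoidAlgebra.single g 1), MonoidAlgebra.single_mul_single,
    ← mul_assoc, ← mul_assoc, MonoidAlgebra.single_mul_single]
  simp

omit [CharZero F] in
theorem mul_centralSum (t : α ≃ mu.cells) (x : MonoidAlgebra F (Perm α)) :
    x * centralSum F t = centralSum F t * x := by
  induction x using MonoidAlgebra.induction_linear with
  | zero => simp
  | add x y hx hy => rw [add_mul, mul_add, hx, hy]
  | single g a => rw [single_eq_smul, smul_mul_assoc, mul_smul_comm, single_mul_centralSum]

omit [CharZero F] in
theorem coeff_one_centralSum (t : α ≃ mu.cells) :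
    (centralSum F t).coeff 1 = Fintype.card (Perm α) := by
  rw [centralSum, MonoidAlgebra.coeff_sum, Finsupp.finsetSum_apply]
  have : ∀ τ : Perm α, (MonoidAlgebra.single τ 1 * (rowSum F t * colSum F t) *
      MonoidAlgebra.single τ⁻¹ 1).coeff 1 = 1 := by
    intro τ
    rw [coeff_one_mul_comm, ← mul_assoc, MonoidAlgebra.single_mul_single, inv_mul_cancel, one_mul,
      ← MonoidAlgebra.one_def, one_mul, coeff_one_rowSum_mul_colSum]
  simp [this]

/-- Otherwise `centralSum` would be nilpotent, whereas its coefficient at 1 is the order of the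
group. -/
theorem centralSum_mul_self_ne_zero (t : α ≃ mu.cells) : centralSum F t * centralSum F t ≠ 0 := by
  intro h
  have : IsNilpotent (centralSum F t) := ⟨2, by rw [pow_two, h]⟩
  have h2 := coeff_one_eq_zero_of_isNilpotent this
  rw [coeff_one_centralSum] at h2
  exact Fintype.card_ne_zero (Nat.cast_eq_zero.mp h2)

/-- For different shapes one order of the symmetrizers gives 0; as the sums are central, either
order is enough. -/
theorem centralSum_mul_centralSum (t : α ≃ lam.cells) (t' : α ≃ mu.cells) (h : lam ≠ mu) :
    centralSum F t * centralSum F t' = 0 := by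
  have aux : ∀ (lam mu : YoungDiagram) (t : α ≃ lam.cells) (t' : α ≃ mu.cells),
      (∀ w : MonoidAlgebra F (Perm α), rowSum F t * w * colSum F t' = 0) →
      centralSum F t * centralSum F t' = 0 := by
    intro lam mu t t' H
    rw [centralSum, centralSum, Finset.sum_mul_sum]
    refine Finset.sum_eq_zero fun τ _ => Finset.sum_eq_zero fun ρ _ => ?_
    have := H (colSum F t * MonoidAlgebra.single τ⁻¹ 1 * MonoidAlgebra.single ρ 1 * rowSum F t')
    calc _ = MonoidAlgebra.single τ 1 * (rowSum F t * (colSum F t * MonoidAlgebra.single τ⁻¹ 1 *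
          MonoidAlgebra.single ρ 1 * rowSum F t') * colSum F t') * MonoidAlgebra.single ρ⁻¹ 1 := by
          simp only [mul_assoc]
      _ = 0 := by rw [this, mul_zero, zero_mul]
  rcases rowSum_mul_mul_colSum_eq_zero (F := F) t t' h with H | H
  · exact aux _ _ t t' H
  · rw [mul_centralSum]; exact aux _ _ t' t H

end Symmetrizer

/-! ### Partitions as diagrams, and class functions on the symmetric group. -/

section Partition

theorem card_cellsOfRowLens (w : List ℕ) : (YoungDiagram.cellsOfRowLens w).card = w.sum := by
  induction w with
  | nil => rfl
  | cons a w ih =>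
    rw [YoungDiagram.cellsOfRowLens, Finset.card_union_of_disjoint, Finset.card_map, ih,
      Finset.card_product, List.sum_cons]
    · simp
    · rw [Finset.disjoint_left]
      rintro ⟨i, j⟩ h1 h2
      simp at h1 h2
      obtain ⟨_, _, h⟩ := h2
      omega

/-- The Young diagram of a partition. -/
def diagramOfPartition {n : ℕ} (p : n.Partition) : YoungDiagram :=
  YoungDiagram.ofRowLens (p.parts.sort (· ≥ ·)) (p.parts.pairwise_sort (· ≥ ·)).sortedGE

theorem card_diagramOfPartition {n : ℕ} (p : n.Partition) : (diagramOfPartition p).card = n := by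
  have h : (diagramOfPartition p).card = (p.parts.sort (· ≥ ·)).sum := card_cellsOfRowLens _
  rw [h, ← Multiset.sum_coe, Multiset.sort_eq, p.parts_sum]

theorem diagramOfPartition_injective {n : ℕ} :
    Function.Injective (diagramOfPartition : n.Partition → YoungDiagram) := by
  intro p q h
  have hp := YoungDiagram.rowLens_ofRowLens_eq_self
    (hw := (p.parts.pairwise_sort (· ≥ ·)).sortedGE) (fun x hx => p.parts_pos (by simpa using hx))
  have hq := YoungDiagram.rowLens_ofRowLens_eq_self
    (hw := (q.parts.pairwise_sort (· ≥ ·)).sortedGE) (fun x hx => q.parts_pos (by simpa using hx))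
  have e : p.parts.sort (· ≥ ·) = q.parts.sort (· ≥ ·) :=
    hp.symm.trans ((congrArg YoungDiagram.rowLens h).trans hq)
  have := congrArg (fun l : List ℕ => (l : Multiset ℕ)) e
  simp only [Multiset.sort_eq] at this
  exact Nat.Partition.ext this

variable {α : Type*} [Fintype α] [DecidableEq α] (F : Type*) [Field F]

/-- A tableau of the shape of a partition. -/
def tableauOfPartition (p : (Fintype.card α).Partition) : α ≃ (diagramOfPartition p).cells :=
  Fintype.equivOfCardEq (by
    rw [Fintype.card_coe]; exact (card_diagramOfPartition p).symm)

/-- The function on the symmetric group attached to a function of the cycle type. -/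
def classFunction : ((Fintype.card α).Partition → F) →ₗ[F] MonoidAlgebra F (Perm α) where
  toFun f := MonoidAlgebra.ofCoeff (Finsupp.equivFunOnFinite.symm fun g => f g.partition)
  map_add' f f' := by ext; simp
  map_smul' c f := by ext; simp

variable {F}

/-- A central element is constant on conjugacy classes, and permutations with the same cycle type
are conjugate. -/
theorem mem_range_classFunction {x : MonoidAlgebra F (Perm α)}
    (hx : ∀ g : Perm α, MonoidAlgebra.single g (1 : F) * x = x * MonoidAlgebra.single g (1 : F)) :
    x ∈ LinearMap.range (classFunction (α := α) F) := by
  classical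
  refine ⟨fun p => if h : ∃ g : Perm α, g.partition = p then x.coeff h.choose else 0, ?_⟩
  ext g
  have hex : ∃ g' : Perm α, g'.partition = g.partition := ⟨g, rfl⟩
  change (if h : ∃ g' : Perm α, g'.partition = g.partition then x.coeff h.choose else 0) = _
  rw [dif_pos hex]
  generalize hex.choose = g', hex.choose_spec = hg'
  obtain ⟨c, hc⟩ := isConj_iff.mp (Equiv.Perm.partition_eq_of_isConj.mpr hg')
  have h1 := congrArg (fun z : MonoidAlgebra F (Perm α) => z.coeff (g * c)) (hx c)
  simp only [MonoidAlgebra.coeff_single_mul_apply, MonoidAlgebra.coeff_mul_single_apply, one_mul,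
    mul_one, mul_inv_cancel_right] at h1
  rw [← h1, ← hc]
  congr 1
  group

/-- The central sums, one for each partition, are pairwise orthogonal with nonzero squares, hence
independent. Their number bounds the dimension of the class functions, so they span these, and the
unit is a class function. -/
theorem one_mem_span_symmetrizers [CharZero F] :
    (1 : MonoidAlgebra F (Perm α)) ∈ Submodule.span F
      {z | ∃ (nu : YoungDiagram) (t : α ≃ nu.cells) (x y : MonoidAlgebra F (Perm α)),
        z = x * (rowSum F t * colSum F t) * y} := by
  set ζ : (Fintype.card α).Partition → MonoidAlgebra F (Perm α) :=
    fun p => centralSum F (tableauOfPartition p) with hζ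
  have hli : LinearIndependent F ζ := by
    rw [Fintype.linearIndependent_iff]
    intro a ha p
    have h1 := congrArg (· * ζ p) ha
    simp only [Finset.sum_mul, zero_mul] at h1
    rw [Finset.sum_eq_single p] at h1
    · rw [smul_mul_assoc] at h1
      exact (smul_eq_zero.mp h1).resolve_right (centralSum_mul_self_ne_zero _)
    · intro q _ hq
      rw [smul_mul_assoc, centralSum_mul_centralSum _ _
        (fun h => hq (diagramOfPartition_injective h)), smul_zero]
    · simp
  have hle : Submodule.span F (Set.range ζ) ≤ LinearMap.range (classFunction (α := α) F) := by
    rw [Submodule.span_le]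
    rintro _ ⟨p, rfl⟩
    exact mem_range_classFunction fun g => single_mul_centralSum _ g
  have heq : Submodule.span F (Set.range ζ) = LinearMap.range (classFunction (α := α) F) := by
    refine Submodule.eq_of_le_of_finrank_le hle ?_
    rw [finrank_span_eq_card hli]
    exact (LinearMap.finrank_range_le _).trans (by simp)
  have h1 : (1 : MonoidAlgebra F (Perm α)) ∈ Submodule.span F (Set.range ζ) := by
    rw [heq]
    exact mem_range_classFunction fun g => by rw [mul_one, one_mul]
  refine Submodule.span_le.mpr ?_ h1
  rintro _ ⟨p, rfl⟩
  refine Submodule.sum_mem _ fun τ _ => Submodule.subset_span ⟨_, tableauOfPartition p, _, _, rfl⟩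

end Partition

/-! ### Elements of `GL` -/

section Elements

variable {k : Type u} [Field k]

/-- The linear map that adds `t` times the `a`-th coordinate to the `b`-th one. -/
def addCoord (a b : ℕ) (t : k) : StdV k →ₗ[k] StdV k :=
  LinearMap.id + (Finsupp.lapply a).smulRight (Finsupp.single b t)

theorem addCoord_apply (a b : ℕ) (t : k) (v : StdV k) :
    addCoord a b t v = v + v a • Finsupp.single b t := rfl

/-- The last term of the hypothesis is `s * t` if `a = b` and 0 otherwise; so it covers the inverses
of transvections and of diagonal elements alike. -/
theorem addCoord_comp {a b : ℕ} {s t : k} (h : s + t + s * Finsupp.single (M := k) b t a = 0) :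
    addCoord a b s ∘ₗ addCoord a b t = LinearMap.id := by
  ext1 i
  ext1
  simp only [LinearMap.comp_apply, addCoord_apply, Finsupp.lsingle_apply, LinearMap.id_apply,
    Finsupp.add_apply, Finsupp.smul_apply, add_assoc, add_eq_left]
  rw [add_smul, ← add_assoc, ← smul_add, ← Finsupp.single_add, smul_assoc, ← smul_add,
    Finsupp.smul_single, ← Finsupp.single_add]
  have : t + s + Finsupp.single (M := k) b t a • s = 0 := by
    rw [smul_eq_mul, mul_comm _ s, add_comm t s]; exact h
  rw [this]
  simp

theorem addCoord_equiv_mem {a b : ℕ} {t : k} (e : StdV k ≃ₗ[k] StdV k)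
    (he : e.toLinearMap = addCoord a b t) : e ∈ GLInf k := by
  have h : ∀ v, e v = v + v a • Finsupp.single b t := fun v => LinearMap.congr_fun he v
  refine ⟨max a b + 1, fun i hi => ?_, fun i hi v => ?_⟩
  · rw [h, Finsupp.single_eq_of_ne (by omega), zero_smul, add_zero]
  · rw [h, Finsupp.add_apply, Finsupp.smul_apply, Finsupp.single_eq_of_ne (by omega), smul_zero,
      add_zero]

/-- The transvection `e_a ↦ e_a + t e_b`. -/
def transvec {a b : ℕ} (hab : a ≠ b) (t : k) : GLInf k :=
  ⟨LinearEquiv.ofLinearMap (addCoord a b t) (addCoord a b (-t))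
    (addCoord_comp (by rw [Finsupp.single_eq_of_ne hab]; ring))
    (addCoord_comp (by rw [Finsupp.single_eq_of_ne hab]; ring)),
    addCoord_equiv_mem _ rfl⟩

theorem transvec_self {a b : ℕ} (hab : a ≠ b) (t : k) :
    (transvec hab t : StdV k ≃ₗ[k] StdV k) (Finsupp.single a 1) =
      Finsupp.single a 1 + t • Finsupp.single b 1 := by
  change addCoord a b t _ = _
  rw [addCoord_apply]; simp

theorem transvec_of_ne {a b : ℕ} (hab : a ≠ b) (t : k) {c : ℕ} (hc : c ≠ a) :
    (transvec hab t : StdV k ≃ₗ[k] StdV k) (Finsupp.single c 1) = Finsupp.single c 1 := by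
  change addCoord a b t _ = _
  rw [addCoord_apply, Finsupp.single_eq_of_ne hc.symm]; simp

/-- The diagonal element `e_a ↦ u e_a`. -/
def diagElt (a : ℕ) (u : kˣ) : GLInf k :=
  ⟨LinearEquiv.ofLinearMap (addCoord a a (u - 1 : k)) (addCoord a a ((u⁻¹ : kˣ) - 1 : k))
    (addCoord_comp (by
      have := u.mul_inv
      simp only [Finsupp.single_eq_same]
      linear_combination this))
    (addCoord_comp (by
      have := u.inv_mul
      simp only [Finsupp.single_eq_same]
      linear_combination this)),
    addCoord_equiv_mem _ rfl⟩

theorem diagElt_self (a : ℕ) (u : kˣ) :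
    (diagElt a u : StdV k ≃ₗ[k] StdV k) (Finsupp.single a 1) = (u : k) • Finsupp.single a 1 := by
  change addCoord a a _ _ = _
  rw [addCoord_apply]
  simp

theorem diagElt_of_ne (a : ℕ) (u : kˣ) {c : ℕ} (hc : c ≠ a) :
    (diagElt a u : StdV k ≃ₗ[k] StdV k) (Finsupp.single c 1) = Finsupp.single c 1 := by
  change addCoord a a _ _ = _
  rw [addCoord_apply, Finsupp.single_eq_of_ne hc.symm]; simp

/-- The permutation matrix of a permutation with finite support. -/
def permElt (π : Perm ℕ) (h : ∃ n, ∀ i, n ≤ i → π i = i) : GLInf k :=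
  ⟨Finsupp.domLCongr π, by
    obtain ⟨n, hn⟩ := h
    refine ⟨n, fun i hi => ?_, fun i hi v => ?_⟩
    · rw [Finsupp.domLCongr_single, hn i hi]
    · rw [Finsupp.domLCongr_apply, Finsupp.domCongr_apply, Finsupp.equivMapDomain_apply]
      congr 1
      rw [Equiv.symm_apply_eq, hn i hi]⟩

theorem permElt_single (π : Perm ℕ) (h : ∃ n, ∀ i, n ≤ i → π i = i) (i : ℕ) :
    (permElt (k := k) π h : StdV k ≃ₗ[k] StdV k) (Finsupp.single i 1) = Finsupp.single (π i) 1 :=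
  Finsupp.domLCongr_single _ _ _

end Elements

/-! ### Tensors with coefficients in an extension -/

section Tens

variable (k : Type u) [Field k]

/-- The basis `e_J` of `V^{⊗ n}`. -/
def tpowBasis (n : ℕ) : Module.Basis (Fin n → ℕ) k (TPow k n) :=
  (Basis.piTensorProduct fun _ : Fin n => (Finsupp.basisSingleOne (R := k) (ι := ℕ)) :
    Module.Basis (Fin n → ℕ) k (⨂[k] _ : Fin n, StdV k))

theorem tpowBasis_apply (n : ℕ) (J : Fin n → ℕ) :
    tpowBasis k n J = pureTensor fun a => Finsupp.single (J a) 1 := by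
  refine (Basis.piTensorProduct_apply _ J).trans ?_
  simp only [Finsupp.coe_basisSingleOne]
  rfl

variable (K : Type u) [Field K] [Algebra k K]

/-- The basis `1 ⊗ e_J` of `K ⊗ V^{⊗ n}`. -/
def ktBasis (n : ℕ) : Module.Basis (Fin n → ℕ) K (K ⊗[k] TPow k n) :=
  (tpowBasis k n).baseChange K

theorem ktBasis_apply (n : ℕ) (J : Fin n → ℕ) :
    ktBasis k K n J = 1 ⊗ₜ[k] pureTensor fun a => Finsupp.single (J a) 1 := by
  rw [ktBasis, Module.Basis.baseChange_apply, tpowBasis_apply]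

/-- The `K`-multilinear map `(v₀, …, vₙ₋₁) ↦ v₀ ⊗ ⋯ ⊗ vₙ₋₁` on the vectors of `V` with coefficients
in `K`. -/
def tens (n : ℕ) : MultilinearMap K (fun _ : Fin n => StdV K) (K ⊗[k] TPow k n) :=
  ((tpowBasis K n).constr K (ktBasis k K n)).compMultilinearMap
    (PiTensorProduct.tprod K : MultilinearMap K (fun _ : Fin n => StdV K) (⨂[K] _ : Fin n, StdV K))

theorem tens_single (n : ℕ) (J : Fin n → ℕ) :
    tens k K n (fun a => Finsupp.single (J a) 1) = ktBasis k K n J := by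
  change (tpowBasis K n).constr K (ktBasis k K n) (pureTensor fun a => Finsupp.single (J a) 1) = _
  rw [← tpowBasis_apply, Module.Basis.constr_basis]

/-- The extension of coefficients from `k` to `K`. -/
def liftV : StdV k →ₗ[k] StdV K := Finsupp.mapRange.linearMap (Algebra.linearMap k K)

@[simp] theorem liftV_single (j : ℕ) :
    liftV k K (Finsupp.single j 1) = Finsupp.single j 1 := by
  simp [liftV]

theorem tens_liftV (n : ℕ) (v : Fin n → StdV k) :
    tens k K n (fun a => liftV k K (v a)) = 1 ⊗ₜ[k] pureTensor v := by
  have h : ((tens k K n).restrictScalars k).compLinearMap (fun _ => liftV k K) =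
      (TensorProduct.mk k K (TPow k n) 1).compMultilinearMap
        (PiTensorProduct.tprod k : MultilinearMap k (fun _ : Fin n => StdV k) (TPow k n)) := by
    refine Module.Basis.ext_multilinear (fun _ => Finsupp.basisSingleOne) fun J => ?_
    simp only [Finsupp.coe_basisSingleOne]
    change tens k K n (fun a => liftV k K (Finsupp.single (J a) 1)) = _
    simp only [liftV_single]
    rw [tens_single, ktBasis_apply]
    rfl
  exact congrArg (fun f => f v) h

end Tens

/-! ### Polarization -/

section Polarization

open Finset in
/-- A polynomial with values in a subspace has its coefficients in it. -/
theorem coeff_mem_of_forall_mem {k W : Type*} [Field k] [CharZero k] [AddCommGroup W] [Module k W]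
    (Q : Submodule k W) (N : ℕ) (w : ℕ → W)
    (h : ∀ u : k, u ≠ 0 → ∑ d ∈ range N, u ^ d • w d ∈ Q) {d : ℕ} (hd : d < N) : w d ∈ Q := by
  by_contra hw
  -- A linear form that vanishes on `Q` but not on `w d` produces a scalar polynomial with every
  -- nonzero element of the infinite field as a root.
  obtain ⟨f, hf, hfQ⟩ := Submodule.exists_le_ker_of_notMem hw
  let P : Polynomial k := ∑ d ∈ range N, Polynomial.monomial d (f (w d))
  have hP : P = 0 := by
    refine Polynomial.eq_zero_of_infinite_isRoot P ?_
    refine (Set.Infinite.mono (s := {0}ᶜ) (fun u hu => ?_) (Set.finite_singleton 0).infinite_compl)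
    have h1 := hfQ (h u hu)
    rw [LinearMap.mem_ker, map_sum] at h1
    change Polynomial.eval u P = 0
    simpa [P, Polynomial.eval_finsetSum, mul_comm] using h1
  have h2 := congrArg (fun p => Polynomial.coeff p d) hP
  simp only [P, Polynomial.finsetSum_coeff, Polynomial.coeff_monomial, Finset.sum_ite_eq',
    Finset.mem_range, hd, if_true, Polynomial.coeff_zero] at h2
  exact hf h2

/-- The polarization of a monomial: the sum of the monomials with one of the indices `j` replaced
by `s`. -/
def polarize (k : Type u) [Field k] {S : Type*} {Pos : S → Type*} [∀ s, Fintype (Pos s)]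
    [∀ s, DecidableEq (Pos s)] (j s : ℕ) (m : Σ s, (Pos s → ℕ)) : (Σ s, (Pos s → ℕ)) →₀ k :=
  ∑ p ∈ Finset.univ.filter fun p : Pos m.1 => m.2 p = j,
    Finsupp.single ⟨m.1, Function.update m.2 p s⟩ 1

variable {k : Type u} [Field k] {K : Type u} [Field K] [Algebra k K] {S : Type*}
  {Pos : S → Type*} [∀ s, Fintype (Pos s)] [∀ s, DecidableEq (Pos s)]
  {W : Type*} [AddCommGroup W] [Module k W] [Module K W] [IsScalarTower k K W]

variable (K) in
/-- The standard basis of `V`, with coefficients extended to `K`. -/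
def stdB (j : ℕ) : StdV K := Finsupp.single j 1

theorem liftV_single_eq (j : ℕ) : liftV k K (Finsupp.single j 1) = stdB K j := liftV_single k K j

/-- The linear combination with coefficients `X` of the values of the multilinear maps `ev s`
at the vectors `h (I p)`. -/
def theta (ev : ∀ s, MultilinearMap K (fun _ : Pos s => StdV K) W) (h : ℕ → StdV K) :
    ((Σ s, (Pos s → ℕ)) →₀ k) →ₗ[k] W :=
  Finsupp.linearCombination k fun m => ev m.1 fun p => h (m.2 p)

/-- The multiset of the indices in a monomial. -/
def content (m : Σ s, (Pos s → ℕ)) : Multiset ℕ := Finset.univ.val.map m.2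

theorem count_content (m : Σ s, (Pos s → ℕ)) (j : ℕ) :
    (content m).count j = (Finset.univ.filter fun p => m.2 p = j).card := by
  rw [content, Multiset.count_map]
  simp only [eq_comm (a := j)]
  rfl

variable (ev : ∀ s, MultilinearMap K (fun _ : Pos s => StdV K) W)

theorem theta_single (h : ℕ → StdV K) (m : Σ s, (Pos s → ℕ)) (a : k) :
    theta ev h (Finsupp.single m a) = a • ev m.1 fun p => h (m.2 p) :=
  Finsupp.linearCombination_single _ _ _

theorem theta_apply (h : ℕ → StdV K) (X : (Σ s, (Pos s → ℕ)) →₀ k) :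
    theta ev h X = ∑ m ∈ X.support, X m • ev m.1 fun p => h (m.2 p) :=
  rfl

theorem theta_congr {h h' : ℕ → StdV K} {X : (Σ s, (Pos s → ℕ)) →₀ k} {C : Multiset ℕ}
    (hX : ∀ m ∈ X.support, content m = C) (hh : ∀ c ∈ C, h c = h' c) :
    theta ev h X = theta ev h' X := by
  rw [theta_apply, theta_apply]
  refine Finset.sum_congr rfl fun m hm => ?_
  congr 2
  funext p
  refine hh _ ?_
  rw [← hX m hm]
  exact Multiset.mem_map_of_mem _ (Finset.mem_univ p)

variable (ρ : Representation k (GLInf k) W)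
  (hρ : ∀ s g (v : Pos s → StdV k), ρ g (ev s fun p => liftV k K (v p)) =
    ev s fun p => liftV k K ((g : StdV k ≃ₗ[k] StdV k) (v p)))

include hρ in
theorem theta_gl (g : GLInf k) (v : ℕ → StdV k) (X : (Σ s, (Pos s → ℕ)) →₀ k) :
    ρ g (theta ev (fun j => liftV k K (v j)) X) =
      theta ev (fun j => liftV k K ((g : StdV k ≃ₗ[k] StdV k) (v j))) X := by
  rw [theta_apply, theta_apply, map_sum]
  exact Finset.sum_congr rfl fun m _ => by rw [map_smul, hρ]

include hρ in
theorem theta_gl_std (g : GLInf k) (f : ℕ → ℕ) (X : (Σ s, (Pos s → ℕ)) →₀ k) :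
    ρ g (theta ev (fun j => stdB K (f j)) X) =
      theta ev (fun j => liftV k K ((g : StdV k ≃ₗ[k] StdV k) (Finsupp.single (f j) 1))) X := by
  simp only [← liftV_single_eq (k := k)]
  exact theta_gl ev ρ hρ g _ X

open Classical in
include hρ in
-- The diagonal element that scales `e_j` by `t` multiplies the monomials with `d` occurrences of
-- `j` by `t ^ d`; the weight components are then the coefficients of a polynomial in `t`.
theorem theta_filter_count_mem [CharZero k] (Q : Submodule k W) (hQ : ∀ g, ∀ x ∈ Q, ρ g x ∈ Q)
    (j d : ℕ) (X : (Σ s, (Pos s → ℕ)) →₀ k) (hX : theta ev (stdB K) X ∈ Q) :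
    theta ev (stdB K) (X.filter fun m => (content m).count j = d) ∈ Q := by
  let cnt : (Σ s, (Pos s → ℕ)) → ℕ := fun m => (content m).count j
  let N := X.support.sup cnt + d + 1
  have hN : ∀ m, X m ≠ 0 → cnt m < N := fun m hm => by
    have : cnt m ≤ X.support.sup cnt := Finset.le_sup (by simpa using hm)
    omega
  have hsum : X = ∑ e ∈ Finset.range N, X.filter fun m => cnt m = e := by
    ext m
    rw [Finsupp.finsetSum_apply]
    simp only [Finsupp.filter_apply]
    rw [Finset.sum_ite_eq]
    by_cases hm : X m = 0
    · simp [hm]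
    · rw [if_pos (Finset.mem_range.2 (hN m hm))]
  refine coeff_mem_of_forall_mem Q N (fun e => theta ev (stdB K) (X.filter fun m => cnt m = e))
    (fun t ht => ?_) (d := d) (by omega)
  have h1 := hQ (diagElt j (Units.mk0 t ht)) _ hX
  have h2 := theta_gl_std ev ρ hρ (diagElt j (Units.mk0 t ht)) id X
  simp only [id] at h2
  rw [h2] at h1
  conv at h1 => rw [hsum, map_sum]
  convert h1 using 1
  refine Finset.sum_congr rfl fun e _ => ?_
  rw [theta_apply, theta_apply, Finset.smul_sum]
  refine Finset.sum_congr rfl fun m hm => ?_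
  rw [smul_comm]
  congr 1
  have hm' : cnt m = e := by
    rw [Finsupp.support_filter, Finset.mem_filter] at hm
    exact hm.2
  have h3 : (fun p => liftV k K ((diagElt j (Units.mk0 t ht) : StdV k ≃ₗ[k] StdV k)
      (Finsupp.single (m.2 p) 1))) = fun p =>
      (if m.2 p = j then algebraMap k K t else 1) • stdB K (m.2 p) := by
    funext p
    split_ifs with hp
    · rw [hp, diagElt_self, map_smul, liftV_single_eq, algebraMap_smul]; rfl
    · rw [diagElt_of_ne _ _ hp, liftV_single_eq, one_smul]
  rw [h3, MultilinearMap.map_smul_univ, Finset.prod_ite, Finset.prod_const, Finset.prod_const_one,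
    mul_one, ← count_content, ← map_pow, algebraMap_smul]
  rw [← hm']

open Classical in
include hρ in
-- Weight components are extracted for one index after the other. At each stage the components sum
-- to an element outside `Z`, so one of them lies outside `Z`.
theorem exists_content [CharZero k] (Q Z : Submodule k W) (hQ : ∀ g, ∀ x ∈ Q, ρ g x ∈ Q)
    (X : (Σ s, (Pos s → ℕ)) →₀ k) (hX : theta ev (stdB K) X ∈ Q) (hXZ : theta ev (stdB K) X ∉ Z) :
    ∃ (C : Multiset ℕ) (Y : (Σ s, (Pos s → ℕ)) →₀ k), (∀ m ∈ Y.support, content m = C) ∧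
      theta ev (stdB K) Y ∈ Q ∧ theta ev (stdB K) Y ∉ Z := by
  have key : ∀ J : Finset ℕ, ∃ (f : ℕ → ℕ) (Y : (Σ s, (Pos s → ℕ)) →₀ k), Y.support ⊆ X.support ∧
      (∀ m ∈ Y.support, ∀ j ∈ J, (content m).count j = f j) ∧
      theta ev (stdB K) Y ∈ Q ∧ theta ev (stdB K) Y ∉ Z := by
    intro J
    induction J using Finset.induction_on with
    | empty => exact ⟨0, X, subset_rfl, by simp, hX, hXZ⟩
    | insert j J hj ih =>
      obtain ⟨f, Y, hYX, hY, hYQ, hYZ⟩ := ih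
      let cnt : (Σ s, (Pos s → ℕ)) → ℕ := fun m => (content m).count j
      have hsum : Y = ∑ e ∈ Finset.range (Y.support.sup cnt + 1), Y.filter fun m => cnt m = e := by
        ext m
        rw [Finsupp.finsetSum_apply]
        simp only [Finsupp.filter_apply]
        rw [Finset.sum_ite_eq]
        by_cases hm : Y m = 0
        · simp [hm]
        · rw [if_pos (Finset.mem_range.2 (Nat.lt_succ_of_le (Finset.le_sup (by simpa using hm))))]
      have : ∃ d, theta ev (stdB K) (Y.filter fun m => cnt m = d) ∉ Z := by
        by_contra! hcon
        refine hYZ ?_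
        rw [hsum, map_sum]
        exact Submodule.sum_mem _ fun d _ => hcon d
      obtain ⟨d, hd⟩ := this
      refine ⟨Function.update f j d, Y.filter fun m => cnt m = d, ?_, ?_,
        theta_filter_count_mem ev ρ hρ Q hQ j d Y hYQ, hd⟩
      · exact (by rw [Finsupp.support_filter]; exact Finset.filter_subset _ _ :
          (Y.filter fun m => cnt m = d).support ⊆ Y.support).trans hYX
      · intro m hm i hi
        rw [Finsupp.support_filter, Finset.mem_filter] at hm
        rcases Finset.mem_insert.1 hi with rfl | hiJ
        · rw [Function.update_self]; exact hm.2
        · rw [Function.update_of_ne (by rintro rfl; exact hj hiJ)]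
          exact hY m hm.1 i hiJ
  let J : Finset ℕ := X.support.biUnion fun m => (content m).toFinset
  obtain ⟨f, Y, hYX, hY, hYQ, hYZ⟩ := key J
  have hne : Y.support.Nonempty := by
    rw [Finsupp.support_nonempty_iff]
    rintro rfl
    exact hYZ (by rw [map_zero]; exact zero_mem _)
  obtain ⟨m₀, hm₀⟩ := hne
  refine ⟨content m₀, Y, fun m hm => Multiset.ext.2 fun j => ?_, hYQ, hYZ⟩
  by_cases hj : j ∈ J
  · rw [hY m hm j hj, hY m₀ hm₀ j hj]
  · have : ∀ m ∈ Y.support, (content m).count j = 0 := fun m hm => by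
      refine Multiset.count_eq_zero.2 fun h => hj ?_
      exact Finset.mem_biUnion.2 ⟨m, hYX hm, Multiset.mem_toFinset.2 h⟩
    rw [this m hm, this m₀ hm₀]

theorem theta_polarize (h : ℕ → StdV K) (j s : ℕ) (m : Σ s, (Pos s → ℕ)) :
    theta ev h (polarize k j s m) =
      ∑ p : Pos m.1 with m.2 p = j, ev m.1 (Function.update (fun q => h (m.2 q)) p (h s)) := by
  rw [polarize, map_sum]
  refine Finset.sum_congr rfl fun p _ => ?_
  rw [theta_single, one_smul]
  congr 1
  funext q
  by_cases hq : q = p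
  · rw [hq, Function.update_self]
    exact congrArg h (Function.update_self ..)
  · rw [Function.update_of_ne hq]
    exact congrArg h (Function.update_of_ne hq ..)

theorem content_update (s : S) (I : Pos s → ℕ) (p : Pos s) (b : ℕ) :
    content ⟨s, Function.update I p b⟩ = b ::ₘ (content ⟨s, I⟩).erase (I p) := by
  have h1 : (Finset.univ : Finset (Pos s)).val = p ::ₘ (Finset.univ.erase p).val := by
    rw [← Finset.insert_val_of_notMem (Finset.notMem_erase p _),
      Finset.insert_erase (Finset.mem_univ p)]
  simp only [content]
  rw [h1, Multiset.map_cons, Multiset.map_cons, Function.update_self, Multiset.erase_cons_head]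
  congr 1
  refine Multiset.map_congr rfl fun q hq => ?_
  rw [Function.update_of_ne]
  rintro rfl
  exact Finset.notMem_erase q _ hq

/-- The expansion of a multilinear map along a polynomial deformation of some of the arguments. -/
theorem map_add_smul_piecewise {ι : Type*} [Fintype ι] [DecidableEq ι]
    (f : MultilinearMap K (fun _ : ι => StdV K) W) (v u : ι → StdV K) (Q : Finset ι) (t : K) :
    f (fun p => if p ∈ Q then v p + t • u p else v p) =
      ∑ d ∈ Finset.range (Q.card + 1), t ^ d • ∑ T ∈ Q.powersetCard d, f (T.piecewise u v) := by
  have h1 : (fun p => if p ∈ Q then v p + t • u p else v p) =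
      Q.piecewise ((fun p => t • u p) + v) v := by
    funext p
    simp [Finset.piecewise, add_comm]
  rw [h1, MultilinearMap.map_piecewise_add, Finset.sum_powerset]
  refine Finset.sum_congr rfl fun d _ => ?_
  rw [Finset.smul_sum]
  refine Finset.sum_congr rfl fun T hT => ?_
  have h2 : T.piecewise (fun p => t • u p) v =
      T.piecewise (fun p => t • T.piecewise u v p) (T.piecewise u v) := by
    funext p
    by_cases hp : p ∈ T <;> simp [hp]
  rw [h2, MultilinearMap.map_piecewise_smul f (fun _ => t), Finset.prod_const,
    (Finset.mem_powersetCard.1 hT).2]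

include hρ in
-- The polarization is the coefficient of `t` in the image under the transvection `e_j ↦ e_j + t
-- e_s`.
theorem theta_polarize_mem [CharZero k] (Q : Submodule k W) (hQ : ∀ g, ∀ x ∈ Q, ρ g x ∈ Q)
    {j s : ℕ} (hjs : j ≠ s) {C : Multiset ℕ} (hj : j ∈ C) {X : (Σ s, (Pos s → ℕ)) →₀ k}
    (hC : ∀ m ∈ X.support, content m = C) (hX : theta ev (stdB K) X ∈ Q) :
    theta ev (stdB K) (X.sum fun m a => a • polarize k j s m) ∈ Q := by
  have hcard : ∀ m ∈ X.support, (Finset.univ.filter fun p => m.2 p = j).card = C.count j :=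
    fun m hm => by rw [← count_content, hC m hm]
  have h := coeff_mem_of_forall_mem Q (C.count j + 1) (fun d => ∑ m ∈ X.support, X m •
    ∑ T ∈ (Finset.univ.filter fun p => m.2 p = j).powersetCard d,
      ev m.1 (T.piecewise (fun _ => stdB K s) fun p => stdB K (m.2 p))) (fun t _ => ?_) (d := 1)
    (Nat.succ_lt_succ (Multiset.count_pos.2 hj))
  · convert h using 1
    rw [Finsupp.sum, map_sum]
    refine Finset.sum_congr rfl fun m hm => ?_
    rw [map_smul, theta_polarize, Finset.powersetCard_one, Finset.sum_map]
    congr 1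
    refine Finset.sum_congr rfl fun p _ => ?_
    congr 1
    funext q
    by_cases hq : q = p <;> simp [hq]
  · have h1 := hQ (transvec hjs t) _ hX
    have h2 := theta_gl_std ev ρ hρ (transvec hjs t) id X
    simp only [id] at h2
    rw [h2] at h1
    convert h1 using 1
    simp only [Finset.smul_sum]
    rw [Finset.sum_comm, theta_apply]
    refine Finset.sum_congr rfl fun m hm => ?_
    have h3 : (fun p => liftV k K ((transvec hjs t : StdV k ≃ₗ[k] StdV k)
        (Finsupp.single (m.2 p) 1))) = fun p =>
        if p ∈ (Finset.univ.filter fun p => m.2 p = j) then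
          stdB K (m.2 p) + algebraMap k K t • stdB K s else stdB K (m.2 p) := by
      funext p
      simp only [Finset.mem_filter, Finset.mem_univ, true_and]
      split_ifs with hp
      · rw [hp, transvec_self, map_add, map_smul, liftV_single_eq, liftV_single_eq,
          algebraMap_smul]
      · rw [transvec_of_ne _ _ hp, liftV_single_eq]
    rw [h3, map_add_smul_piecewise (ev m.1) (fun p => stdB K (m.2 p)) (fun _ => stdB K s),
      hcard m hm, Finset.smul_sum]
    refine Finset.sum_congr rfl fun d _ => ?_
    rw [← map_pow, algebraMap_smul, smul_comm, Finset.smul_sum, Finset.smul_sum]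

include hρ in
-- The transvection `e_s ↦ e_s + e_j` undoes the polarization: its difference with the identity maps
-- the polarized element to `C.count j` times the original one, and this integer is invertible in
-- characteristic 0. The index `s` must be new, so that it occurs only where it has been inserted.
theorem theta_polarize_notMem [CharZero k] (Z : Submodule k W) (hZ : ∀ g, ∀ x ∈ Z, ρ g x ∈ Z)
    {j s : ℕ} (hjs : j ≠ s) {C : Multiset ℕ} (hj : j ∈ C) (hs : s ∉ C)
    {X : (Σ s, (Pos s → ℕ)) →₀ k}
    (hC : ∀ m ∈ X.support, content m = C) (hX : theta ev (stdB K) X ∉ Z) :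
    theta ev (stdB K) (X.sum fun m a => a • polarize k j s m) ∉ Z := by
  intro h
  have h1 := hZ (transvec hjs.symm 1) _ h
  have h2 := theta_gl_std ev ρ hρ (transvec hjs.symm 1) id (X.sum fun m a => a • polarize k j s m)
  simp only [id] at h2
  rw [h2] at h1
  have h3 := Z.sub_mem h1 h
  have h4 : theta ev (fun i => liftV k K ((transvec hjs.symm (1 : k) : StdV k ≃ₗ[k] StdV k)
      (Finsupp.single i 1))) (X.sum fun m a => a • polarize k j s m) -
      theta ev (stdB K) (X.sum fun m a => a • polarize k j s m) =
      (C.count j : k) • theta ev (stdB K) X := by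
    simp only [Finsupp.sum, map_sum]
    rw [← Finset.sum_sub_distrib, theta_apply, Finset.smul_sum]
    refine Finset.sum_congr rfl fun m hm => ?_
    rw [map_smul, map_smul, ← smul_sub, smul_comm, theta_polarize, theta_polarize,
      ← Finset.sum_sub_distrib]
    congr 1
    have h5 : ∀ p, m.2 p ≠ s := fun p hp => by
      refine hs ?_
      rw [← hC m hm, ← hp]
      exact Multiset.mem_map_of_mem _ (Finset.mem_univ p)
    rw [Finset.sum_congr rfl (g := fun _ => ev m.1 fun p => stdB K (m.2 p)) ?_, Finset.sum_const,
      ← count_content, hC m hm, Nat.cast_smul_eq_nsmul]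
    intro p hp
    rw [transvec_self, map_add, one_smul, liftV_single_eq, liftV_single_eq]
    have h6 : (fun q => liftV k K ((transvec hjs.symm (1 : k) : StdV k ≃ₗ[k] StdV k)
      (Finsupp.single (m.2 q) 1))) = fun q => stdB K (m.2 q) := by
      funext q
      rw [transvec_of_ne _ _ (h5 q), liftV_single_eq]
    rw [h6, MultilinearMap.map_update_add, add_sub_cancel_left]
    congr 1
    rw [← (Finset.mem_filter.1 hp).2, Function.update_eq_self_iff]
  rw [h4] at h3
  refine hX ?_
  have hne : (C.count j : k) ≠ 0 := Nat.cast_ne_zero.2 (Multiset.count_pos.2 hj).ne'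
  have := Z.smul_mem (C.count j : k)⁻¹ h3
  rwa [inv_smul_smul₀ hne] at this

theorem content_of_mem_polarize {j s : ℕ} {C : Multiset ℕ} {X : (Σ s, (Pos s → ℕ)) →₀ k}
    (hC : ∀ m ∈ X.support, content m = C) :
    ∀ m ∈ (X.sum fun m a => a • polarize k j s m).support, content m = s ::ₘ C.erase j := by
  classical
  intro m hm
  obtain ⟨m', hm', h1⟩ := (Finsupp.mem_support_finsetSum _ hm)
  obtain ⟨p, hp, h2⟩ := Finsupp.mem_support_finsetSum _ (Finsupp.support_smul h1)
  obtain rfl := Finset.mem_singleton.1 (Finsupp.support_single_subset h2)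
  rw [content_update, ← hC m' hm', (Finset.mem_filter.1 hp).2]

include hρ in
/-- A subspace that is stable under `GL` contains multilinear elements. -/
theorem exists_multilinear [CharZero k] (Q Z : Submodule k W) (hQ : ∀ g, ∀ x ∈ Q, ρ g x ∈ Q)
    (hZ : ∀ g, ∀ x ∈ Z, ρ g x ∈ Z)
    (X : (Σ s, (Pos s → ℕ)) →₀ k) (hX : theta ev (stdB K) X ∈ Q) (hXZ : theta ev (stdB K) X ∉ Z) :
    ∃ (C : Multiset ℕ) (Y : (Σ s, (Pos s → ℕ)) →₀ k), C.Nodup ∧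
      (∀ m ∈ Y.support, content m = C) ∧
      theta ev (stdB K) Y ∈ Q ∧ theta ev (stdB K) Y ∉ Z := by
  obtain ⟨C, Y, hY, hYQ, hYZ⟩ := exists_content ev ρ hρ Q Z hQ X hX hXZ
  clear hX hXZ X
  -- The induction is on the number of repetitions. Polarizing a repeated index `j` to a new index
  -- `s` lowers it, and keeps the element inside `Q` and outside `Z`.
  induction hn : C.card - C.toFinset.card using Nat.strong_induction_on generalizing C Y with
  | _ n ih =>
    by_cases hC : C.Nodup
    · exact ⟨C, Y, hC, hY, hYQ, hYZ⟩
    · rw [Multiset.nodup_iff_count_le_one] at hC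
      push Not at hC
      obtain ⟨j, hj⟩ := hC
      have hjC : j ∈ C := Multiset.count_pos.1 (by omega)
      obtain ⟨s, hs⟩ := Infinite.exists_notMem_finset C.toFinset
      rw [Multiset.mem_toFinset] at hs
      have hjs : j ≠ s := by rintro rfl; exact hs hjC
      have hsub : insert s C.toFinset ⊆ (s ::ₘ C.erase j).toFinset := by
        intro i hi
        rw [Multiset.mem_toFinset, Multiset.mem_cons]
        rcases Finset.mem_insert.1 hi with rfl | hi'
        · exact Or.inl rfl
        · refine Or.inr (Multiset.count_pos.1 ?_)
          have h1 := Multiset.count_pos.2 (Multiset.mem_toFinset.1 hi')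
          by_cases hij : i = j
          · rw [hij, Multiset.count_erase_self]; omega
          · rwa [Multiset.count_erase_of_ne hij]
      have h1 := Finset.card_le_card hsub
      rw [Finset.card_insert_of_notMem (by rwa [Multiset.mem_toFinset])] at h1
      have h2 : (s ::ₘ C.erase j).card = C.card := by
        rw [Multiset.card_cons, Multiset.card_erase_add_one hjC]
      have h3 := Multiset.toFinset_card_le (s ::ₘ C.erase j)
      exact ih _ (by omega) _ _ (content_of_mem_polarize hY)
        (theta_polarize_mem ev ρ hρ Q hQ hjs hjC hY hYQ)
        (theta_polarize_notMem ev ρ hρ Z hZ hjs hjC hs hY hYZ) rfl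

theorem exists_unique_position {C : Multiset ℕ} (hC : C.Nodup) {m : Σ s, (Pos s → ℕ)}
    (hm : content m = C) {c : ℕ} (hc : c ∈ C) :
    ∃ p, m.2 p = c ∧ ∀ q, m.2 q = c → q = p := by
  rw [← hm] at hc hC
  obtain ⟨p, -, hp⟩ := Multiset.mem_map.1 hc
  refine ⟨p, hp, fun q hq => ?_⟩
  exact Multiset.inj_on_of_nodup_map hC q (Finset.mem_univ q) p (Finset.mem_univ p)
    (hq.trans hp.symm)

theorem exists_eq_update {C : Multiset ℕ} (hC : C.Nodup) {m : Σ s, (Pos s → ℕ)}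
    (hm : content m = C) {c : ℕ} (hc : c ∈ C) (h : ℕ → StdV K) :
    ∃ p, ∀ v, (fun q => Function.update h c v (m.2 q)) =
      Function.update (fun q => h (m.2 q)) p v := by
  obtain ⟨p, hp, hq⟩ := exists_unique_position hC hm hc
  refine ⟨p, fun v => funext fun q => ?_⟩
  by_cases hqp : q = p
  · subst hqp; rw [hp]; simp
  · rw [Function.update_of_ne hqp, Function.update_of_ne fun h => hqp (hq q h)]

theorem theta_update_add {C : Multiset ℕ} (hC : C.Nodup) {X : (Σ s, (Pos s → ℕ)) →₀ k}
    (hX : ∀ m ∈ X.support, content m = C) {c : ℕ} (hc : c ∈ C) (h : ℕ → StdV K) (v w : StdV K) :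
    theta ev (Function.update h c (v + w)) X =
      theta ev (Function.update h c v) X + theta ev (Function.update h c w) X := by
  rw [theta_apply, theta_apply, theta_apply, ← Finset.sum_add_distrib]
  refine Finset.sum_congr rfl fun m hm => ?_
  obtain ⟨p, hp⟩ := exists_eq_update hC (hX m hm) hc h
  rw [hp, hp, hp, MultilinearMap.map_update_add, smul_add]

theorem theta_update_smul {C : Multiset ℕ} (hC : C.Nodup) {X : (Σ s, (Pos s → ℕ)) →₀ k}
    (hX : ∀ m ∈ X.support, content m = C) {c : ℕ} (hc : c ∈ C) (h : ℕ → StdV K) (a : K)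
    (v : StdV K) :
    theta ev (Function.update h c (a • v)) X = a • theta ev (Function.update h c v) X := by
  rw [theta_apply, theta_apply, Finset.smul_sum]
  refine Finset.sum_congr rfl fun m hm => ?_
  obtain ⟨p, hp⟩ := exists_eq_update hC (hX m hm) hc h
  rw [hp, hp, MultilinearMap.map_update_smul, smul_comm]

include hρ in
-- Apply the transvection `e_{f c} ↦ e_{f c} + e_b` and subtract the original. As `f c` differs from
-- the other indices in use, only the argument of index `c` is affected, and it occurs once.
theorem theta_update_index_mem {Q : Submodule k W} (hQ : ∀ g, ∀ x ∈ Q, ρ g x ∈ Q)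
    {C : Multiset ℕ} (hC : C.Nodup) {X : (Σ s, (Pos s → ℕ)) →₀ k}
    (hX : ∀ m ∈ X.support, content m = C) {c : ℕ} (hc : c ∈ C) {f : ℕ → ℕ}
    (hf : ∀ i ∈ C, i ≠ c → f i ≠ f c) (b : ℕ)
    (hm : theta ev (fun j => stdB K (f j)) X ∈ Q) :
    theta ev (fun j => stdB K (Function.update f c b j)) X ∈ Q := by
  by_cases hb : f c = b
  · rwa [← hb, Function.update_eq_self]
  · have h1 := hQ (transvec hb 1) _ hm
    rw [theta_gl_std ev ρ hρ] at h1
    have h2 : theta ev (fun j => liftV k K ((transvec hb (1 : k) : StdV k ≃ₗ[k] StdV k)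
        (Finsupp.single (f j) 1))) X =
        theta ev (Function.update (fun j => stdB K (f j)) c (stdB K (f c) + stdB K b)) X := by
      refine theta_congr ev hX fun i hi => ?_
      by_cases hic : i = c
      · subst hic
        rw [Function.update_self, transvec_self, map_add, one_smul, liftV_single_eq,
          liftV_single_eq]
      · rw [Function.update_of_ne hic, transvec_of_ne _ _ (hf i hi hic), liftV_single_eq]
    rw [h2, theta_update_add ev hC hX hc] at h1
    have h3 : Function.update (fun j => stdB K (f j)) c (stdB K (f c)) =
      fun j => stdB K (f j) := Function.update_eq_self c _
    rw [h3] at h1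
    have h4 := Q.sub_mem h1 hm
    rw [add_sub_cancel_left] at h4
    convert h4 using 3
    funext i
    by_cases hic : i = c
    · subst hic; simp
    · simp [hic]

include hρ in
theorem theta_index_mem {Q : Submodule k W} (hQ : ∀ g, ∀ x ∈ Q, ρ g x ∈ Q)
    {C : Multiset ℕ} (hC : C.Nodup) {X : (Σ s, (Pos s → ℕ)) →₀ k}
    (hX : ∀ m ∈ X.support, content m = C) (hm : theta ev (stdB K) X ∈ Q) (f : ℕ → ℕ) :
    theta ev (fun j => stdB K (f j)) X ∈ Q := by
  classical
  obtain ⟨s, hs⟩ : ∃ s, ∀ i ∈ C, i < s ∧ f i < s := by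
    refine ⟨C.toFinset.sup id + C.toFinset.sup f + 1, fun i hi => ?_⟩
    have h1 : id i ≤ C.toFinset.sup id := Finset.le_sup (Multiset.mem_toFinset.2 hi)
    have h2 : f i ≤ C.toFinset.sup f := Finset.le_sup (Multiset.mem_toFinset.2 hi)
    simp only [id] at h1
    omega
  -- Indices can be changed one by one as long as the one being changed differs from all the others
  -- in use at that moment, whether already changed or not.
  have move : ∀ (f₀ f₁ : ℕ → ℕ), (∀ i ∈ C, ∀ j ∈ C, i ≠ j → f₀ i ≠ f₀ j) →
      (∀ i ∈ C, ∀ j ∈ C, i ≠ j → f₁ i ≠ f₀ j) → theta ev (fun j => stdB K (f₀ j)) X ∈ Q →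
      theta ev (fun j => stdB K (f₁ j)) X ∈ Q := by
    intro f₀ f₁ h₀ h₁ h
    have key : ∀ D : Finset ℕ, D ⊆ C.toFinset →
        theta ev (fun j => stdB K (if j ∈ D then f₁ j else f₀ j)) X ∈ Q := by
      intro D
      induction D using Finset.induction_on with
      | empty => intro _; simpa using h
      | insert c D hcD ih =>
        intro hD
        rw [Finset.insert_subset_iff, Multiset.mem_toFinset] at hD
        have := theta_update_index_mem ev ρ hρ hQ hC hX hD.1
          (f := fun j => if j ∈ D then f₁ j else f₀ j) (fun i hi hic => ?_) (f₁ c) (ih hD.2)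
        · convert this using 4 with j
          by_cases hjc : j = c
          · subst hjc; simp
          · simp [hjc]
        · simp only [if_neg hcD]
          split_ifs
          · exact h₁ i hi c hD.1 hic
          · exact h₀ i hi c hD.1 hic
    rw [theta_congr ev hX (h' := fun j => stdB K (if j ∈ C.toFinset then f₁ j else f₀ j))]
    · exact key _ subset_rfl
    · intro c hc
      rw [if_pos (Multiset.mem_toFinset.2 hc)]
  -- The function `f` need not be injective on `C`. The passage through `j ↦ s + j`, beyond all the
  -- old and new indices, avoids collisions.
  refine move (fun j => s + j) f (fun i _ j _ hij => by omega) (fun i hi j _ _ => ?_)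
    (move id (fun j => s + j) (fun i _ j _ hij => hij) (fun i _ j hj _ => ?_) hm)
  · have := (hs i hi).2; omega
  · have := (hs j hj).1; simp only [id]; omega

include hρ in
/-- The orbit of a multilinear element spans the values of the multilinear map. -/
theorem theta_mem (Q : Submodule K W) (hQ : ∀ g, ∀ x ∈ Q, ρ g x ∈ Q)
    {C : Multiset ℕ} (hC : C.Nodup) {X : (Σ s, (Pos s → ℕ)) →₀ k}
    (hX : ∀ m ∈ X.support, content m = C) (hm : theta ev (stdB K) X ∈ Q) (h : ℕ → StdV K) :
    theta ev h X ∈ Q := by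
  classical
  -- The indices in `D` may carry any vector, the other ones only basis vectors. Linearity over `K`
  -- in the vector of one index, which occurs once in each monomial, enlarges `D`.
  have key : ∀ D : Finset ℕ, D ⊆ C.toFinset → ∀ h : ℕ → StdV K,
      (∀ c ∈ C, c ∉ D → ∃ b, h c = stdB K b) → theta ev h X ∈ Q := by
    intro D
    induction D using Finset.induction_on with
    | empty =>
      intro _ h hh
      have : ∀ c, ∃ b, c ∈ C → h c = stdB K b := fun c => by
        by_cases hc : c ∈ C
        · obtain ⟨b, hb⟩ := hh c hc (by simp)
          exact ⟨b, fun _ => hb⟩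
        · exact ⟨0, fun h => absurd h hc⟩
      choose f hf using this
      rw [theta_congr ev hX hf]
      exact theta_index_mem ev ρ hρ (Q := Q.restrictScalars k) hQ hC hX hm f
    | insert c D hcD ih =>
      intro hD h hh
      rw [Finset.insert_subset_iff, Multiset.mem_toFinset] at hD
      have : ∀ v, theta ev (Function.update h c v) X ∈ Q := by
        intro v
        induction v using Finsupp.induction_linear with
        | zero =>
          have := theta_update_smul ev hC hX hD.1 h 0 0
          rw [zero_smul, zero_smul] at this
          rw [this]; exact Q.zero_mem
        | add v w hv hw => rw [theta_update_add ev hC hX hD.1]; exact Q.add_mem hv hw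
        | single b a =>
          have h1 : Finsupp.single b a = a • stdB K b := by simp [stdB]
          rw [h1, theta_update_smul ev hC hX hD.1]
          refine Q.smul_mem _ (ih hD.2 _ fun i hi hiD => ?_)
          by_cases hic : i = c
          · exact ⟨b, by rw [hic, Function.update_self]⟩
          · rw [Function.update_of_ne hic]
            exact hh i hi (by simp [hic, hiD])
      have h2 := this (h c)
      rwa [Function.update_eq_self] at h2
  exact key C.toFinset subset_rfl h fun c hc hcD => absurd (Multiset.mem_toFinset.2 hc) hcD

end Polarization

/-! ### The forms of the field and contractions -/

section Multilinear

variable {k : Type u} [Field k] {K : Type u} [Field K] [Algebra k K]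

theorem multilinear_ext {ι : Type*} [Finite ι] {M : Type*} [AddCommGroup M] [Module K M]
    {f g : MultilinearMap K (fun _ : ι => StdV K) M}
    (h : ∀ J : ι → ℕ, f (fun a => stdB K (J a)) = g fun a => stdB K (J a)) : f = g := by
  refine Module.Basis.ext_multilinear (fun _ => Finsupp.basisSingleOne) fun J => ?_
  simp only [Finsupp.coe_basisSingleOne]
  exact h J

theorem tens_stdB (n : ℕ) (J : Fin n → ℕ) :
    tens k K n (fun a => stdB K (J a)) = 1 ⊗ₜ[k] pureTensor fun a => Finsupp.single (J a) 1 := by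
  rw [← ktBasis_apply]
  exact tens_single k K n J

/-- The product of a multilinear form and a multilinear map in separate variables. -/
def smulMultilinear {ι κ : Type*} {M : Type*} [AddCommGroup M] [Module K M]
    (f : MultilinearMap K (fun _ : ι => StdV K) K) (g : MultilinearMap K (fun _ : κ => StdV K) M) :
    MultilinearMap K (fun _ : ι ⊕ κ => StdV K) M :=
  (TensorProduct.lid K M).toLinearMap.compMultilinearMap (f.domCoprod g)

theorem smulMultilinear_apply {ι κ : Type*} {M : Type*} [AddCommGroup M] [Module K M]
    (f : MultilinearMap K (fun _ : ι => StdV K) K) (g : MultilinearMap K (fun _ : κ => StdV K) M)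
    (v : ι ⊕ κ → StdV K) :
    smulMultilinear f g v = f (fun a => v (Sum.inl a)) • g fun a => v (Sum.inr a) := by
  simp [smulMultilinear, MultilinearMap.domCoprod_apply]

/-- The product of multilinear forms in separate variables. -/
def prodMultilinear {N : ℕ} {d : Fin N → ℕ}
    (f : ∀ l, MultilinearMap K (fun _ : Fin (d l) => StdV K) K) :
    MultilinearMap K (fun _ : Σ l, Fin (d l) => StdV K) K where
  toFun v := ∏ l, f l fun a => v ⟨l, a⟩
  map_update_add' {dec} v p x y := by
    obtain ⟨l, a⟩ := p
    have h1 : ∀ z, (fun b => Function.update v ⟨l, a⟩ z ⟨l, b⟩) =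
        Function.update (fun b => v ⟨l, b⟩) a z := fun z => by
      funext b
      by_cases hb : b = a
      · subst hb; simp
      · rw [Function.update_of_ne hb, Function.update_of_ne (by simpa using hb)]
    have h2 : ∀ z, ∀ l' ∈ Finset.univ.erase l,
        (f l' fun b => Function.update v ⟨l, a⟩ z ⟨l', b⟩) = f l' fun b => v ⟨l', b⟩ := by
      intro z l' hl'
      congr 1
      funext b
      rw [Function.update_of_ne]
      intro h
      exact Finset.ne_of_mem_erase hl' (congrArg Sigma.fst h)
    simp only [← Finset.mul_prod_erase Finset.univ _ (Finset.mem_univ l), h1,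
      Finset.prod_congr rfl (h2 _), MultilinearMap.map_update_add, add_mul]
  map_update_smul' {dec} v p c x := by
    obtain ⟨l, a⟩ := p
    have h1 : ∀ z, (fun b => Function.update v ⟨l, a⟩ z ⟨l, b⟩) =
        Function.update (fun b => v ⟨l, b⟩) a z := fun z => by
      funext b
      by_cases hb : b = a
      · subst hb; simp
      · rw [Function.update_of_ne hb, Function.update_of_ne (by simpa using hb)]
    have h2 : ∀ z, ∀ l' ∈ Finset.univ.erase l,
        (f l' fun b => Function.update v ⟨l, a⟩ z ⟨l', b⟩) = f l' fun b => v ⟨l', b⟩ := by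
      intro z l' hl'
      congr 1
      funext b
      rw [Function.update_of_ne]
      intro h
      exact Finset.ne_of_mem_erase hl' (congrArg Sigma.fst h)
    simp only [← Finset.mul_prod_erase Finset.univ _ (Finset.mem_univ l), h1,
      Finset.prod_congr rfl (h2 _), MultilinearMap.map_update_smul, smul_eq_mul, mul_assoc]

theorem prodMultilinear_apply {N : ℕ} {d : Fin N → ℕ}
    (f : ∀ l, MultilinearMap K (fun _ : Fin (d l) => StdV K) K) (v : (Σ l, Fin (d l)) → StdV K) :
    prodMultilinear f v = ∏ l, f l fun a => v ⟨l, a⟩ := rfl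

end Multilinear

/-! ### The forms as multilinear maps over K, and a criterion for tracelessness. -/

section Forms

variable {k : Type u} [Field k] {r : ℕ} (σ : Fin r → YoungDiagram)

variable (k) in
/-- The generator of the Specht module. -/
def spGen (μ : YoungDiagram) : Specht k μ :=
  ⟨youngSymmetrizer k μ, Ideal.subset_span rfl⟩

theorem exists_smul_spGen {μ : YoungDiagram} (x : Specht k μ) :
    ∃ a : MonoidAlgebra k (Perm (Fin μ.card)), x = a • spGen k μ := by
  obtain ⟨a, ha⟩ := Ideal.mem_span_singleton'.1 x.2
  exact ⟨a, Subtype.ext ha.symm⟩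

theorem single_smul_specht {μ : YoungDiagram} (τ : Perm (Fin μ.card)) (c : k) (x : Specht k μ) :
    MonoidAlgebra.single τ c • x = c • spechtRep k μ τ x := by
  change _ = c • (MonoidAlgebra.single τ (1 : k) • x)
  rw [← smul_assoc, MonoidAlgebra.smul_single, smul_eq_mul, mul_one]

theorem specht_mem_span (μ : YoungDiagram) (x : Specht k μ) :
    x ∈ Submodule.span k (Set.range fun τ => spechtRep k μ τ (spGen k μ)) := by
  obtain ⟨a, rfl⟩ := exists_smul_spGen x
  induction a using MonoidAlgebra.induction_linear with
  | zero => rw [zero_smul]; exact zero_mem _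
  | add a b ha hb => rw [add_smul]; exact add_mem ha hb
  | single τ c =>
    rw [single_smul_specht]
    exact Submodule.smul_mem _ _ (Submodule.subset_span ⟨τ, rfl⟩)

theorem schurProj_perm' {μ : YoungDiagram} (τ : Perm (Fin μ.card)) (x : Specht k μ)
    (v : TPow k μ.card) :
    schurProj (spechtRep k μ τ x) v = schurProj x (permTPow k μ.card τ⁻¹ v) := by
  rw [← schurProj_perm τ x, ← Module.End.mul_apply, ← map_mul, mul_inv_cancel, map_one]
  rfl

variable (k) in
/-- The linear form on `K ⊗ S` induced by the inclusion of `S = ⨁ S_{σ i}(V)` in `K`. -/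
def sumForm : RatK k σ ⊗[k] SchurSum k σ →ₗ[RatK k σ] RatK k σ :=
  LinearMap.liftBaseChange (RatK k σ)
    ((IsScalarTower.toAlgHom k (SymR k σ) (RatK k σ)).toLinearMap ∘ₗ
      SymmetricAlgebra.ι k (SchurSum k σ))

theorem sumForm_tmul (a : RatK k σ) (w : SchurSum k σ) :
    sumForm k σ (a ⊗ₜ w) =
      a * algebraMap (SymR k σ) (RatK k σ) (SymmetricAlgebra.ι k (SchurSum k σ) w) := by
  simp [sumForm]

variable (k) in
/-- The projection `V^{⊗ |σ i|} → S_{σ i}(V) → S` given by the generator of the Specht module. -/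
def blockProj (i : Fin r) : TPow k (σ i).card →ₗ[k] SchurSum k σ :=
  DirectSum.lof k (Fin r) (fun i => Schur k (σ i)) i ∘ₗ schurProj (spGen k (σ i))

variable (k) in
/-- The multilinear map to `K ⊗ S` induced by `blockProj`. -/
def blockMap (i : Fin r) :
    MultilinearMap (RatK k σ) (fun _ : Fin (σ i).card => StdV (RatK k σ))
      (RatK k σ ⊗[k] SchurSum k σ) :=
  (LinearMap.baseChange (RatK k σ) (blockProj k σ i)).compMultilinearMap (tens k (RatK k σ) _)

variable (k) in
/-- The multilinear form on the vectors with coefficients in `K` given by the generator of the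
Specht module of `σ i`. -/
def polForm (i : Fin r) :
    MultilinearMap (RatK k σ) (fun _ : Fin (σ i).card => StdV (RatK k σ)) (RatK k σ) :=
  (sumForm k σ).compMultilinearMap (blockMap k σ i)

theorem formAt_tens (i : Fin r) (v : Fin (σ i).card → StdV (RatK k σ)) :
    formAt σ i (spGen k (σ i)) (tens k (RatK k σ) _ v) = polForm k σ i v := by
  have : formAt σ i (spGen k (σ i)) =
      sumForm k σ ∘ₗ LinearMap.baseChange (RatK k σ) (blockProj k σ i) := by
    refine TensorProduct.AlgebraTensorModule.ext fun a w => ?_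
    rw [formAt_tmul, LinearMap.comp_apply, LinearMap.baseChange_tmul, sumForm_tmul]
    rfl
  rw [this]; rfl

theorem glKTensor_tens (n : ℕ) (g : GLInf k) (v : Fin n → StdV k) :
    glKTensor k σ n g (tens k (RatK k σ) n fun a => liftV k (RatK k σ) (v a)) =
      tens k (RatK k σ) n fun a =>
        liftV k (RatK k σ) ((g : StdV k ≃ₗ[k] StdV k) (v a)) := by
  rw [tens_liftV, tens_liftV, glKTensor_tmul, map_one, glTPow_pure]

theorem glRatK_polForm (i : Fin r) (g : GLInf k) (v : Fin (σ i).card → StdV k) :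
    glRatK k σ g (polForm k σ i fun a => liftV k (RatK k σ) (v a)) =
      polForm k σ i fun a => liftV k (RatK k σ) ((g : StdV k ≃ₗ[k] StdV k) (v a)) := by
  rw [← formAt_tens, ← formAt_tens, tens_liftV, tens_liftV, ← formAt_gl, map_one, glTPow_pure]

theorem permKTensor_eq_baseChange (n : ℕ) (τ : Perm (Fin n)) (t : KTensor k σ n) :
    permKTensor k σ n τ t = LinearMap.baseChange (RatK k σ) (permTPow k n τ) t := by
  induction t using TensorProduct.induction_on with
  | zero => rw [map_zero, map_zero]
  | tmul a w => rw [permKTensor_tmul, LinearMap.baseChange_tmul]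
  | add x y hx hy => rw [map_add, map_add, hx, hy]

theorem permKTensor_tens (n : ℕ) (τ : Perm (Fin n)) (v : Fin n → StdV (RatK k σ)) :
    permKTensor k σ n τ (tens k (RatK k σ) n v) = tens k (RatK k σ) n fun a => v (τ.symm a) := by
  have h : (LinearMap.baseChange (RatK k σ) (permTPow k n τ)).compMultilinearMap
      (tens k (RatK k σ) n) = (tens k (RatK k σ) n).domDomCongr τ.symm := by
    refine multilinear_ext fun J => ?_
    rw [LinearMap.compMultilinearMap_apply, MultilinearMap.domDomCongr_apply, tens_stdB,
      tens_stdB (J := fun a => J (τ.symm a)), LinearMap.baseChange_tmul, permTPow_pure]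
  rw [permKTensor_eq_baseChange, ← LinearMap.compMultilinearMap_apply, h,
    MultilinearMap.domDomCongr_apply]

theorem contract_tens {n m m' : ℕ} (e : Fin m ⊕ Fin m' ≃ Fin n)
    (φ : KTensor k σ m →ₗ[RatK k σ] RatK k σ) (v : Fin n → StdV (RatK k σ)) :
    contract σ e φ (tens k (RatK k σ) n v) =
      φ (tens k (RatK k σ) m fun j => v (e (Sum.inl j))) •
        tens k (RatK k σ) m' fun j => v (e (Sum.inr j)) := by
  have h : (contract σ e φ).compMultilinearMap (tens k (RatK k σ) n) =
      (smulMultilinear (φ.compMultilinearMap (tens k (RatK k σ) m))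
        (tens k (RatK k σ) m')).domDomCongr e := by
    refine multilinear_ext fun J => ?_
    rw [LinearMap.compMultilinearMap_apply, MultilinearMap.domDomCongr_apply,
      smulMultilinear_apply, LinearMap.compMultilinearMap_apply, tens_stdB, contract_pure]
    rw [tens_stdB (J := fun a => J (e (Sum.inl a))), tens_stdB (J := fun a => J (e (Sum.inr a))),
      TensorProduct.smul_tmul', smul_eq_mul, mul_one]
  rw [← LinearMap.compMultilinearMap_apply, h, MultilinearMap.domDomCongr_apply,
    smulMultilinear_apply]
  rfl

theorem contract_perm {n m m' : ℕ} (e : Fin m ⊕ Fin m' ≃ Fin n) (τ : Perm (Fin n))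
    (φ : KTensor k σ m →ₗ[RatK k σ] RatK k σ) (t : KTensor k σ n) :
    contract σ e φ (permKTensor k σ n τ t) = contract σ (e.trans τ.symm) φ t := by
  refine LinearMap.congr_fun
    (f := (contract σ e φ).restrictScalars k ∘ₗ permKTensor k σ n τ)
    (g := (contract σ (e.trans τ.symm) φ).restrictScalars k) (KTensor_ext σ fun a v => ?_) t
  simp only [LinearMap.comp_apply, LinearMap.restrictScalars_apply, permKTensor_tmul,
    permTPow_pure, contract_pure]
  rfl

/-- The definition only uses the increasing enumerations of a subset and its complement. A
permutation of the factors, under which traceless tensors are stable, reduces an arbitrary `e` to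
these. -/
theorem contract_eq_zero {n m' : ℕ} {y : KTensor k σ n} (hy : y ∈ Traceless k σ n) (i : Fin r)
    (x : Specht k (σ i)) (e : Fin (σ i).card ⊕ Fin m' ≃ Fin n) :
    contract σ e (formAt σ i x) y = 0 := by
  have hn : (σ i).card + m' = n := by simpa using Fintype.card_congr e
  obtain rfl : m' = n - (σ i).card := by omega
  obtain ⟨S, -, hS⟩ := Finset.exists_subset_card_eq
    (s := (Finset.univ : Finset (Fin n))) (n := (σ i).card) (by simp; omega)
  let e₀ := finSumEquivOfFinset hS (by rw [Finset.card_compl, Fintype.card_fin, hS] :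
    Sᶜ.card = n - (σ i).card)
  have h := Traceless_perm_stable σ n (e.symm.trans e₀) y hy
  simp only [Traceless, Submodule.mem_iInf, LinearMap.mem_ker] at h
  have h1 := h i x S hS
  rw [contraction, contract_perm] at h1
  convert h1 using 2
  refine congrArg (fun e => contract σ e (formAt σ i x)) (Equiv.ext fun a => ?_)
  change e a = e (e₀.symm (e₀ a))
  rw [Equiv.symm_apply_apply]

theorem contract_formAt_perm {n m' : ℕ} (i : Fin r) (x : Specht k (σ i))
    (e : Fin (σ i).card ⊕ Fin m' ≃ Fin n) (τ : Perm (Fin (σ i).card)) :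
    contract σ e (formAt σ i (spechtRep k (σ i) τ x)) =
      contract σ ((Equiv.sumCongr τ (Equiv.refl _)).trans e) (formAt σ i x) := by
  refine LinearMap.restrictScalars_injective k (KTensor_ext σ fun a v => ?_)
  simp only [LinearMap.restrictScalars_apply, contract_pure, formAt_tmul, schurProj_perm',
    permTPow_pure]
  rfl

theorem schurProj_add {μ : YoungDiagram} (x y : Specht k μ) :
    schurProj (x + y) = schurProj x + schurProj y := by
  simp only [schurProj, map_add, LinearMap.comp_add]

theorem schurProj_smul {μ : YoungDiagram} (c : k) (x : Specht k μ) :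
    schurProj (c • x) = c • schurProj x := by
  simp only [schurProj, map_smul, LinearMap.comp_smul]

variable (k) in
/-- The contraction as a function of the element of the Specht module. -/
def contractFormAt {n m' : ℕ} (i : Fin r) (e : Fin (σ i).card ⊕ Fin m' ≃ Fin n) :
    Specht k (σ i) →ₗ[k] (KTensor k σ n →ₗ[k] KTensor k σ m') where
  toFun x := (contract σ e (formAt σ i x)).restrictScalars k
  map_add' x y := by
    refine KTensor_ext σ fun a v => ?_
    simp only [LinearMap.restrictScalars_apply, LinearMap.add_apply, contract_pure, formAt_tmul,
      schurProj_add, map_add, mul_add, TensorProduct.add_tmul]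
  map_smul' c x := by
    refine KTensor_ext σ fun a v => ?_
    simp only [LinearMap.restrictScalars_apply, LinearMap.smul_apply, contract_pure, formAt_tmul,
      schurProj_smul, map_smul, mul_smul_comm, TensorProduct.smul_tmul', RingHom.id_apply]

/-- The contraction is linear in the element of the Specht module, and a permutation applied to the
generator can be absorbed in `e`; so the generator suffices. -/
theorem mem_traceless {n : ℕ} {y : KTensor k σ n}
    (h : ∀ (i : Fin r) (m' : ℕ) (e : Fin (σ i).card ⊕ Fin m' ≃ Fin n),
      contract σ e (formAt σ i (spGen k (σ i))) y = 0) : y ∈ Traceless k σ n := by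
  simp only [Traceless, Submodule.mem_iInf, LinearMap.mem_ker]
  intro i x S hS
  have key : ∀ e : Fin (σ i).card ⊕ Fin (n - (σ i).card) ≃ Fin n,
      contractFormAt k σ i e x y = 0 := by
    intro e
    induction specht_mem_span _ x using Submodule.span_induction with
    | mem x hx =>
      obtain ⟨τ, rfl⟩ := hx
      change contract σ e (formAt σ i (spechtRep k (σ i) τ (spGen k (σ i)))) y = 0
      rw [contract_formAt_perm]
      exact h i _ _
    | zero => rw [map_zero, LinearMap.zero_apply]
    | add x y _ _ hx hy => rw [map_add, LinearMap.add_apply, hx, hy, add_zero]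
    | smul c x _ hx => rw [map_smul, LinearMap.smul_apply, hx, smul_zero]
  exact key _

end Forms

/-! ### Monomials -/

section Monomials

variable {k : Type u} [Field k] {r : ℕ} (σ : Fin r → YoungDiagram)

/-- In the coinvariants, a permutation of the generator can be moved to the tensor. -/
theorem schurProj_spGen_surjective (μ : YoungDiagram) :
    Function.Surjective (schurProj (spGen k μ)) := by
  rw [← LinearMap.range_eq_top, eq_top_iff]
  have h : ∀ x v, schurProj x v ∈ LinearMap.range (schurProj (spGen k μ)) := by
    intro x v
    induction specht_mem_span _ x using Submodule.span_induction with
    | mem x hx =>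
      obtain ⟨τ, rfl⟩ := hx
      rw [schurProj_perm']
      exact ⟨_, rfl⟩
    | zero =>
      have : schurProj (0 : Specht k μ) v = 0 := by
        have := LinearMap.congr_fun (schurProj_smul (0 : k) (0 : Specht k μ)) v
        rwa [zero_smul, zero_smul] at this
      rw [this]; exact zero_mem _
    | add x y _ _ hx hy => rw [schurProj_add]; exact add_mem hx hy
    | smul c x _ hx => rw [schurProj_smul]; exact Submodule.smul_mem _ _ hx
  have h2 : (LinearMap.range (schurProj (spGen k μ))).mkQ = 0 :=
    schur_ext fun x v => by
      rw [LinearMap.zero_apply]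
      exact (Submodule.Quotient.mk_eq_zero _).2 (h x v)
  intro y _
  have := LinearMap.congr_fun h2 y
  exact (Submodule.Quotient.mk_eq_zero _).1 this

variable (k) in
/-- The vectors `S_{σ i}(V)` of index `J` span `⨁ S_{σ i}(V)`. -/
theorem span_blockProj_eq_top :
    Submodule.span k (Set.range fun m : Σ i, (Fin (σ i).card → ℕ) =>
      blockProj k σ m.1 (tpowBasis k _ m.2)) = ⊤ := by
  rw [eq_top_iff]
  intro w hw
  clear hw
  induction w using DirectSum.induction_on with
  | zero => exact zero_mem _
  | of i x =>
    obtain ⟨t, rfl⟩ := schurProj_spGen_surjective (k := k) (σ i) x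
    change blockProj k σ i t ∈ _
    induction (tpowBasis k (σ i).card).mem_span t using Submodule.span_induction with
    | mem t ht =>
      obtain ⟨J, rfl⟩ := ht
      exact Submodule.subset_span ⟨⟨i, J⟩, rfl⟩
    | zero => rw [map_zero]; exact zero_mem _
    | add x y _ _ hx hy => rw [map_add]; exact add_mem hx hy
    | smul c x _ hx => rw [map_smul]; exact Submodule.smul_mem _ _ hx
  | add x y hx hy => exact add_mem hx hy

theorem polForm_stdB (i : Fin r) (J : Fin (σ i).card → ℕ) :
    polForm k σ i (fun a => stdB (RatK k σ) (J a)) =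
      algebraMap (SymR k σ) (RatK k σ)
        (SymmetricAlgebra.ι k (SchurSum k σ) (blockProj k σ i (tpowBasis k _ J))) := by
  rw [polForm, LinearMap.compMultilinearMap_apply, blockMap, LinearMap.compMultilinearMap_apply,
    tens_stdB, ← tpowBasis_apply, LinearMap.baseChange_tmul, sumForm_tmul, one_mul]

/-- The shape of a monomial: the index of the component where it lives and the sequence of the forms
that occur in its coefficient. -/
structure Shape (r : ℕ) (O : Type) where
  /-- The index of the component. -/
  out : O
  /-- The number of forms. -/
  num : ℕ
  /-- The forms. -/
  blk : Fin num → Fin r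

variable {O : Type} [DecidableEq O] (ar : O → ℕ)

/-- The arguments of the monomials of a given shape. -/
abbrev Shape.Pos (s : Shape r O) : Type :=
  (Σ l : Fin s.num, Fin (σ (s.blk l)).card) ⊕ Fin (ar s.out)

variable (k) in
/-- The product of the spaces `T^{ar o}`. -/
abbrev PiT : Type u := ∀ o, KTensor k σ (ar o)

variable (k) in
/-- The monomials of a given shape, as a multilinear map. -/
def shapeEval (s : Shape r O) :
    MultilinearMap (RatK k σ) (fun _ : s.Pos σ ar => StdV (RatK k σ)) (PiT k σ ar) :=
  smulMultilinear (prodMultilinear fun l => polForm k σ (s.blk l))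
    ((LinearMap.single (RatK k σ) (fun o => KTensor k σ (ar o)) s.out).compMultilinearMap
      (tens k (RatK k σ) (ar s.out)))

theorem shapeEval_apply (s : Shape r O) (v : s.Pos σ ar → StdV (RatK k σ)) :
    shapeEval k σ ar s v = (∏ l, polForm k σ (s.blk l) fun a => v (Sum.inl ⟨l, a⟩)) •
      Pi.single (M := fun o => KTensor k σ (ar o)) s.out
        (tens k (RatK k σ) (ar s.out) fun a => v (Sum.inr a)) := by
  rw [shapeEval, smulMultilinear_apply, prodMultilinear_apply]
  rfl

variable (k) in
/-- The action of `GL` on the product of the spaces `T^{ar o}`. -/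
def glPi : Representation k (GLInf k) (PiT k σ ar) where
  toFun g := LinearMap.pi fun o => glKTensor k σ (ar o) g ∘ₗ LinearMap.proj o
  map_one' := by ext x o; simp
  map_mul' g h := by ext x o; simp

theorem glPi_apply (g : GLInf k) (x : PiT k σ ar) (o : O) :
    glPi k σ ar g x o = glKTensor k σ (ar o) g (x o) := rfl

theorem glPi_single (g : GLInf k) (o : O) (x : KTensor k σ (ar o)) :
    glPi k σ ar g (Pi.single o x) = Pi.single o (glKTensor k σ (ar o) g x) := by
  funext o'
  rw [glPi_apply]
  by_cases h : o' = o
  · subst h; simp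
  · rw [Pi.single_eq_of_ne h, Pi.single_eq_of_ne h, map_zero]

theorem glPi_smul (g : GLInf k) (a : RatK k σ) (x : PiT k σ ar) :
    glPi k σ ar g (a • x) = glRatK k σ g a • glPi k σ ar g x :=
  funext fun _ => glKTensor_smul σ _ g a _

theorem glPi_shapeEval (s : Shape r O) (g : GLInf k) (v : s.Pos σ ar → StdV k) :
    glPi k σ ar g (shapeEval k σ ar s fun p => liftV k (RatK k σ) (v p)) =
      shapeEval k σ ar s fun p => liftV k (RatK k σ) ((g : StdV k ≃ₗ[k] StdV k) (v p)) := by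
  rw [shapeEval_apply, shapeEval_apply, glPi_smul, glPi_single, map_prod, glKTensor_tens]
  simp only [glRatK_polForm]

/-- The index of the product of a form and a monomial. -/
def consIndex (s : Shape r O) (i : Fin r) (I : Fin (σ i).card → ℕ) (J : s.Pos σ ar → ℕ) :
    Shape.Pos σ ar (⟨s.out, s.num + 1, Fin.cons i s.blk⟩ : Shape r O) → ℕ :=
  Sum.elim (fun p => Fin.cases
    (motive := fun l => Fin (σ ((Fin.cons i s.blk : Fin (s.num + 1) → Fin r) l)).card → ℕ)
    I (fun l a => J (Sum.inl ⟨l, a⟩)) p.1 p.2) fun a => J (Sum.inr a)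

theorem polForm_smul_shapeEval (s : Shape r O) (i : Fin r) (I : Fin (σ i).card → ℕ)
    (J : s.Pos σ ar → ℕ) :
    polForm k σ i (fun a => stdB (RatK k σ) (I a)) •
        shapeEval k σ ar s (fun p => stdB (RatK k σ) (J p)) =
      shapeEval k σ ar ⟨s.out, s.num + 1, Fin.cons i s.blk⟩
        fun p => stdB (RatK k σ) (consIndex σ ar s i I J p) := by
  rw [shapeEval_apply, shapeEval_apply, smul_smul, Fin.prod_univ_succ]
  rfl

variable (k) in
/-- The `k`-span of the monomials. -/
def monSpan : Submodule k (PiT k σ ar) :=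
  LinearMap.range (theta (shapeEval k σ ar) (stdB (RatK k σ)))

theorem shapeEval_mem_monSpan (s : Shape r O) (J : s.Pos σ ar → ℕ) :
    shapeEval k σ ar s (fun p => stdB (RatK k σ) (J p)) ∈ monSpan k σ ar :=
  ⟨Finsupp.single ⟨s, J⟩ 1, by rw [theta_single, one_smul]⟩

/-- The symmetric algebra is generated by the values of the forms at basis vectors, and such a value
times a monomial is a monomial with one more form. -/
theorem smul_mem_monSpan (a : SymR k σ) :
    ∀ x ∈ monSpan k σ ar, algebraMap (SymR k σ) (RatK k σ) a • x ∈ monSpan k σ ar := by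
  induction a using SymmetricAlgebra.induction with
  | algebraMap c =>
    intro x hx
    rw [← IsScalarTower.algebraMap_apply, algebraMap_smul]
    exact Submodule.smul_mem _ _ hx
  | ι w =>
    have hw : w ∈ Submodule.span k (Set.range fun m : Σ i, (Fin (σ i).card → ℕ) =>
      blockProj k σ m.1 (tpowBasis k _ m.2)) := by rw [span_blockProj_eq_top]; trivial
    induction hw using Submodule.span_induction with
    | mem w hw =>
      obtain ⟨⟨i, I⟩, rfl⟩ := hw
      rintro _ ⟨X, rfl⟩
      rw [theta_apply, Finset.smul_sum]
      refine Submodule.sum_mem _ fun m _ => ?_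
      rw [smul_comm]
      refine Submodule.smul_mem _ _ ?_
      rw [← polForm_stdB, polForm_smul_shapeEval]
      exact shapeEval_mem_monSpan σ ar _ _
    | zero => intro x _; rw [map_zero, map_zero, zero_smul]; exact zero_mem _
    | add v w _ _ hv hw =>
      intro x hx
      rw [map_add, map_add, add_smul]
      exact add_mem (hv x hx) (hw x hx)
    | smul c w _ hw =>
      intro x hx
      have h1 : algebraMap (SymR k σ) (RatK k σ) (c • SymmetricAlgebra.ι k (SchurSum k σ) w) =
          c • algebraMap (SymR k σ) (RatK k σ) (SymmetricAlgebra.ι k (SchurSum k σ) w) := by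
        rw [Algebra.smul_def, map_mul, ← IsScalarTower.algebraMap_apply, ← Algebra.smul_def]
      rw [map_smul, h1, smul_assoc]
      exact Submodule.smul_mem _ _ (hw x hx)
  | mul a b ha hb =>
    intro x hx
    rw [map_mul, mul_smul]
    exact ha _ (hb x hx)
  | add a b ha hb =>
    intro x hx
    rw [map_add, add_smul]
    exact add_mem (ha x hx) (hb x hx)

/-- Basis tensors are monomials without forms. For sums and for multiples by fractions, denominators
are cleared, the span being stable under the symmetric algebra. -/
theorem exists_smul_mem_monSpan [Finite O] (x : PiT k σ ar) :
    ∃ a : RatK k σ, a ≠ 0 ∧ a • x ∈ monSpan k σ ar := by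
  suffices h : ∃ a : SymR k σ, a ≠ 0 ∧ algebraMap (SymR k σ) (RatK k σ) a • x ∈ monSpan k σ ar by
    obtain ⟨a, ha, h⟩ := h
    exact ⟨_, by rwa [Ne, FaithfulSMul.algebraMap_eq_zero_iff], h⟩
  have hadd : ∀ x y : PiT k σ ar,
      (∃ a : SymR k σ, a ≠ 0 ∧ algebraMap (SymR k σ) (RatK k σ) a • x ∈ monSpan k σ ar) →
      (∃ a : SymR k σ, a ≠ 0 ∧ algebraMap (SymR k σ) (RatK k σ) a • y ∈ monSpan k σ ar) →
      ∃ a : SymR k σ, a ≠ 0 ∧ algebraMap (SymR k σ) (RatK k σ) a • (x + y) ∈ monSpan k σ ar := by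
    rintro x y ⟨a, ha, hx⟩ ⟨b, hb, hy⟩
    refine ⟨a * b, mul_ne_zero ha hb, ?_⟩
    rw [smul_add]
    refine add_mem ?_ ?_
    · rw [mul_comm, map_mul, mul_smul]; exact smul_mem_monSpan σ ar b _ hx
    · rw [map_mul, mul_smul]; exact smul_mem_monSpan σ ar a _ hy
  have hzero : ∃ a : SymR k σ, a ≠ 0 ∧
      algebraMap (SymR k σ) (RatK k σ) a • (0 : PiT k σ ar) ∈ monSpan k σ ar :=
    ⟨1, one_ne_zero, by rw [smul_zero]; exact zero_mem _⟩
  have hsmul : ∀ (c : RatK k σ) (x : PiT k σ ar),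
      (∃ a : SymR k σ, a ≠ 0 ∧ algebraMap (SymR k σ) (RatK k σ) a • x ∈ monSpan k σ ar) →
      ∃ a : SymR k σ, a ≠ 0 ∧ algebraMap (SymR k σ) (RatK k σ) a • c • x ∈ monSpan k σ ar := by
    rintro c x ⟨a, ha, hx⟩
    obtain ⟨p, q, hq, rfl⟩ := IsFractionRing.div_surjective (A := SymR k σ) c
    have hq0 : q ≠ 0 := nonZeroDivisors.ne_zero hq
    refine ⟨a * q, mul_ne_zero ha hq0, ?_⟩
    have hq1 : algebraMap (SymR k σ) (RatK k σ) q ≠ 0 := by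
      rwa [Ne, FaithfulSMul.algebraMap_eq_zero_iff]
    rw [smul_smul, map_mul, mul_assoc, mul_div_cancel₀ _ hq1, mul_comm, mul_smul]
    exact smul_mem_monSpan σ ar p _ hx
  cases nonempty_fintype O
  rw [← Finset.univ_sum_single x]
  refine Finset.sum_induction _ (fun x : PiT k σ ar => ∃ a : SymR k σ, a ≠ 0 ∧
    algebraMap (SymR k σ) (RatK k σ) a • x ∈ monSpan k σ ar) hadd hzero fun o _ => ?_
  generalize x o = t
  induction (ktBasis k (RatK k σ) (ar o)).mem_span t using Submodule.span_induction with
  | mem t ht =>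
    obtain ⟨J, rfl⟩ := ht
    refine ⟨1, one_ne_zero, ?_⟩
    have := shapeEval_mem_monSpan (k := k) σ ar (⟨o, 0, Fin.elim0⟩ : Shape r O)
      (Sum.elim (fun p => p.1.elim0) J)
    rw [shapeEval_apply, Finset.univ_eq_empty, Finset.prod_empty, one_smul] at this
    rw [map_one, one_smul, ← tens_single]
    exact this
  | zero => rw [Pi.single_zero]; exact hzero
  | add x y _ _ hx hy => rw [Pi.single_add]; exact hadd _ _ hx hy
  | smul c x _ hx => rw [Pi.single_smul]; exact hsmul c _ hx

end Monomials

/-! ### Functoriality in the standard representation -/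

section Functor

variable {k : Type u} [Field k]

/-- The endomorphism of `V` with given columns. -/
def colMap (f : ℕ → StdV k) : StdV k →ₗ[k] StdV k := Finsupp.linearCombination k f

theorem colMap_single (f : ℕ → StdV k) (j : ℕ) : colMap f (Finsupp.single j 1) = f j := by
  simp [colMap]

/-- The endomorphism of `V^{⊗ n}` induced by an endomorphism of `V`. -/
def tpowMap (n : ℕ) (φ : StdV k →ₗ[k] StdV k) : TPow k n →ₗ[k] TPow k n :=
  PiTensorProduct.map (R := k) (s := fun _ : Fin n => StdV k) (t := fun _ : Fin n => StdV k)
    fun _ => φ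

theorem tpowMap_pure (n : ℕ) (φ : StdV k →ₗ[k] StdV k) (v : Fin n → StdV k) :
    tpowMap n φ (pureTensor v) = pureTensor fun i => φ (v i) :=
  PiTensorProduct.map_tprod _ _

theorem perm_tpowMap_comm (n : ℕ) (τ : Perm (Fin n)) (φ : StdV k →ₗ[k] StdV k) :
    permTPow k n τ ∘ₗ tpowMap n φ = tpowMap n φ ∘ₗ permTPow k n τ :=
  pure_ext fun v => by simp only [LinearMap.comp_apply, tpowMap_pure, permTPow_pure]

/-- The endomorphism of `S_μ(V)` induced by an endomorphism of `V`. -/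
def schurMap (μ : YoungDiagram) (φ : StdV k →ₗ[k] StdV k) : Schur k μ →ₗ[k] Schur k μ :=
  Representation.Coinvariants.map (diagRep k μ) (diagRep k μ)
    (Representation.IntertwiningMap.lTensor (spechtRep k μ)
      { toLinearMap := tpowMap μ.card φ
        isIntertwining' := fun τ => (perm_tpowMap_comm μ.card τ φ).symm })

variable {r : ℕ} (σ : Fin r → YoungDiagram)

/-- The endomorphism of `⨁ S_{σ i}(V)` induced by an endomorphism of `V`. -/
def sumMap (φ : StdV k →ₗ[k] StdV k) : SchurSum k σ →ₗ[k] SchurSum k σ :=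
  DirectSum.lmap fun i => schurMap (σ i) φ

theorem sumMap_blockProj (φ : StdV k →ₗ[k] StdV k) (i : Fin r) (t : TPow k (σ i).card) :
    sumMap σ φ (blockProj k σ i t) = blockProj k σ i (tpowMap _ φ t) :=
  DirectSum.lmap_lof _ _ _

theorem sumMap_blockProj_basis (f : ℕ → StdV k) (i : Fin r) (J : Fin (σ i).card → ℕ) :
    sumMap σ (colMap f) (blockProj k σ i (tpowBasis k _ J)) =
      blockProj k σ i (pureTensor fun a => f (J a)) := by
  rw [sumMap_blockProj, tpowBasis_apply, tpowMap_pure]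
  simp only [colMap_single]

theorem sum_ext {M : Type*} [AddCommGroup M] [Module k M] {f g : SchurSum k σ →ₗ[k] M}
    (h : ∀ i J, f (blockProj k σ i (tpowBasis k _ J)) = g (blockProj k σ i (tpowBasis k _ J))) :
    f = g := by
  refine LinearMap.ext_on (span_blockProj_eq_top k σ) ?_
  rintro _ ⟨m, rfl⟩
  exact h m.1 m.2

/-- The endomorphism of `V` with coefficients extended to `K` with given columns. -/
def extMap (K : Type u) [Field K] [Algebra k K] (f : ℕ → StdV k) : StdV K →ₗ[K] StdV K :=
  Finsupp.linearCombination K fun j => liftV k K (f j)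

theorem extMap_stdB (K : Type u) [Field K] [Algebra k K] (f : ℕ → StdV k) (j : ℕ) :
    extMap K f (stdB K j) = liftV k K (f j) := by
  simp [extMap, stdB]

theorem extMap_apply (K : Type u) [Field K] [Algebra k K] (f : ℕ → StdV k) (v : StdV K) :
    extMap K f v = v.sum fun j a => a • liftV k K (f j) := rfl

/-- An endomorphism of `V` over `k` acts on `K ⊗ S` through the second factor and leaves the
coefficients in `K` alone. This is the advantage of `K ⊗ S` over `K`, where coefficients and vectors
are mixed. -/
theorem sumMap_blockMap (f : ℕ → StdV k) (i : Fin r)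
    (v : Fin (σ i).card → StdV (RatK k σ)) :
    LinearMap.baseChange (RatK k σ) (sumMap σ (colMap f)) (blockMap k σ i v) =
      blockMap k σ i fun a => extMap (RatK k σ) f (v a) := by
  have h : (LinearMap.baseChange (RatK k σ) (sumMap σ (colMap f))).compMultilinearMap
      (blockMap k σ i) = (blockMap k σ i).compLinearMap fun _ => extMap (RatK k σ) f := by
    refine multilinear_ext fun J => ?_
    rw [LinearMap.compMultilinearMap_apply, MultilinearMap.compLinearMap_apply]
    simp only [extMap_stdB]
    rw [blockMap, LinearMap.compMultilinearMap_apply, LinearMap.compMultilinearMap_apply,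
      tens_stdB, tens_liftV, ← tpowBasis_apply, LinearMap.baseChange_tmul,
      LinearMap.baseChange_tmul, LinearMap.baseChange_tmul, sumMap_blockProj_basis]
  rw [← LinearMap.compMultilinearMap_apply, h, MultilinearMap.compLinearMap_apply]

/-- The columns of the projection of `V` that kills the coordinate `i`. -/
def killCol (i : ℕ) : ℕ → StdV k := Function.update (fun j => Finsupp.single j 1) i 0

theorem extMap_eq_self (K : Type u) [Field K] [Algebra k K] (f : ℕ → StdV k) {v : StdV K}
    (h : ∀ j, v j ≠ 0 → f j = Finsupp.single j 1) : extMap K f v = v := by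
  rw [extMap_apply]
  conv_rhs => rw [← Finsupp.sum_single v]
  refine Finset.sum_congr rfl fun j hj => ?_
  change v j • liftV k K (f j) = _
  rw [h j (by simpa using hj), liftV_single_eq]
  simp [stdB]

theorem sumMap_killCol_idem (i : ℕ) (w : SchurSum k σ) :
    sumMap σ (colMap (killCol i)) (sumMap σ (colMap (killCol i)) w) =
      sumMap σ (colMap (killCol (k := k) i)) w := by
  refine LinearMap.congr_fun (f := sumMap σ (colMap (killCol i)) ∘ₗ sumMap σ (colMap (killCol i)))
    (g := sumMap σ (colMap (killCol (k := k) i))) (sum_ext σ fun i' J => ?_) w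
  rw [LinearMap.comp_apply, sumMap_blockProj_basis, sumMap_blockProj, tpowMap_pure]
  congr 2
  funext a
  by_cases h : J a = i
  · simp [killCol, h]
  · simp only [killCol, Function.update_of_ne h, colMap_single]

theorem exists_sumMap_killCol_eq (w : SchurSum k σ) :
    ∃ N, ∀ i, N ≤ i → sumMap σ (colMap (killCol i)) w = w := by
  have hw : w ∈ Submodule.span k (Set.range fun m : Σ i, (Fin (σ i).card → ℕ) =>
      blockProj k σ m.1 (tpowBasis k _ m.2)) := by rw [span_blockProj_eq_top]; trivial
  induction hw using Submodule.span_induction with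
  | mem w hw =>
    obtain ⟨⟨i', J⟩, rfl⟩ := hw
    refine ⟨Finset.univ.sup J + 1, fun i hi => ?_⟩
    change sumMap σ (colMap (killCol i)) (blockProj k σ i' (tpowBasis k _ J)) =
      blockProj k σ i' (tpowBasis k _ J)
    rw [sumMap_blockProj_basis, tpowBasis_apply]
    congr 2
    funext a
    have : J a ≤ Finset.univ.sup J := Finset.le_sup (Finset.mem_univ a)
    rw [killCol, Function.update_of_ne (by omega)]
  | zero => exact ⟨0, fun i _ => map_zero _⟩
  | add v w _ _ hv hw =>
    obtain ⟨N, hN⟩ := hv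
    obtain ⟨M, hM⟩ := hw
    exact ⟨max N M, fun i hi => by rw [map_add, hN i (le_of_max_le_left hi),
      hM i (le_of_max_le_right hi)]⟩
  | smul c w _ hw =>
    obtain ⟨N, hN⟩ := hw
    exact ⟨N, fun i hi => by rw [map_smul, hN i hi]⟩

end Functor

/-! ### Translations of the field -/

section Translation

variable {k : Type u} [Field k] {r : ℕ} (σ : Fin r → YoungDiagram)

/-- The endomorphism `w ↦ w + θ(w)` of the symmetric algebra. -/
def transHom (θ : SchurSum k σ →ₗ[k] k) : SymR k σ →ₐ[k] SymR k σ :=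
  SymmetricAlgebra.lift (SymmetricAlgebra.ι k (SchurSum k σ) + Algebra.linearMap k (SymR k σ) ∘ₗ θ)

theorem transHom_ι (θ : SchurSum k σ →ₗ[k] k) (w : SchurSum k σ) :
    transHom σ θ (SymmetricAlgebra.ι k _ w) =
      SymmetricAlgebra.ι k _ w + algebraMap k (SymR k σ) (θ w) :=
  SymmetricAlgebra.lift_ι_apply _ _

theorem transHom_comp {θ θ' : SchurSum k σ →ₗ[k] k} (h : θ + θ' = 0) :
    (transHom σ θ).comp (transHom σ θ') = AlgHom.id k _ := by
  apply SymmetricAlgebra.algHom_ext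
  refine LinearMap.ext fun w => ?_
  change transHom σ θ (transHom σ θ' (SymmetricAlgebra.ι k _ w)) = SymmetricAlgebra.ι k _ w
  rw [transHom_ι, map_add, transHom_ι, AlgHom.commutes, add_assoc, ← map_add,
    ← LinearMap.add_apply, h]
  simp

/-- The automorphism `w ↦ w + θ(w)` of the field `K`. -/
def transK (θ : SchurSum k σ →ₗ[k] k) : RatK k σ ≃ₐ[k] RatK k σ :=
  IsFractionRing.fieldEquivOfAlgEquiv k (RatK k σ) (RatK k σ)
    (AlgEquiv.ofAlgHom (transHom σ θ) (transHom σ (-θ)) (transHom_comp σ (add_neg_cancel θ))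
      (transHom_comp σ (neg_add_cancel θ)))

theorem transK_algebraMap (θ : SchurSum k σ →ₗ[k] k) (a : SymR k σ) :
    transK σ θ (algebraMap (SymR k σ) (RatK k σ) a) =
      algebraMap (SymR k σ) (RatK k σ) (transHom σ θ a) :=
  IsFractionRing.fieldEquivOfAlgEquiv_algebraMap k (RatK k σ) (RatK k σ) _ a

/-- A linear form on `⨁ S_{σ i}(V)` that only involves the coordinate `i`. -/
def Involves (i : ℕ) (θ : SchurSum k σ →ₗ[k] k) : Prop :=
  ∀ w, θ (sumMap σ (colMap (killCol i)) w) = 0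

theorem exists_transHom_eq (a : SymR k σ) :
    ∃ N, ∀ i, N ≤ i → ∀ θ, Involves σ i θ → transHom σ θ a = a := by
  induction a using SymmetricAlgebra.induction with
  | algebraMap c => exact ⟨0, fun i _ θ _ => AlgHom.commutes _ _⟩
  | ι w =>
    obtain ⟨N, hN⟩ := exists_sumMap_killCol_eq σ w
    refine ⟨N, fun i hi θ hθ => ?_⟩
    have := hθ w
    rw [hN i hi] at this
    rw [transHom_ι, this, map_zero, add_zero]
  | mul a b ha hb =>
    obtain ⟨N, hN⟩ := ha
    obtain ⟨M, hM⟩ := hb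
    exact ⟨max N M, fun i hi θ hθ => by rw [map_mul, hN i (le_of_max_le_left hi) θ hθ,
      hM i (le_of_max_le_right hi) θ hθ]⟩
  | add a b ha hb =>
    obtain ⟨N, hN⟩ := ha
    obtain ⟨M, hM⟩ := hb
    exact ⟨max N M, fun i hi θ hθ => by rw [map_add, hN i (le_of_max_le_left hi) θ hθ,
      hM i (le_of_max_le_right hi) θ hθ]⟩

/-- Only finitely many coordinates of `V` occur in the numerator and the denominator. -/
theorem exists_transK_eq (a : RatK k σ) :
    ∃ N, ∀ i, N ≤ i → ∀ θ, Involves σ i θ → transK σ θ a = a := by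
  obtain ⟨p, q, -, rfl⟩ := IsFractionRing.div_surjective (A := SymR k σ) a
  obtain ⟨N, hN⟩ := exists_transHom_eq σ p
  obtain ⟨M, hM⟩ := exists_transHom_eq σ q
  exact ⟨max N M, fun i hi θ hθ => by rw [map_div₀, transK_algebraMap, transK_algebraMap,
    hN i (le_of_max_le_left hi) θ hθ, hM i (le_of_max_le_right hi) θ hθ]⟩

/-- The action of a translation on the vectors with coefficients in `K`. -/
def transV (θ : SchurSum k σ →ₗ[k] k) : StdV (RatK k σ) →+ StdV (RatK k σ) :=
  Finsupp.mapRange.addMonoidHom (transK σ θ : RatK k σ →+ RatK k σ)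

theorem transV_smul (θ : SchurSum k σ →ₗ[k] k) (a : RatK k σ) (v : StdV (RatK k σ)) :
    transV σ θ (a • v) = transK σ θ a • transV σ θ v := by
  ext j
  exact map_mul (transK σ θ) a (v j)

theorem transV_stdB (θ : SchurSum k σ →ₗ[k] k) (j : ℕ) :
    transV σ θ (stdB _ j) = stdB (RatK k σ) j := by
  simp [transV, stdB]

theorem exists_transV_eq (v : StdV (RatK k σ)) :
    ∃ N, ∀ i, N ≤ i → ∀ θ, Involves σ i θ → transV σ θ v = v := by
  induction v using Finsupp.induction_linear with
  | zero => exact ⟨0, fun _ _ _ _ => map_zero _⟩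
  | add v w hv hw =>
    obtain ⟨N, hN⟩ := hv
    obtain ⟨M, hM⟩ := hw
    exact ⟨max N M, fun i hi θ hθ => by rw [map_add, hN i (le_of_max_le_left hi) θ hθ,
      hM i (le_of_max_le_right hi) θ hθ]⟩
  | single j a =>
    obtain ⟨N, hN⟩ := exists_transK_eq σ a
    refine ⟨N, fun i hi θ hθ => ?_⟩
    have h1 : Finsupp.single j a = a • stdB (RatK k σ) j := by simp [stdB]
    rw [h1, transV_smul, transV_stdB, hN i hi θ hθ]

/-- The action of a translation on the coefficients of `K ⊗ S`. -/
def transE (θ : SchurSum k σ →ₗ[k] k) :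
    RatK k σ ⊗[k] SchurSum k σ ≃ₗ[k] RatK k σ ⊗[k] SchurSum k σ :=
  TensorProduct.congr (transK σ θ).toLinearEquiv (LinearEquiv.refl k _)

theorem transE_tmul (θ : SchurSum k σ →ₗ[k] k) (a : RatK k σ) (w : SchurSum k σ) :
    transE σ θ (a ⊗ₜ w) = transK σ θ a ⊗ₜ w := rfl

theorem transE_smul (θ : SchurSum k σ →ₗ[k] k) (a : RatK k σ)
    (x : RatK k σ ⊗[k] SchurSum k σ) : transE σ θ (a • x) = transK σ θ a • transE σ θ x := by
  induction x using TensorProduct.induction_on with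
  | zero => simp
  | tmul b w =>
    rw [TensorProduct.smul_tmul', transE_tmul, transE_tmul, TensorProduct.smul_tmul', smul_eq_mul,
      smul_eq_mul, map_mul]
  | add x y hx hy => rw [smul_add, map_add, hx, hy, map_add, smul_add]

theorem transE_symm_smul (θ : SchurSum k σ →ₗ[k] k) (a : RatK k σ)
    (x : RatK k σ ⊗[k] SchurSum k σ) :
    (transE σ θ).symm (transK σ θ a • x) = a • (transE σ θ).symm x := by
  rw [LinearEquiv.symm_apply_eq, transE_smul, LinearEquiv.apply_symm_apply]

theorem transE_blockMap (θ : SchurSum k σ →ₗ[k] k) (i : Fin r)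
    (v : Fin (σ i).card → StdV (RatK k σ)) :
    transE σ θ (blockMap k σ i v) = blockMap k σ i fun a => transV σ θ (v a) := by
  have hup : ∀ [DecidableEq (Fin (σ i).card)] (v : Fin (σ i).card → StdV (RatK k σ)) p x,
      (fun a => transV σ θ (Function.update v p x a)) =
        Function.update (fun a => transV σ θ (v a)) p (transV σ θ x) := fun v p x => by
    funext a
    by_cases ha : a = p
    · subst ha; simp
    · simp [ha]
  -- Both translations are semilinear for the same automorphism of `K`, so the composite with one of
  -- them inverted is `K`-multilinear and can be compared on basis vectors.
  let f : MultilinearMap (RatK k σ) (fun _ : Fin (σ i).card => StdV (RatK k σ))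
      (RatK k σ ⊗[k] SchurSum k σ) :=
    { toFun := fun v => (transE σ θ).symm (blockMap k σ i fun a => transV σ θ (v a))
      map_update_add' := fun v p x y => by
        rw [hup, hup, hup, map_add, MultilinearMap.map_update_add, map_add]
      map_update_smul' := fun v p c x => by
        rw [hup, hup, transV_smul, MultilinearMap.map_update_smul, transE_symm_smul] }
  have h : f = blockMap k σ i := by
    refine multilinear_ext fun J => ?_
    change (transE σ θ).symm (blockMap k σ i fun a => transV σ θ (stdB _ (J a))) = _
    rw [LinearEquiv.symm_apply_eq]
    simp only [transV_stdB]
    rw [blockMap, LinearMap.compMultilinearMap_apply, tens_stdB, LinearMap.baseChange_tmul,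
      transE_tmul, map_one]
  have h1 : (transE σ θ).symm (blockMap k σ i fun a => transV σ θ (v a)) = blockMap k σ i v :=
    congrArg (fun f => f v) h
  rw [← h1, LinearEquiv.apply_symm_apply]

/-- The extension of coefficients of a linear form. -/
def extForm (θ : SchurSum k σ →ₗ[k] k) : RatK k σ ⊗[k] SchurSum k σ →ₗ[RatK k σ] RatK k σ :=
  LinearMap.liftBaseChange (RatK k σ) (Algebra.linearMap k (RatK k σ) ∘ₗ θ)

theorem extForm_tmul (θ : SchurSum k σ →ₗ[k] k) (a : RatK k σ) (w : SchurSum k σ) :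
    extForm σ θ (a ⊗ₜ w) = a * algebraMap k (RatK k σ) (θ w) := by
  simp [extForm]

/-- On a sum of terms `a w`, the translation acts on the coefficients `a` and adds the scalar `θ w`
to each vector `w`. Differentiation is thus replaced by a field automorphism, which applies to
fractions directly. -/
theorem transK_sumForm (θ : SchurSum k σ →ₗ[k] k) (x : RatK k σ ⊗[k] SchurSum k σ) :
    transK σ θ (sumForm k σ x) = sumForm k σ (transE σ θ x) + extForm σ θ (transE σ θ x) := by
  induction x using TensorProduct.induction_on with
  | zero => simp
  | tmul a w =>
    rw [transE_tmul, sumForm_tmul, sumForm_tmul, extForm_tmul, map_mul, transK_algebraMap,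
      transHom_ι, map_add, mul_add, ← IsScalarTower.algebraMap_apply]
  | add x y hx hy => rw [map_add, map_add, hx, hy, map_add, map_add, map_add]; abel

theorem eq_zero_of_extForm_eq_zero {x : RatK k σ ⊗[k] SchurSum k σ}
    (h : ∀ θ, extForm σ θ x = 0) : x = 0 := by
  let b := Module.Basis.ofVectorSpace k (SchurSum k σ)
  refine (b.baseChange (RatK k σ)).ext_elem fun j => ?_
  have h1 : (b.baseChange (RatK k σ)).coord j = extForm σ (b.coord j) := by
    refine (b.baseChange (RatK k σ)).ext fun j' => ?_
    rw [Module.Basis.coord_apply, Module.Basis.repr_self, Module.Basis.baseChange_apply,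
      extForm_tmul, Module.Basis.coord_apply, Module.Basis.repr_self, one_mul]
    by_cases hj : j' = j
    · subst hj; simp
    · simp [hj]
  rw [map_zero, Finsupp.zero_apply, ← Module.Basis.coord_apply, h1, h]

end Translation

/-! ### Independence of the forms -/

section Independence

variable {k : Type u} [Field k] {r : ℕ} (σ : Fin r → YoungDiagram)

/-- A family of elements of `K ⊗ S` such that, for large `i`, the coefficients of the member of
index `i` do not involve the coordinate `i` of `V`, and all its vectors involve it. -/
def Separated (Y : ℕ → RatK k σ ⊗[k] SchurSum k σ) : Prop :=
  ∃ N, ∀ i, N ≤ i → LinearMap.baseChange (RatK k σ) (sumMap σ (colMap (killCol i))) (Y i) = 0 ∧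
    ∀ θ, Involves σ i θ → transE σ θ (Y i) = Y i

theorem Separated.add {Y Z : ℕ → RatK k σ ⊗[k] SchurSum k σ} (hY : Separated σ Y)
    (hZ : Separated σ Z) : Separated σ (Y + Z) := by
  obtain ⟨N, hN⟩ := hY
  obtain ⟨M, hM⟩ := hZ
  refine ⟨max N M, fun i hi => ⟨?_, fun θ hθ => ?_⟩⟩
  · rw [Pi.add_apply, map_add, (hN i (le_of_max_le_left hi)).1, (hM i (le_of_max_le_right hi)).1,
      add_zero]
  · rw [Pi.add_apply, map_add, (hN i (le_of_max_le_left hi)).2 θ hθ,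
      (hM i (le_of_max_le_right hi)).2 θ hθ]

theorem Separated.smul {Y : ℕ → RatK k σ ⊗[k] SchurSum k σ} (hY : Separated σ Y)
    (a : RatK k σ) : Separated σ (a • Y) := by
  obtain ⟨N, hN⟩ := hY
  obtain ⟨M, hM⟩ := exists_transK_eq σ a
  refine ⟨max N M, fun i hi => ⟨?_, fun θ hθ => ?_⟩⟩
  · rw [Pi.smul_apply, map_smul, (hN i (le_of_max_le_left hi)).1, smul_zero]
  · rw [Pi.smul_apply, transE_smul, (hN i (le_of_max_le_left hi)).2 θ hθ,
      hM i (le_of_max_le_right hi) θ hθ]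

theorem Separated.sum {ι : Type*} (s : Finset ι) {Y : ι → ℕ → RatK k σ ⊗[k] SchurSum k σ}
    (hY : ∀ i ∈ s, Separated σ (Y i)) : Separated σ (∑ i ∈ s, Y i) :=
  Finset.sum_induction _ (Separated σ) (fun _ _ h h' => h.add σ h')
    ⟨0, fun _ _ => ⟨map_zero _, fun _ _ => map_zero _⟩⟩ hY

/-- A translation that involves only the coordinate `i` fixes the coefficients of `Y i`; applied to
the relation `sumForm (Y i) = 0` it leaves the value of `θ'` at `Y i`, which is therefore 0. As the
vectors in `Y i` die with the coordinate `i`, the correction that makes `θ'` out of `θ` does not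
change this value. So all linear forms vanish at `Y i`. -/
theorem Separated.eventually_eq_zero {Y : ℕ → RatK k σ ⊗[k] SchurSum k σ} (hY : Separated σ Y)
    {L : ℕ} (h : ∀ i, L ≤ i → sumForm k σ (Y i) = 0) : ∃ N, ∀ i, N ≤ i → Y i = 0 := by
  obtain ⟨N, hN⟩ := hY
  refine ⟨max N L, fun i hi => eq_zero_of_extForm_eq_zero σ fun θ => ?_⟩
  obtain ⟨h1, h2⟩ := hN i (le_of_max_le_left hi)
  let θ' : SchurSum k σ →ₗ[k] k := θ - θ ∘ₗ sumMap σ (colMap (killCol i))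
  have hθ' : Involves σ i θ' := fun w => by
    simp only [θ', LinearMap.sub_apply, LinearMap.comp_apply, sumMap_killCol_idem, sub_self]
  have h3 := transK_sumForm σ θ' (Y i)
  rw [h2 θ' hθ', h i (le_of_max_le_right hi), map_zero, zero_add] at h3
  have h4 : extForm σ θ' = extForm σ θ - extForm σ θ ∘ₗ
      LinearMap.baseChange (RatK k σ) (sumMap σ (colMap (killCol i))) := by
    refine TensorProduct.AlgebraTensorModule.ext fun a w => ?_
    rw [LinearMap.sub_apply, LinearMap.comp_apply, LinearMap.baseChange_tmul, extForm_tmul,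
      extForm_tmul, extForm_tmul, ← mul_sub, ← map_sub]
    rfl
  rw [h4, LinearMap.sub_apply, LinearMap.comp_apply, h1, map_zero, sub_zero] at h3
  exact h3.symm

variable (k) in
/-- An occurrence of a vector in a form: the form, the position of the vector and the other
vectors. -/
structure Slot where
  /-- The index of the form. -/
  idx : Fin r
  /-- The position. -/
  pos : Fin (σ idx).card
  /-- The other vectors. -/
  vec : Fin (σ idx).card → StdV (RatK k σ)

variable {σ} in
/-- The map to `K ⊗ S` given by an occurrence of a vector in a form. -/
def Slot.map (S : Slot k σ) : StdV (RatK k σ) →ₗ[RatK k σ] RatK k σ ⊗[k] SchurSum k σ :=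
  (blockMap k σ S.idx).toLinearMap S.vec S.pos

variable {σ} in
theorem Slot.map_apply (S : Slot k σ) (v : StdV (RatK k σ)) :
    S.map v = blockMap k σ S.idx (Function.update S.vec S.pos v) := rfl

variable {σ} in
theorem Slot.sumForm_map (S : Slot k σ) (v : StdV (RatK k σ)) :
    sumForm k σ (S.map v) = polForm k σ S.idx (Function.update S.vec S.pos v) := rfl

theorem exists_forall_apply_eq_zero {ι : Type*} [Finite ι] (v : ι → StdV (RatK k σ)) :
    ∃ N, ∀ i, N ≤ i → ∀ p, v p i = 0 := by
  cases nonempty_fintype ι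
  refine ⟨Finset.univ.sup (fun p => (v p).support.sup id) + 1, fun i hi p => ?_⟩
  by_contra h
  have h1 : id i ≤ (v p).support.sup id := Finset.le_sup (by simpa using h)
  have h2 : (v p).support.sup id ≤ Finset.univ.sup (fun p => (v p).support.sup id) :=
    Finset.le_sup (f := fun p => (v p).support.sup id) (Finset.mem_univ p)
  simp only [id] at h1
  omega

theorem update_comp {ι A B : Type*} [DecidableEq ι] (f : A → B) (v : ι → A) (p : ι) (x : A) :
    (fun a => f (Function.update v p x a)) = Function.update (fun a => f (v a)) p (f x) := by
  funext a
  by_cases ha : a = p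
  · subst ha; simp
  · simp [ha]

theorem extMap_killCol_self (i : ℕ) :
    extMap (RatK k σ) (killCol (k := k) i) (stdB _ i) = 0 := by
  rw [extMap_stdB, killCol, Function.update_self, map_zero]

/-- The argument `e_i` dies with the coordinate `i`, and the finitely many coefficients of the other
vectors do not involve a large `i`. -/
theorem Slot.separated (S : Slot k σ) : Separated σ fun i => S.map (stdB _ i) := by
  obtain ⟨N, hN⟩ : ∃ N, ∀ i, N ≤ i → ∀ θ, Involves σ i θ → ∀ p, transV σ θ (S.vec p) = S.vec p := by
    choose N hN using fun p => exists_transV_eq σ (S.vec p)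
    refine ⟨Finset.univ.sup N, fun i hi θ hθ p => hN p i (le_trans ?_ hi) θ hθ⟩
    exact Finset.le_sup (Finset.mem_univ p)
  refine ⟨N, fun i hi => ⟨?_, fun θ hθ => ?_⟩⟩
  · beta_reduce
    rw [S.map_apply, sumMap_blockMap, update_comp, extMap_killCol_self]
    exact MultilinearMap.map_update_zero _ _ _
  · beta_reduce
    rw [S.map_apply, transE_blockMap, update_comp, transV_stdB]
    congr 2
    funext p
    exact hN i hi θ hθ p

/-- The columns of the projection of `V` that kills the coordinates of index less than `L`. -/
def killBelow (L : ℕ) : ℕ → StdV k := fun j => if j < L then 0 else Finsupp.single j 1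

/-- The vectors of `V` with vanishing coordinates of index less than `L` separate a
combination of occurrences that only involves such vectors from the occurrences in which there is
a vector whose other coordinates vanish. -/
theorem exists_vector_sumForm_ne_zero (L : ℕ) {B : Type*} [Finite B] (S : B → Slot k σ)
    (hS : ∀ b, ∃ q, q ≠ (S b).pos ∧ ∀ j, L ≤ j → (S b).vec q j = 0)
    {M : Type*} (s : Finset M) (a : M → RatK k σ) (T : M → Slot k σ)
    (hT : ∀ m ∈ s, ∀ q, q ≠ (T m).pos → ∀ j, j < L → (T m).vec q j = 0) (s₀ : ℕ)
    (h₀ : ∑ m ∈ s, a m * sumForm k σ ((T m).map (stdB _ s₀)) ≠ 0) :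
    ∃ v : StdV (RatK k σ), (∀ j, j < L → v j = 0) ∧ (∀ b, sumForm k σ ((S b).map v) = 0) ∧
      ∑ m ∈ s, a m * sumForm k σ ((T m).map v) ≠ 0 := by
  by_contra hcon
  push Not at hcon
  cases nonempty_fintype B
  -- The shift by `L` parametrizes the vectors whose coordinates below `L` vanish.
  let sh : StdV (RatK k σ) →ₗ[RatK k σ] StdV (RatK k σ) :=
    Finsupp.lmapDomain (RatK k σ) (RatK k σ) fun i => i + L
  have hsh : ∀ v j, j < L → sh v j = 0 := fun v j hj => by
    refine Finsupp.mapDomain_of_notMem_range _ _ ?_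
    rintro ⟨i, hi⟩
    simp only at hi
    omega
  have hsh1 : ∀ i, sh (stdB _ i) = stdB _ (i + L) := fun i => by
    simp [sh, stdB]
  let X : StdV (RatK k σ) →ₗ[RatK k σ] RatK k σ ⊗[k] SchurSum k σ := ∑ m ∈ s, a m • (T m).map
  have hX : ∀ v, sumForm k σ (X v) = ∑ m ∈ s, a m * sumForm k σ ((T m).map v) := fun v => by
    simp only [X, LinearMap.sum_apply, LinearMap.smul_apply, map_sum, map_smul, smul_eq_mul]
  -- If no vector is suitable, the combination vanishes on the common kernel of finitely many linear
  -- forms, hence is a linear combination of them over `K`.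
  have hmem : sumForm k σ ∘ₗ X ∘ₗ sh ∈
      Submodule.span (RatK k σ) (Set.range fun b => sumForm k σ ∘ₗ (S b).map ∘ₗ sh) := by
    refine mem_span_of_iInf_ker_le_ker fun v hv => ?_
    rw [Submodule.mem_iInf] at hv
    rw [LinearMap.mem_ker]
    change sumForm k σ (X (sh v)) = 0
    rw [hX]
    exact hcon _ (hsh v) hv
  obtain ⟨ν, hν⟩ := (Submodule.mem_span_range_iff_exists_fun _).1 hmem
  -- The relation at `e_i`, lifted from `K` to `K ⊗ S`. Its coefficients are independent of `i`, so
  -- it is a separated family.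
  let Y : ℕ → RatK k σ ⊗[k] SchurSum k σ := fun i =>
    X (stdB _ i) + ∑ b, (-ν b) • (S b).map (stdB _ i)
  have hYsep : Separated σ Y := by
    have h1 : Y = (∑ m ∈ s, a m • fun i => (T m).map (stdB _ i)) +
        ∑ b, (-ν b) • fun i => (S b).map (stdB _ i) := by
      funext i
      simp only [Y, X, LinearMap.sum_apply, LinearMap.smul_apply, Pi.add_apply, Finset.sum_apply,
        Pi.smul_apply]
    rw [h1]
    exact (Separated.sum σ s fun m _ => ((T m).separated σ).smul σ _).add σ
      (Separated.sum σ _ fun b _ => ((S b).separated σ).smul σ _)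
  have hYzero : ∀ i, L ≤ i → sumForm k σ (Y i) = 0 := by
    intro i hi
    obtain ⟨j, rfl⟩ := Nat.exists_eq_add_of_le' hi
    have h1 := LinearMap.congr_fun hν (stdB _ j)
    rw [LinearMap.sum_apply] at h1
    simp only [LinearMap.smul_apply, LinearMap.comp_apply, hsh1, smul_eq_mul] at h1
    simp only [Y, map_add, map_sum, map_smul, smul_eq_mul]
    rw [← h1, ← Finset.sum_add_distrib]
    exact Finset.sum_eq_zero fun b _ => by ring
  obtain ⟨N, hN⟩ := hYsep.eventually_eq_zero σ hYzero
  have hvec : ∃ M, ∀ i, M ≤ i → ∀ m ∈ s, ∀ q, (T m).vec q i = 0 := by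
    choose N hN using fun m => exists_forall_apply_eq_zero σ (T m).vec
    exact ⟨s.sup N, fun i hi m hm q => hN m i (le_trans (Finset.le_sup hm) hi) q⟩
  obtain ⟨N', hN'⟩ := hvec
  obtain ⟨i, hi, hi', hiL⟩ : ∃ i, N ≤ i ∧ N' ≤ i ∧ L ≤ i :=
    ⟨max N (max N' L), le_max_left _ _, (le_max_left _ _).trans (le_max_right _ _),
      (le_max_right _ _).trans (le_max_right _ _)⟩
  -- Killing the coordinates below `L` annihilates the occurrences `S b`, which have another
  -- argument supported there, and leaves the terms `T m` unchanged.
  have h1 : X (stdB _ i) = 0 := by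
    have h2 := congrArg
      (LinearMap.baseChange (RatK k σ) (sumMap σ (colMap (killBelow (k := k) L)))) (hN i hi)
    simp only [Y, X, LinearMap.sum_apply, LinearMap.smul_apply, map_add, map_sum, map_smul,
      map_zero, Slot.map_apply, sumMap_blockMap] at h2
    rw [Finset.sum_eq_zero (s := Finset.univ) fun b _ => ?_, add_zero] at h2
    · simp only [X, LinearMap.sum_apply, LinearMap.smul_apply, Slot.map_apply]
      rw [← h2]
      refine Finset.sum_congr rfl fun m hm => ?_
      congr 2
      funext q
      rw [extMap_eq_self]
      intro j hj
      rw [killBelow, if_neg]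
      intro hjL
      refine hj ?_
      by_cases hq : q = (T m).pos
      · rw [hq, Function.update_self, stdB, Finsupp.single_eq_of_ne (by omega)]
      · rw [Function.update_of_ne hq]
        exact hT m hm q hq j hjL
    · obtain ⟨q, hq, hqL⟩ := hS b
      rw [(blockMap k σ (S b).idx).map_coord_zero q, smul_zero]
      rw [Function.update_of_ne hq, extMap_apply]
      refine Finset.sum_eq_zero fun j hj => ?_
      have hjL : j < L := by
        by_contra hjL
        exact (Finsupp.mem_support_iff.1 hj) (hqL j (not_lt.1 hjL))
      simp only [killBelow, if_pos hjL, map_zero, smul_zero]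
  refine h₀ ?_
  rw [← hX]
  -- The index `i` does not occur in the other arguments of the `T m`, so the substitution `e_i ↦
  -- e_{s₀}` carries the vanishing from `e_i` to `e_{s₀}`, where it contradicts `h₀`.
  have h2 := congrArg (LinearMap.baseChange (RatK k σ) (sumMap σ (colMap
    (Function.update (fun j => Finsupp.single j (1 : k)) i (Finsupp.single s₀ 1))))) h1
  simp only [X, LinearMap.sum_apply, LinearMap.smul_apply, map_sum, map_smul,
      map_zero, Slot.map_apply, sumMap_blockMap, update_comp, extMap_stdB, Function.update_self,
      liftV_single_eq] at h2
  have h3 : X (stdB _ s₀) = 0 := by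
    rw [← h2]
    simp only [X, LinearMap.sum_apply, LinearMap.smul_apply, Slot.map_apply]
    refine Finset.sum_congr rfl fun m hm => ?_
    congr 3
    funext q
    rw [extMap_eq_self]
    intro j hj
    rw [Function.update_of_ne]
    rintro rfl
    exact hj (hN' _ hi' m hm q)
  rw [h3, map_zero]

end Independence

/-! ### Choice of the vectors carried by the forms. -/

section Selection

variable {k : Type u} [Field k] {r : ℕ} (σ : Fin r → YoungDiagram)

variable (k) in
/-- The value of a product of forms at the vectors `h`. -/
def formProd {C : Type*} {N : ℕ} (b : Fin N → Fin r) (I : (Σ l, Fin (σ (b l)).card) → C)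
    (h : C → StdV (RatK k σ)) : RatK k σ :=
  ∏ l, polForm k σ (b l) fun a => h (I ⟨l, a⟩)

open Classical in
-- As `I` is a bijection, the index `c` is an argument of exactly one of the forms, and the product
-- depends linearly on its vector.
theorem formProd_update {C : Type*} {N : ℕ} (b : Fin N → Fin r)
    (I : (Σ l, Fin (σ (b l)).card) → C) (hI : Function.Bijective I) (h : C → StdV (RatK k σ))
    (c : C) : ∃ (a : RatK k σ) (l : Fin N) (p : Fin (σ (b l)).card),
      ∀ v, formProd k σ b I (Function.update h c v) =
        a * sumForm k σ ((⟨b l, p, fun q => h (I ⟨l, q⟩)⟩ : Slot k σ).map v) := by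
  obtain ⟨⟨l, p⟩, hlp⟩ := hI.2 c
  refine ⟨∏ l' ∈ Finset.univ.erase l, polForm k σ (b l') fun a => h (I ⟨l', a⟩), l, p,
    fun v => ?_⟩
  have h1 : ∀ l' ∈ Finset.univ.erase l,
      (polForm k σ (b l') fun a => Function.update h c v (I ⟨l', a⟩)) =
        polForm k σ (b l') fun a => h (I ⟨l', a⟩) := by
    intro l' hl'
    congr 1
    funext a
    rw [Function.update_of_ne]
    intro h1
    rw [← hlp] at h1
    exact Finset.ne_of_mem_erase hl' (congrArg Sigma.fst (hI.1 h1))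
  have h2 : (fun a => Function.update h c v (I ⟨l, a⟩)) =
      Function.update (fun a => h (I ⟨l, a⟩)) p v := by
    funext a
    by_cases ha : a = p
    · subst ha; rw [hlp, Function.update_self, Function.update_self]
    · rw [Function.update_of_ne ha, Function.update_of_ne]
      intro h1
      rw [← hlp] at h1
      have := hI.1 h1
      simp only [Sigma.mk.injEq, heq_eq_eq, true_and] at this
      exact ha this
  have h3 : formProd k σ b I (Function.update h c v) =
      (∏ l' ∈ Finset.univ.erase l, polForm k σ (b l') fun a =>
        Function.update h c v (I ⟨l', a⟩)) *
      polForm k σ (b l) fun a => Function.update h c v (I ⟨l, a⟩) :=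
    (Finset.prod_erase_mul _ _ (Finset.mem_univ l)).symm
  rw [h3, h2, Finset.prod_congr rfl h1, Slot.sumForm_map]

/-- The vectors attached to the indices: the given ones, or the first vectors of the basis. -/
def mixVec {C : Type*} {L : ℕ} (h : C → StdV (RatK k σ)) : C ⊕ Fin L → StdV (RatK k σ) :=
  Sum.elim h fun j => stdB _ j

open Classical in
/-- There are vectors at which a given combination of products of forms does not vanish, but the
forms vanish if one of the arguments is one of these vectors, another one is a basis vector of
small index, and none of these vectors occurs twice. -/
theorem exists_selection {C : Type*} [Finite C] (L : ℕ) {M : Type*} (s : Finset M)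
    (a : M → RatK k σ) (N : M → ℕ) (b : ∀ m, Fin (N m) → Fin r)
    (I : ∀ m, (Σ l, Fin (σ (b m l)).card) → C) (hI : ∀ m ∈ s, Function.Bijective (I m))
    (f : C → ℕ) (hf : ∀ c, L ≤ f c)
    (h₀ : ∑ m ∈ s, a m * formProd k σ (b m) (I m) (fun c => stdB _ (f c)) ≠ 0) :
    ∃ h : C → StdV (RatK k σ), ∑ m ∈ s, a m * formProd k σ (b m) (I m) h ≠ 0 ∧
      ∀ (i : Fin r) (J : Fin (σ i).card → C ⊕ Fin L),
        (∀ p q c, J p = Sum.inl c → J q = Sum.inl c → p = q) →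
        (∃ p c, J p = Sum.inl c) → (∃ p j, J p = Sum.inr j) →
        polForm k σ i (fun p => mixVec σ h (J p)) = 0 := by
  cases nonempty_fintype C
  -- The vectors are chosen one at a time: those of index in `D` are chosen, the others are still
  -- the basis vectors `e_{f c}`. All of them have vanishing coordinates below `L`, which the choice
  -- of the next one needs.
  suffices key : ∀ D : Finset C, ∃ h : C → StdV (RatK k σ),
      ∑ m ∈ s, a m * formProd k σ (b m) (I m) h ≠ 0 ∧ (∀ c j, j < L → h c j = 0) ∧
      (∀ c, c ∉ D → h c = stdB _ (f c)) ∧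
      ∀ (i : Fin r) (J : Fin (σ i).card → C ⊕ Fin L),
        (∀ p q c, J p = Sum.inl c → J q = Sum.inl c → p = q) → (∀ p c, J p = Sum.inl c → c ∈ D) →
        (∃ p c, J p = Sum.inl c) → (∃ p j, J p = Sum.inr j) →
        polForm k σ i (fun p => mixVec σ h (J p)) = 0 by
    obtain ⟨h, h1, -, -, h4⟩ := key Finset.univ
    exact ⟨h, h1, fun i J hJ h5 h6 => h4 i J hJ (fun _ _ _ => Finset.mem_univ _) h5 h6⟩
  intro D
  induction D using Finset.induction_on with
  | empty =>
    refine ⟨_, h₀, fun c j hj => ?_, fun _ _ => rfl, fun i J _ hJ h5 _ => ?_⟩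
    · rw [stdB, Finsupp.single_eq_of_ne]
      have := hf c
      omega
    · obtain ⟨p, c, hp⟩ := h5
      exact absurd (hJ p c hp) (Finset.notMem_empty c)
  | insert c D hc ih =>
    obtain ⟨h, h1, h2, h3, h4⟩ := ih
    -- The finitely many conditions on the new vector: all the ways to place it at a position of a
    -- form that also has a basis vector of index below `L` as an argument.
    let B := {x : Σ i, (Fin (σ i).card → C ⊕ Fin L) × Fin (σ i).card //
      x.2.1 x.2.2 = Sum.inl c ∧ ∃ q j, x.2.1 q = Sum.inr j}
    choose A l p hA using fun m : s => formProd_update σ (b m) (I m) (hI m m.2) h c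
    have hS : ∀ x : B, ∃ q, q ≠ x.1.2.2 ∧ ∀ j, L ≤ j → mixVec σ h (x.1.2.1 q) j = 0 := by
      rintro ⟨⟨i, J, p⟩, hp, q, j, hq⟩
      refine ⟨q, ?_, fun i hi => ?_⟩
      · intro hqp
        have hq' : J q = Sum.inr j := hq
        rw [show q = p from hqp] at hq'
        exact absurd (hp.symm.trans hq') (by simp)
      · simp only at hq
        simp only [hq]
        have := j.2
        exact Finsupp.single_eq_of_ne (by omega)
    have hT : ∑ m ∈ s.attach, a m * A m * sumForm k σ
        ((⟨b m (l m), p m, fun q => h (I m ⟨l m, q⟩)⟩ : Slot k σ).map (stdB _ (f c))) ≠ 0 := by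
      rw [← Finset.sum_attach] at h1
      convert h1 using 1
      refine Finset.sum_congr rfl fun m _ => ?_
      rw [mul_assoc, ← hA, ← h3 c hc, Function.update_eq_self]
    obtain ⟨v, hv1, hv2, hv3⟩ := exists_vector_sumForm_ne_zero σ L (B := B)
      (fun x => ⟨x.1.1, x.1.2.2, fun q => mixVec σ h (x.1.2.1 q)⟩) hS s.attach
      (fun m => a m * A m) (fun m => ⟨b m (l m), p m, fun q => h (I m ⟨l m, q⟩)⟩)
      (fun m _ q _ j hj => h2 _ j hj) (f c) hT
    · refine ⟨Function.update h c v, ?_, fun c' j hj => ?_, fun c' hc' => ?_,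
        fun i J hJ hJD h5 h6 => ?_⟩
      · rw [← Finset.sum_attach]
        convert hv3 using 1
        refine Finset.sum_congr rfl fun m _ => ?_
        rw [hA, mul_assoc]
      · by_cases hcc : c' = c
        · subst hcc; rw [Function.update_self]; exact hv1 j hj
        · rw [Function.update_of_ne hcc]; exact h2 c' j hj
      · rw [Finset.mem_insert, not_or] at hc'
        rw [Function.update_of_ne hc'.1]
        exact h3 c' hc'.2
      · by_cases hcJ : ∃ p, J p = Sum.inl c
        · obtain ⟨p, hp⟩ := hcJ
          have h7 := hv2 ⟨⟨i, J, p⟩, hp, h6⟩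
          rw [Slot.sumForm_map] at h7
          rw [← h7]
          congr 1
          funext q
          by_cases hq : q = p
          · rw [hq, Function.update_self, hp]
            change Function.update h c v c = v
            rw [Function.update_self]
          · rw [Function.update_of_ne hq]
            change mixVec σ _ (J q) = mixVec σ h (J q)
            rcases hJq : J q with c' | j
            · change Function.update h c v c' = h c'
              rw [Function.update_of_ne]
              rintro rfl
              exact hq (hJ q p c' hJq hp)
            · rfl
        · push Not at hcJ
          rw [← h4 i J hJ (fun p c' hp => ?_) h5 h6]
          · congr 1
            funext q
            rcases hJq : J q with c' | j
            · change Function.update h c v c' = h c'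
              rw [Function.update_of_ne]
              rintro rfl
              exact hcJ q hJq
            · rfl
          · refine Finset.mem_of_mem_insert_of_ne (hJD p c' hp) ?_
            rintro rfl
            exact hcJ p hp

end Selection

/-! ### A traceless tensor that generates a free module -/

section FreeVector

variable {k : Type u} [Field k] {r : ℕ} (σ : Fin r → YoungDiagram)

/-- Finitely many linear forms have a common nonzero kernel in the infinite-dimensional space of
vectors with vanishing coordinates below `L`. -/
theorem exists_vector_forms_eq_zero (L : ℕ) {B : Type*} [Finite B]
    (S : B → StdV (RatK k σ) →ₗ[RatK k σ] RatK k σ) :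
    ∃ v : StdV (RatK k σ), v ≠ 0 ∧ (∀ j, j < L → v j = 0) ∧ ∀ b, S b v = 0 := by
  let sh : StdV (RatK k σ) →ₗ[RatK k σ] StdV (RatK k σ) :=
    Finsupp.lmapDomain (RatK k σ) (RatK k σ) fun i => i + L
  have hinj : Function.Injective sh := Finsupp.mapDomain_injective fun i j hij => by
    simpa using hij
  let F : StdV (RatK k σ) →ₗ[RatK k σ] (B → RatK k σ) := LinearMap.pi fun b => S b ∘ₗ sh
  have hF : ¬ Function.Injective F := fun h => by
    have h1 := Module.Finite.of_injective F h
    have h2 := Module.Finite.finite_basis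
      (Finsupp.basisSingleOne : Module.Basis ℕ (RatK k σ) (StdV (RatK k σ)))
    exact not_finite ℕ
  rw [← LinearMap.ker_eq_bot, Submodule.eq_bot_iff] at hF
  push Not at hF
  obtain ⟨v, hv, hv0⟩ := hF
  refine ⟨sh v, fun h => hv0 (hinj (h.trans (map_zero sh).symm)), fun j hj => ?_, fun b => ?_⟩
  · refine Finsupp.mapDomain_of_notMem_range _ _ ?_
    rintro ⟨i, hi⟩
    simp only at hi
    omega
  · exact congrFun (LinearMap.mem_ker.1 hv) b

open Classical in
/-- Vectors with disjoint supports at which the forms vanish. -/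
theorem exists_disjoint_vectors (hσ : ∀ i, σ i ≠ ⊥) (n : ℕ) :
    ∃ v : Fin n → StdV (RatK k σ), (∀ a, v a ≠ 0) ∧
      (∀ a b j, a ≠ b → v a j ≠ 0 → v b j = 0) ∧
      ∀ i (J : Fin (σ i).card → Fin n), Function.Injective J →
        polForm k σ i (fun p => v (J p)) = 0 := by
  induction n with
  | zero =>
    refine ⟨Fin.elim0, fun a => a.elim0, fun a => a.elim0, fun i J _ => ?_⟩
    -- A form of a non-empty partition has at least one argument, so nothing can be placed in it
    -- when `n = 0`.
    have h1 : (σ i).card ≠ 0 := fun h => hσ i (by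
      rw [YoungDiagram.card, Finset.card_eq_zero] at h
      exact YoungDiagram.ext (by rw [h]; rfl))
    exact (J ⟨0, Nat.pos_of_ne_zero h1⟩).elim0
  | succ n ih =>
    obtain ⟨v, hv0, hvd, hv⟩ := ih
    obtain ⟨L, hL⟩ := exists_forall_apply_eq_zero σ v
    obtain ⟨w, hw0, hwL, hw⟩ := exists_vector_forms_eq_zero σ L
      (B := Σ i, (Fin (σ i).card → Fin (n + 1)) × Fin (σ i).card) (fun x =>
        (polForm k σ x.1).toLinearMap (fun p => (Fin.snoc v 0 : Fin (n + 1) → _) (x.2.1 p)) x.2.2)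
    refine ⟨Fin.snoc v w, fun a => ?_, fun a b j => ?_, fun i J hJ => ?_⟩
    · refine Fin.lastCases ?_ (fun a => ?_) a
      · rwa [Fin.snoc_last]
      · rw [Fin.snoc_castSucc]; exact hv0 a
    · refine Fin.lastCases ?_ (fun a => ?_) a <;> refine Fin.lastCases ?_ (fun b => ?_) b
      · intro h; exact absurd rfl h
      · rw [Fin.snoc_last, Fin.snoc_castSucc]
        intro _ h
        by_contra hb
        exact h (hwL j (by by_contra hj; exact hb (hL j (not_lt.1 hj) b)))
      · rw [Fin.snoc_last, Fin.snoc_castSucc]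
        intro _ h
        by_contra hb
        exact h (hL j (not_lt.1 fun hj => hb (hwL j hj)) a)
      · rw [Fin.snoc_castSucc, Fin.snoc_castSucc]
        intro h
        exact hvd a b j (by rintro rfl; exact h rfl)
    · by_cases hlast : ∃ p, J p = Fin.last n
      · obtain ⟨p, hp⟩ := hlast
        rw [← hw ⟨i, J, p⟩]
        change _ = polForm k σ i (Function.update _ p w)
        congr 1
        funext q
        by_cases hq : q = p
        · rw [hq, Function.update_self, hp, Fin.snoc_last]
        · rw [Function.update_of_ne hq]
          have : J q ≠ Fin.last n := fun h => hq (hJ (h.trans hp.symm))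
          obtain ⟨c, hc⟩ := Fin.exists_castSucc_eq.2 this
          change _ = (Fin.snoc v 0 : Fin (n + 1) → StdV (RatK k σ)) (J q)
          rw [← hc, Fin.snoc_castSucc, Fin.snoc_castSucc]
      · push Not at hlast
        choose J' hJ' using fun p => Fin.exists_castSucc_eq.2 (hlast p)
        rw [← hv i J' fun p q hpq => hJ (by rw [← hJ', ← hJ', hpq])]
        congr 1
        funext p
        rw [← hJ', Fin.snoc_castSucc]

end FreeVector

/-! ### Insertion of tensors in monomials -/

section Insertion

variable {k : Type u} [Field k] {r : ℕ} (σ : Fin r → YoungDiagram)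

open Classical in
/-- The vectors `h`, with those of index `B a` replaced by the vectors of the basis of index
`J a`. -/
def glue {K : Type u} [Field K] {n : ℕ} (B : Fin n → ℕ) (h : ℕ → StdV K) (J : Fin n → ℕ) (c : ℕ) :
    StdV K :=
  if hc : ∃ a, B a = c then stdB K (J hc.choose) else h c

theorem glue_apply {K : Type u} [Field K] {n : ℕ} {B : Fin n → ℕ} (hB : Function.Injective B)
    (h : ℕ → StdV K) (J : Fin n → ℕ) (a : Fin n) : glue B h J (B a) = stdB K (J a) := by
  have hc : ∃ a', B a' = B a := ⟨a, rfl⟩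
  rw [glue, dif_pos hc, hB hc.choose_spec]

theorem glue_of_notMem {K : Type u} [Field K] {n : ℕ} {B : Fin n → ℕ} (h : ℕ → StdV K)
    (J : Fin n → ℕ) {c : ℕ} (hc : ∀ a, B a ≠ c) : glue B h J c = h c := by
  rw [glue, dif_neg (by push Not; exact hc)]

theorem exists_equiv_extend {d n : ℕ} {f : Fin d → Fin n} (hf : Function.Injective f) :
    ∃ e : Fin d ⊕ Fin (n - d) ≃ Fin n, ∀ a, e (Sum.inl a) = f a := by
  classical
  have h1 : Fintype.card ((Set.range f)ᶜ : Set (Fin n)) = n - d := by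
    rw [Fintype.card_compl_set, Set.card_range_of_injective hf, Fintype.card_fin, Fintype.card_fin]
  exact ⟨((Equiv.ofInjective f hf).sumCongr (Fintype.equivFinOfCardEq h1).symm).trans
    (Equiv.Set.sumCompl (Set.range f)), fun a => rfl⟩

variable {O : Type} [DecidableEq O] (ar : O → ℕ)

variable (k) in
/-- The linear map that inserts a tensor in the arguments of index `B` of a monomial. -/
def insertMap {n : ℕ} (s : Shape r O) (I : s.Pos σ ar → ℕ) (B : Fin n → ℕ)
    (h : ℕ → StdV (RatK k σ)) : KTensor k σ n →ₗ[RatK k σ] PiT k σ ar :=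
  (ktBasis k (RatK k σ) n).constr (RatK k σ) fun J =>
    shapeEval k σ ar s fun p => glue B h J (I p)

theorem insertMap_basis {n : ℕ} (s : Shape r O) (I : s.Pos σ ar → ℕ) (B : Fin n → ℕ)
    (h : ℕ → StdV (RatK k σ)) (J : Fin n → ℕ) :
    insertMap k σ ar s I B h (ktBasis k (RatK k σ) n J) =
      shapeEval k σ ar s fun p => glue B h J (I p) :=
  Module.Basis.constr_basis _ _ _ _

open Classical in
-- All the arguments of the form `l` are taken from the inserted tensor, so the insertion factors
-- through a contraction.
theorem insertMap_eq_zero_of_traceless {n : ℕ} {s : Shape r O} {I : s.Pos σ ar → ℕ}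
    (hI : Function.Injective I) {B : Fin n → ℕ} (hB : Function.Injective B)
    (h : ℕ → StdV (RatK k σ)) (l : Fin s.num) (hl : ∀ a, ∃ b, B b = I (Sum.inl ⟨l, a⟩))
    {y : KTensor k σ n} (hy : y ∈ Traceless k σ n) : insertMap k σ ar s I B h y = 0 := by
  choose f hf using hl
  have hfi : Function.Injective f := fun a a' haa => by
    have h1 := hI ((hf a).symm.trans ((congrArg B haa).trans (hf a')))
    simpa using h1
  obtain ⟨e, he⟩ := exists_equiv_extend hfi
  -- The rest of the monomial, as a function of the factors that are not contracted. The value 0 on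
  -- the contracted positions is a dummy: by injectivity of `I`, these indices occur only in the
  -- form `l`.
  let G : KTensor k σ (n - (σ (s.blk l)).card) →ₗ[RatK k σ] PiT k σ ar :=
    (ktBasis k (RatK k σ) _).constr (RatK k σ) fun J =>
      (∏ l' ∈ Finset.univ.erase l, polForm k σ (s.blk l') fun a =>
        glue B h (fun b => Sum.elim (fun _ => 0) J (e.symm b)) (I (Sum.inl ⟨l', a⟩))) •
      Pi.single (M := fun o => KTensor k σ (ar o)) s.out
        (tens k (RatK k σ) (ar s.out) fun a =>
          glue B h (fun b => Sum.elim (fun _ => 0) J (e.symm b)) (I (Sum.inr a)))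
  have key : insertMap k σ ar s I B h =
      G ∘ₗ contract σ e (formAt σ (s.blk l) (spGen k (σ (s.blk l)))) := by
    refine (ktBasis k (RatK k σ) n).ext fun J => ?_
    have hq : ∀ q, (∀ a, q ≠ Sum.inl ⟨l, a⟩) → glue B h J (I q) =
        glue B h (fun b => Sum.elim (fun _ => 0) (fun j => J (e (Sum.inr j))) (e.symm b)) (I q) := by
      intro q hq
      by_cases hqB : ∃ b, B b = I q
      · obtain ⟨b, hb⟩ := hqB
        rw [← hb, glue_apply hB, glue_apply hB]
        congr 1
        obtain ⟨x, rfl⟩ := e.surjective b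
        rw [Equiv.symm_apply_apply]
        rcases x with a | j
        · exfalso
          rw [he, hf] at hb
          exact hq a (hI hb).symm
        · rfl
      · push Not at hqB
        rw [glue_of_notMem h _ hqB, glue_of_notMem h _ hqB]
    have h3 : (∏ l', polForm k σ (s.blk l') fun a => glue B h J (I (Sum.inl ⟨l', a⟩))) =
        (polForm k σ (s.blk l) fun a => stdB _ (J (e (Sum.inl a)))) *
        ∏ l' ∈ Finset.univ.erase l, polForm k σ (s.blk l') fun a =>
          glue B h (fun b => Sum.elim (fun _ => 0) (fun j => J (e (Sum.inr j))) (e.symm b))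
            (I (Sum.inl ⟨l', a⟩)) := by
      rw [← Finset.mul_prod_erase _ _ (Finset.mem_univ l)]
      have h5 : (fun a => glue B h J (I (Sum.inl ⟨l, a⟩))) =
          fun a => stdB _ (J (e (Sum.inl a))) := funext fun a => by
        rw [← hf, glue_apply hB, he]
      rw [h5]
      refine congrArg _ (Finset.prod_congr rfl fun l' hl' => ?_)
      refine congrArg _ (funext fun a => hq _ fun a' h1 => Finset.ne_of_mem_erase hl' ?_)
      simp only [Sum.inl.injEq, Sigma.mk.injEq] at h1
      exact h1.1
    have h4 : (fun a => glue B h J (I (Sum.inr a))) = fun a =>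
        glue B h (fun b => Sum.elim (fun _ => 0) (fun j => J (e (Sum.inr j))) (e.symm b))
          (I (Sum.inr a)) := funext fun a => hq _ fun a' h1 => by cases h1
    have h5 : contract σ e (formAt σ (s.blk l) (spGen k (σ (s.blk l))))
        (ktBasis k (RatK k σ) n J) =
        (polForm k σ (s.blk l) fun a => stdB _ (J (e (Sum.inl a)))) •
          ktBasis k (RatK k σ) _ fun a => J (e (Sum.inr a)) := by
      rw [← tens_single, ← tens_single]
      exact (contract_tens σ e _ fun a => stdB _ (J a)).trans (by rw [formAt_tens]; rfl)
    rw [insertMap_basis, LinearMap.comp_apply, h5, map_smul, Module.Basis.constr_basis, smul_smul,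
      shapeEval_apply, h3, h4]
  rw [key, LinearMap.comp_apply, contract_eq_zero σ hy, map_zero]

/-- A tensor only involves the vectors of the basis of index less than `L`. -/
def SupportedBelow {n : ℕ} (L : ℕ) (y : KTensor k σ n) : Prop :=
  ∀ J, (ktBasis k (RatK k σ) n).repr y J ≠ 0 → ∀ a, J a < L

theorem insertMap_apply {n : ℕ} (s : Shape r O) (I : s.Pos σ ar → ℕ) (B : Fin n → ℕ)
    (h : ℕ → StdV (RatK k σ)) (y : KTensor k σ n) :
    insertMap k σ ar s I B h y = ((ktBasis k (RatK k σ) n).repr y).sum fun J a =>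
      a • shapeEval k σ ar s fun p => glue B h J (I p) :=
  Module.Basis.constr_apply _ _ _ _

/-- After expanding `y` in basis tensors of index below `L`, the form `l` has both a basis vector of
small index and one of the chosen vectors as arguments; so it vanishes by the choice of `h`. -/
theorem insertMap_eq_zero_of_mixed {n : ℕ} {s : Shape r O} {I : s.Pos σ ar → ℕ}
    (hI : Function.Injective I) {B : Fin n → ℕ} {L : ℕ}
    {C : Set ℕ} {h : ℕ → StdV (RatK k σ)}
    (hIC : ∀ p, (∀ b, B b ≠ I p) → I p ∈ C)
    (hh : ∀ (i : Fin r) (J : Fin (σ i).card → C ⊕ Fin L),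
        (∀ p q c, J p = Sum.inl c → J q = Sum.inl c → p = q) →
        (∃ p c, J p = Sum.inl c) → (∃ p j, J p = Sum.inr j) →
        polForm k σ i (fun p => mixVec σ (fun c : C => h c) (J p)) = 0)
    (l : Fin s.num) (h1 : ∃ a b, B b = I (Sum.inl ⟨l, a⟩))
    (h2 : ∃ a, ∀ b, B b ≠ I (Sum.inl ⟨l, a⟩))
    {y : KTensor k σ n} (hy : SupportedBelow σ L y) : insertMap k σ ar s I B h y = 0 := by
  classical
  rw [insertMap_apply]
  refine Finset.sum_eq_zero fun J hJ => ?_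
  have hJL := hy J (Finsupp.mem_support_iff.1 hJ)
  beta_reduce
  rw [shapeEval_apply, Finset.prod_eq_zero (Finset.mem_univ l), zero_smul, smul_zero]
  let J' : Fin (σ (s.blk l)).card → C ⊕ Fin L := fun a =>
    if ha : ∃ b, B b = I (Sum.inl ⟨l, a⟩) then Sum.inr ⟨J ha.choose, hJL _⟩
    else Sum.inl ⟨I (Sum.inl ⟨l, a⟩), hIC _ (by push Not at ha; exact ha)⟩
  have hJ'l : ∀ a c, J' a = Sum.inl c → I (Sum.inl ⟨l, a⟩) = c := by
    intro a c hac
    simp only [J'] at hac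
    split_ifs at hac with ha
    exact congrArg Subtype.val (Sum.inl.inj hac)
  rw [← hh (s.blk l) J' ?_ ?_ ?_]
  · congr 1
    funext a
    by_cases ha : ∃ b, B b = I (Sum.inl ⟨l, a⟩)
    · simp only [J', dif_pos ha, glue]
      rfl
    · simp only [J', dif_neg ha, glue]
      rfl
  · intro p q c hp hq
    have h3 := hI ((hJ'l p c hp).trans (hJ'l q c hq).symm)
    simpa using h3
  · obtain ⟨a, ha⟩ := h2
    exact ⟨a, _, dif_neg (by push Not; exact ha)⟩
  · obtain ⟨a, ha⟩ := h1
    exact ⟨a, _, dif_pos ha⟩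

variable (k) in
/-- The `K`-linear action of the symmetric group on `Tⁿ`. -/
def permRepK (n : ℕ) : Representation (RatK k σ) (Perm (Fin n)) (KTensor k σ n) where
  toFun τ := LinearMap.baseChange (RatK k σ) (permTPow k n τ)
  map_one' := by rw [map_one]; exact LinearMap.baseChange_id
  map_mul' τ τ' := by rw [map_mul]; exact LinearMap.baseChange_mul _ _

theorem permRepK_apply (n : ℕ) (τ : Perm (Fin n)) (y : KTensor k σ n) :
    permRepK k σ n τ y = permKTensor k σ n τ y := (permKTensor_eq_baseChange σ n τ y).symm

variable (k) in
/-- The action of the group algebra of the symmetric group on `Tⁿ`. -/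
def act (n : ℕ) : MonoidAlgebra (RatK k σ) (Perm (Fin n)) →ₐ[RatK k σ]
    Module.End (RatK k σ) (KTensor k σ n) :=
  (permRepK k σ n).asAlgebraHom

theorem act_single (n : ℕ) (τ : Perm (Fin n)) (a : RatK k σ) (y : KTensor k σ n) :
    act k σ n (MonoidAlgebra.single τ a) y = a • permKTensor k σ n τ y := by
  rw [act, Representation.asAlgebraHom_single, LinearMap.smul_apply, permRepK_apply]

theorem act_tens (n : ℕ) (τ : Perm (Fin n)) (a : RatK k σ) (v : Fin n → StdV (RatK k σ)) :
    act k σ n (MonoidAlgebra.single τ a) (tens k (RatK k σ) n v) =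
      a • tens k (RatK k σ) n fun b => v (τ.symm b) := by
  rw [act_single, permKTensor_tens]

open Classical in
-- As no form has an argument in `B`, all of `B` is in the output. The output has at most `ar o₀`
-- places, and fewer in the other components, so it is a permutation of `B` in the component `o₀`.
-- The forms only see `h`; the monomial thus becomes a scalar times a permutation, and the
-- permutation is trivial exactly if the output is `B`.
theorem exists_act_insertMap {o₀ : O} (har : ∀ o, o ≠ o₀ → ar o < ar o₀) {o : O} {N : ℕ}
    {b : Fin N → Fin r} {I : Shape.Pos σ ar ⟨o, N, b⟩ → ℕ}
    (hI : Function.Injective I) {B : Fin (ar o₀) → ℕ} (hB : Function.Injective B)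
    (h : ℕ → StdV (RatK k σ)) (hIB : ∀ a, ∃ p, I p = B a) (hb : ∀ p a, B a ≠ I (Sum.inl p)) :
    ∃ z : MonoidAlgebra (RatK k σ) (Perm (Fin (ar o₀))),
      z.coeff 1 = (if ∃ ho : o = o₀, ∀ a : Fin (ar o₀),
          I (Sum.inr (Fin.cast (congrArg ar ho).symm a)) = B a then
        formProd k σ b (fun p => I (Sum.inl p)) h else 0) ∧
      ∀ y, insertMap k σ ar ⟨o, N, b⟩ I B h y = Pi.single o₀ (act k σ _ z y) := by
  have h1 : ∀ a, ∃ a', I (Sum.inr a') = B a := fun a => by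
    obtain ⟨p | a', hp⟩ := hIB a
    · exact absurd hp.symm (hb p a)
    · exact ⟨a', hp⟩
  choose f hf using h1
  have hfi : Function.Injective f := fun a a' haa => hB (by rw [← hf, ← hf, haa])
  obtain rfl : o = o₀ := by
    by_contra ho
    have h2 := Fintype.card_le_of_injective f hfi
    rw [Fintype.card_fin, Fintype.card_fin] at h2
    exact absurd (har o ho) (not_lt.2 h2)
  let τ : Perm (Fin (ar o)) := Equiv.ofBijective f (Finite.injective_iff_bijective.1 hfi)
  have hτ : ∀ a, I (Sum.inr (τ a)) = B a := hf
  refine ⟨MonoidAlgebra.single τ (formProd k σ b (fun p => I (Sum.inl p)) h), ?_, fun y => ?_⟩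
  · have h2 : (∃ ho : o = o, ∀ a, I (Sum.inr (Fin.cast (congrArg ar ho).symm a)) = B a) ↔
        τ = 1 := by
      constructor
      · rintro ⟨_, h2⟩
        refine Equiv.ext fun a => ?_
        have h3 := hI ((hτ a).trans (h2 a).symm)
        simpa using h3
      · intro h2
        refine ⟨rfl, fun a => ?_⟩
        rw [← hτ, h2]
        rfl
    rw [MonoidAlgebra.coeff_single, Finsupp.single_apply]
    by_cases h3 : τ = 1
    · rw [if_pos h3, if_pos (h2.2 h3)]
    · rw [if_neg h3, if_neg fun h4 => h3 (h2.1 h4)]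
  · refine LinearMap.congr_fun (g := LinearMap.single (RatK k σ) (fun o => KTensor k σ (ar o)) o ∘ₗ
      act k σ _ (MonoidAlgebra.single τ _)) ((ktBasis k (RatK k σ) _).ext fun J => ?_) y
    have h3 : ∀ l, (polForm k σ (b l) fun a => glue B h J (I (Sum.inl ⟨l, a⟩))) =
        polForm k σ (b l) fun a => h (I (Sum.inl ⟨l, a⟩)) := fun l => by
      congr 1
      funext a
      exact glue_of_notMem h J fun a' => hb _ a'
    have h4 : (fun a => glue B h J (I (Sum.inr a))) = fun a => stdB _ (J (τ.symm a)) := by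
      funext a
      obtain ⟨a', rfl⟩ := τ.surjective a
      rw [hτ, glue_apply hB, Equiv.symm_apply_apply]
    rw [insertMap_basis, LinearMap.comp_apply, ← tens_single, act_tens, shapeEval_apply, map_smul]
    simp only [h3]
    rw [h4]
    rfl

end Insertion

/-! ### Stable subspaces contain traceless tensors -/

section Stable

variable {k : Type u} [Field k] {r : ℕ} (σ : Fin r → YoungDiagram)

theorem exists_shift (t : ℕ) : ∃ g : GLInf k, ∀ c, c < t →
    (g : StdV k ≃ₗ[k] StdV k) (Finsupp.single c 1) = Finsupp.single (c + t) 1 := by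
  -- The involution that exchanges the first two blocks of length `t`; its permutation matrix lies
  -- in `GL`.
  let f : ℕ → ℕ := fun i => if i < t then i + t else if i < t + t then i - t else i
  have hf : Function.Involutive f := fun i => by
    simp only [f]
    split_ifs <;> omega
  refine ⟨permElt hf.toPerm ⟨t + t, fun i hi => ?_⟩, fun c hc => ?_⟩
  · change f i = i
    simp only [f]
    split_ifs <;> omega
  · rw [permElt_single]
    change Finsupp.single (f c) 1 = _
    simp only [f, if_pos hc]

theorem glRatK_formProd {C : Type*} {N : ℕ} (b : Fin N → Fin r)
    (I : (Σ l, Fin (σ (b l)).card) → C) (v : C → StdV k) (g : GLInf k) :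
    glRatK k σ g (formProd k σ b I fun c => liftV k (RatK k σ) (v c)) =
      formProd k σ b I fun c => liftV k (RatK k σ) ((g : StdV k ≃ₗ[k] StdV k) (v c)) := by
  rw [formProd, formProd, map_prod]
  simp only [glRatK_polForm]

variable {O : Type} [DecidableEq O] (ar : O → ℕ)

/-- A monomial contributes to the coordinate of index `B` of the component `o₀`. -/
def Shape.HasOutput {s : Shape r O} (I : s.Pos σ ar → ℕ) (o₀ : O) (B : Fin (ar o₀) → ℕ) : Prop :=
  ∃ ho : s.out = o₀, ∀ a : Fin (ar o₀), I (Sum.inr (Fin.cast (congrArg ar ho).symm a)) = B a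

open Classical in
theorem repr_single_basis {o₀ : O} (B : Fin (ar o₀) → ℕ) (o : O) (J : Fin (ar o) → ℕ) :
    (ktBasis k (RatK k σ) (ar o₀)).repr
      ((Pi.single o (ktBasis k (RatK k σ) _ J) : PiT k σ ar) o₀) B =
      if ∃ ho : o = o₀, ∀ a : Fin (ar o₀), J (Fin.cast (congrArg ar ho).symm a) = B a
        then 1 else 0 := by
  by_cases ho : o = o₀
  · subst ho
    rw [Pi.single_eq_same, Module.Basis.repr_self, Finsupp.single_apply]
    by_cases h : J = B
    · rw [if_pos h, if_pos ⟨rfl, fun a => congrFun h a⟩]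
    · rw [if_neg h, if_neg]
      rintro ⟨_, h1⟩
      exact h (funext h1)
  · rw [Pi.single_eq_of_ne (Ne.symm ho), map_zero, Finsupp.zero_apply, if_neg]
    rintro ⟨h, _⟩
    exact ho h

open Classical in
theorem repr_shapeEval {o₀ : O} (B : Fin (ar o₀) → ℕ) (s : Shape r O) (I : s.Pos σ ar → ℕ) :
    (ktBasis k (RatK k σ) (ar o₀)).repr
      (shapeEval k σ ar s (fun p => stdB (RatK k σ) (I p)) o₀) B =
      if Shape.HasOutput σ ar I o₀ B then
        formProd k σ s.blk (fun p => I (Sum.inl p)) (stdB (RatK k σ)) else 0 := by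
  rw [shapeEval_apply, Pi.smul_apply, map_smul, Finsupp.smul_apply]
  have h := repr_single_basis (k := k) σ ar B s.out fun a => I (Sum.inr a)
  rw [← tens_single] at h
  change _ • (ktBasis k (RatK k σ) (ar o₀)).repr ((Pi.single s.out (tens k (RatK k σ) _
    fun a => Finsupp.single (I (Sum.inr a)) 1) : PiT k σ ar) o₀) B = _
  rw [h]
  by_cases hg : Shape.HasOutput σ ar I o₀ B
  · rw [if_pos hg, if_pos (by exact hg), smul_eq_mul, mul_one]; rfl
  · rw [if_neg hg, if_neg (by exact hg), smul_zero]

theorem content_injective {S : Type*} {Pos : S → Type*} [∀ s, Fintype (Pos s)] {C : Multiset ℕ}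
    (hC : C.Nodup) {m : Σ s, (Pos s → ℕ)} (hm : content m = C) : Function.Injective m.2 := by
  intro p q hpq
  rw [← hm] at hC
  exact Multiset.inj_on_of_nodup_map hC p (Finset.mem_univ p) q (Finset.mem_univ q) hpq

theorem exists_index_of_mem_content {S : Type*} {Pos : S → Type*} [∀ s, Fintype (Pos s)]
    {C : Multiset ℕ} {m : Σ s, (Pos s → ℕ)} (hm : content m = C) {c : ℕ} (hc : c ∈ C) :
    ∃ p, m.2 p = c := by
  rw [← hm] at hc
  obtain ⟨p, -, hp⟩ := Multiset.mem_map.1 hc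
  exact ⟨p, hp⟩

theorem index_mem_content {S : Type*} {Pos : S → Type*} [∀ s, Fintype (Pos s)]
    {C : Multiset ℕ} {m : Σ s, (Pos s → ℕ)} (hm : content m = C) (p : Pos m.1) : m.2 p ∈ C := by
  rw [← hm]
  exact Multiset.mem_map_of_mem _ (Finset.mem_univ p)

theorem Shape.HasOutput.injective {s : Shape r O} {I : s.Pos σ ar → ℕ} {o₀ : O}
    {B : Fin (ar o₀) → ℕ} (h : Shape.HasOutput σ ar I o₀ B) (hI : Function.Injective I) :
    Function.Injective B := by
  obtain ⟨ho, h⟩ := h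
  intro a b hab
  rw [← h, ← h] at hab
  have := hI hab
  simpa using this

theorem Shape.HasOutput.ne {s : Shape r O} {I : s.Pos σ ar → ℕ} {o₀ : O}
    {B : Fin (ar o₀) → ℕ} (h : Shape.HasOutput σ ar I o₀ B) (hI : Function.Injective I)
    (p : Σ l, Fin (σ (s.blk l)).card) (a : Fin (ar o₀)) : B a ≠ I (Sum.inl p) := by
  obtain ⟨ho, h⟩ := h
  intro hab
  rw [← h] at hab
  have := hI hab
  simp at this

theorem Shape.HasOutput.exists_inl {s : Shape r O} {I : s.Pos σ ar → ℕ} {o₀ : O}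
    {B : Fin (ar o₀) → ℕ} (h : Shape.HasOutput σ ar I o₀ B) {q : s.Pos σ ar}
    (hq : ∀ a, B a ≠ I q) : ∃ p, q = Sum.inl p := by
  obtain ⟨ho, h⟩ := h
  rcases q with p | a
  · exact ⟨p, rfl⟩
  · refine absurd ?_ (hq (Fin.cast (congrArg ar ho) a))
    rw [← h]
    congr 1

open Classical in
/-- A combination of products of forms can be evaluated at vectors where it does not vanish, but
where all the forms with arguments of both kinds vanish. -/
theorem exists_good_vectors (L : ℕ) {C : Multiset ℕ} (hC : C.Nodup)
    {X : (Σ s : Shape r O, (s.Pos σ ar → ℕ)) →₀ k} (hX : ∀ m ∈ X.support, content m = C)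
    {o₀ : O} {B : Fin (ar o₀) → ℕ}
    (hB : (ktBasis k (RatK k σ) (ar o₀)).repr
      (theta (shapeEval k σ ar) (stdB (RatK k σ)) X o₀) B ≠ 0) :
    ∃ h : ℕ → StdV (RatK k σ),
      ∑ m ∈ X.support, algebraMap k (RatK k σ) (X m) * (if Shape.HasOutput σ ar m.2 o₀ B then
        formProd k σ m.1.blk (fun p => m.2 (Sum.inl p)) h else 0) ≠ 0 ∧
      ∀ (i : Fin r) (J : Fin (σ i).card → {c | c ∈ C ∧ ∀ a, B a ≠ c} ⊕ Fin L),
        (∀ p q c, J p = Sum.inl c → J q = Sum.inl c → p = q) →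
        (∃ p c, J p = Sum.inl c) → (∃ p j, J p = Sum.inr j) →
        polForm k σ i (fun p => mixVec σ (fun c : {c | c ∈ C ∧ ∀ a, B a ≠ c} => h c) (J p)) = 0 := by
  set C' : Set ℕ := {c | c ∈ C ∧ ∀ a, B a ≠ c} with hC'
  have hfin : Finite C' := (C.toFinset.finite_toSet.subset fun c hc => by simpa using hc.1).to_subtype
  let M := {m // m ∈ X.support ∧ Shape.HasOutput σ ar m.2 o₀ B}
  have hM : Finite M := (X.support.finite_toSet.subset fun m hm => hm.1).to_subtype
  have : Fintype M := Fintype.ofFinite M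
  have hsum : ∀ F : (Σ s : Shape r O, (s.Pos σ ar → ℕ)) → RatK k σ,
      ∑ m ∈ X.support, algebraMap k (RatK k σ) (X m) *
        (if Shape.HasOutput σ ar m.2 o₀ B then F m else 0) =
      ∑ m : M, algebraMap k (RatK k σ) (X m.1) * F m.1 := by
    intro F
    simp only [mul_ite, mul_zero]
    rw [← Finset.sum_filter]
    refine Finset.sum_subtype _ (fun m => ?_) fun m => algebraMap k (RatK k σ) (X m) * F m
    rw [Finset.mem_filter]
  have hne := hB
  rw [theta_apply, Finset.sum_apply, map_sum, Finsupp.finsetSum_apply] at hne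
  have h1 : ∀ m ∈ X.support, (ktBasis k (RatK k σ) (ar o₀)).repr
      ((X m • shapeEval k σ ar m.1 fun p => stdB (RatK k σ) (m.2 p)) o₀) B =
      algebraMap k (RatK k σ) (X m) * (if Shape.HasOutput σ ar m.2 o₀ B then
        formProd k σ m.1.blk (fun p => m.2 (Sum.inl p)) (stdB (RatK k σ)) else 0) := fun m _ => by
    rw [← repr_shapeEval, Pi.smul_apply, ← algebraMap_smul (RatK k σ) (X m), map_smul,
      Finsupp.smul_apply, smul_eq_mul]
  rw [Finset.sum_congr rfl h1, hsum] at hne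
  -- In a monomial with output `B` and content `C`, the arguments of the forms are in bijection with
  -- the indices of `C` outside `B`.
  let I : ∀ m : M, (Σ l, Fin (σ (m.1.1.blk l)).card) → C' := fun m p =>
    ⟨m.1.2 (Sum.inl p), index_mem_content (hX _ m.2.1) _,
      m.2.2.ne σ ar (content_injective hC (hX _ m.2.1)) p⟩
  have hI : ∀ m, Function.Bijective (I m) := by
    intro m
    have hinj := content_injective hC (hX _ m.2.1)
    refine ⟨fun p q hpq => ?_, fun c => ?_⟩
    · exact Sum.inl_injective (hinj (congrArg Subtype.val hpq))
    · obtain ⟨q, hq⟩ := exists_index_of_mem_content (hX _ m.2.1) c.2.1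
      obtain ⟨p, rfl⟩ := m.2.2.exists_inl σ ar (q := q) (by rw [hq]; exact c.2.2)
      exact ⟨p, Subtype.ext hq⟩
  obtain ⟨t, htL, ht⟩ : ∃ t, L ≤ t ∧ ∀ c : C', (c : ℕ) < t := by
    refine ⟨L + C.toFinset.sup id + 1, by omega, fun c => ?_⟩
    have : id (c : ℕ) ≤ C.toFinset.sup id := Finset.le_sup (Multiset.mem_toFinset.2 c.2.1)
    simp only [id] at this
    omega
  -- The selection starts from basis vectors of index at least `L`. The shift moves all the indices
  -- there, and acts on the coefficient by a field automorphism, so the coefficient remains nonzero.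
  obtain ⟨g, hg⟩ := exists_shift (k := k) t
  obtain ⟨h, hh1, hh2⟩ := exists_selection σ L (C := C') (Finset.univ : Finset M)
    (fun m => algebraMap k (RatK k σ) (X m.1)) (fun m => m.1.1.num) (fun m => m.1.1.blk) I
    (fun m _ => hI m) (fun c => c + t) (fun c => by omega) (by
      intro h0
      refine hne ((map_eq_zero (glRatK k σ g)).1 ?_)
      rw [← h0, map_sum]
      refine Finset.sum_congr rfl fun m _ => ?_
      rw [map_mul, AlgEquiv.commutes]
      congr 1
      have h2 : formProd k σ m.1.1.blk (fun p => m.1.2 (Sum.inl p)) (stdB (RatK k σ)) =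
          formProd k σ m.1.1.blk (I m) fun c => liftV k (RatK k σ) (Finsupp.single (c : ℕ) 1) := by
        simp only [liftV_single_eq]
        rfl
      rw [h2, glRatK_formProd]
      simp only [hg _ (ht _), liftV_single_eq])
  refine ⟨fun c => if hc : c ∈ C' then h ⟨c, hc⟩ else 0, ?_, ?_⟩
  · rw [hsum fun m => formProd k σ m.1.blk (fun p => m.2 (Sum.inl p))
      fun c => if hc : c ∈ C' then h ⟨c, hc⟩ else 0]
    convert hh1 using 3 with m
    refine Finset.prod_congr rfl fun l _ => ?_
    congr 1
    funext a
    exact dif_pos (I m ⟨l, a⟩).2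
  · intro i J hJ1 hJ2 hJ3
    have h3 : (fun c : C' => if hc : (c : ℕ) ∈ C' then h ⟨c, hc⟩ else 0) = h :=
      funext fun c => dif_pos c.2
    rw [h3]
    exact hh2 i J hJ1 hJ2 hJ3

open Classical in
/-- A stable subspace with a nonzero component of the largest degree contains the images of the
traceless tensors, of bounded support, by an element of the group algebra. -/
theorem exists_act_mem [CharZero k] [Finite O] {o₀ : O} (har : ∀ o, o ≠ o₀ → ar o < ar o₀)
    (Q : Submodule (RatK k σ) (PiT k σ ar)) (hQ : ∀ g, ∀ x ∈ Q, glPi k σ ar g x ∈ Q)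
    {x : PiT k σ ar} (hx : x ∈ Q) (hx₀ : x o₀ ≠ 0) (L : ℕ) :
    ∃ z : MonoidAlgebra (RatK k σ) (Perm (Fin (ar o₀))), z ≠ 0 ∧
      ∀ y ∈ Traceless k σ (ar o₀), SupportedBelow σ L y →
        (Pi.single o₀ (act k σ _ z y) : PiT k σ ar) ∈ Q := by
  obtain ⟨a, ha, X₀, hX₀⟩ := exists_smul_mem_monSpan σ ar x
  -- Staying outside `Z` means keeping a nonzero component of the largest degree.
  let Z : Submodule k (PiT k σ ar) := LinearMap.ker (LinearMap.proj o₀)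
  obtain ⟨C, X, hC, hX, hXQ, hXZ⟩ := exists_multilinear (shapeEval k σ ar) (glPi k σ ar)
    (glPi_shapeEval σ ar) (Q.restrictScalars k) Z hQ
    (fun g x hx => by
      rw [LinearMap.mem_ker] at hx ⊢
      change glKTensor k σ _ g (x o₀) = 0
      rw [show x o₀ = 0 from hx, map_zero])
    X₀ (by rw [hX₀]; exact Q.smul_mem a hx)
    (by rw [hX₀]; exact fun h => smul_ne_zero ha hx₀ (LinearMap.mem_ker.1 h))
  have hmem := theta_mem (shapeEval k σ ar) (glPi k σ ar) (glPi_shapeEval σ ar) Q hQ hC hX hXQ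
  obtain ⟨B, hB⟩ : ∃ B, (ktBasis k (RatK k σ) (ar o₀)).repr
      (theta (shapeEval k σ ar) (stdB (RatK k σ)) X o₀) B ≠ 0 := by
    by_contra! hcon
    refine hXZ (LinearMap.mem_ker.2 ((ktBasis k (RatK k σ) (ar o₀)).ext_elem fun J => ?_))
    rw [map_zero]
    exact hcon J
  obtain ⟨h, hh1, hh2⟩ := exists_good_vectors σ ar L hC hX hB
  obtain ⟨m₀, hm₀, hm₀B⟩ : ∃ m ∈ X.support, Shape.HasOutput σ ar m.2 o₀ B := by
    by_contra! hcon
    refine hh1 (Finset.sum_eq_zero fun m hm => ?_)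
    rw [if_neg (hcon m hm), mul_zero]
  have hBi := hm₀B.injective σ ar (content_injective hC (hX _ hm₀))
  have hBC : ∀ a, B a ∈ C := fun a => by
    obtain ⟨ho, h1⟩ := hm₀B
    rw [← h1]
    exact index_mem_content (hX _ hm₀) _
  -- Three kinds of monomials: no form meets `B`, and the insertion is the action of an element `z`;
  -- or a form has all its arguments in `B` and `y` is traceless; or a form has arguments of both
  -- kinds and vanishes by the choice of `h`. In the last two cases `z = 0`, which agrees with the
  -- coefficient of the output `B`.
  have key : ∀ m, ∃ z : MonoidAlgebra (RatK k σ) (Perm (Fin (ar o₀))), m ∈ X.support →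
      z.coeff 1 = (if Shape.HasOutput σ ar m.2 o₀ B then
        formProd k σ m.1.blk (fun p => m.2 (Sum.inl p)) h else 0) ∧
      ∀ y ∈ Traceless k σ (ar o₀), SupportedBelow σ L y →
        insertMap k σ ar m.1 m.2 B h y = Pi.single o₀ (act k σ _ z y) := by
    intro m
    by_cases hm : m ∈ X.support
    swap
    · exact ⟨0, fun h => absurd h hm⟩
    have hinj := content_injective hC (hX m hm)
    by_cases hall : ∀ p a, B a ≠ m.2 (Sum.inl p)
    · obtain ⟨z, hz1, hz2⟩ := exists_act_insertMap σ ar har (o := m.1.out) (N := m.1.num)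
        (b := m.1.blk) (I := m.2) hinj hBi h
        (fun a => exists_index_of_mem_content (hX m hm) (hBC a)) hall
      refine ⟨z, fun _ => ⟨hz1.trans ?_, fun y _ _ => hz2 y⟩⟩
      by_cases hg : Shape.HasOutput σ ar m.2 o₀ B
      · rw [if_pos hg, if_pos (by exact hg)]
      · rw [if_neg hg, if_neg (by exact hg)]
    · have hno : ¬ Shape.HasOutput σ ar m.2 o₀ B := fun h1 => hall (h1.ne σ ar hinj)
      push Not at hall
      obtain ⟨⟨l, a⟩, b, hab⟩ := hall
      refine ⟨0, fun _ => ⟨by rw [if_neg hno]; rfl, fun y hy hyL => ?_⟩⟩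
      rw [map_zero, LinearMap.zero_apply, Pi.single_zero]
      by_cases hl : ∀ a, ∃ b, B b = m.2 (Sum.inl ⟨l, a⟩)
      · exact insertMap_eq_zero_of_traceless σ ar hinj hBi h l hl hy
      · push Not at hl
        exact insertMap_eq_zero_of_mixed σ ar hinj (C := {c | c ∈ C ∧ ∀ a, B a ≠ c})
          (fun p hp => ⟨index_mem_content (hX m hm) p, hp⟩) hh2 l ⟨a, b, hab⟩ hl hyL
  choose z hz using key
  -- The coefficient of this element at 1 is the coefficient of `B` evaluated at `h`, which does not
  -- vanish.
  refine ⟨∑ m ∈ X.support, algebraMap k (RatK k σ) (X m) • z m, fun h0 => hh1 ?_,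
    fun y hy hyL => ?_⟩
  · have h1 := congrArg (fun z => MonoidAlgebra.coeff z 1) h0
    beta_reduce at h1
    rw [MonoidAlgebra.coeff_sum, Finsupp.finsetSum_apply] at h1
    refine Eq.trans (Finset.sum_congr rfl fun m hm => ?_) h1
    rw [← (hz m hm).1]
    rfl
  · have h1 : (Pi.single o₀ (act k σ _ (∑ m ∈ X.support, algebraMap k (RatK k σ) (X m) • z m) y) :
        PiT k σ ar) =
        ∑ m ∈ X.support, algebraMap k (RatK k σ) (X m) • insertMap k σ ar m.1 m.2 B h y := by
      rw [map_sum, LinearMap.sum_apply, ← LinearMap.single_apply (RatK k σ), map_sum]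
      refine Finset.sum_congr rfl fun m hm => ?_
      rw [map_smul, LinearMap.smul_apply, map_smul, (hz m hm).2 y hy hyL]
      rfl
    rw [h1]
    simp only [insertMap_apply, Finsupp.sum, Finset.smul_sum]
    rw [Finset.sum_comm]
    -- For each basis tensor of `y`, the sum over the monomials is the multilinear element evaluated
    -- at the vectors `glue B h J`, which lies in `Q`.
    refine Q.sum_mem fun J _ => ?_
    have h2 := Q.smul_mem ((ktBasis k (RatK k σ) (ar o₀)).repr y J) (hmem (glue B h J))
    rw [theta_apply, Finset.smul_sum] at h2
    convert h2 using 2 with m hm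
    rw [smul_comm, algebraMap_smul]

/-! ### A traceless tensor that generates a free module -/

theorem exists_supportedBelow {n : ℕ} (y : KTensor k σ n) : ∃ L, SupportedBelow σ L y := by
  refine ⟨((ktBasis k (RatK k σ) n).repr y).support.sup (fun J => Finset.univ.sup J) + 1,
    fun J hJ a => Nat.lt_succ_of_le ?_⟩
  exact le_trans (Finset.le_sup (f := J) (Finset.mem_univ a))
    (Finset.le_sup (f := fun J => Finset.univ.sup J) (Finsupp.mem_support_iff.2 hJ))

theorem SupportedBelow.mono {n L L' : ℕ} (h : L ≤ L') {y : KTensor k σ n}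
    (hy : SupportedBelow σ L y) : SupportedBelow σ L' y :=
  fun J hJ a => (hy J hJ a).trans_le h

theorem repr_tens (n : ℕ) (v : Fin n → StdV (RatK k σ)) (J : Fin n → ℕ) :
    (ktBasis k (RatK k σ) n).repr (tens k (RatK k σ) n v) J = ∏ a, v a (J a) := by
  have h : ((ktBasis k (RatK k σ) n).coord J).compMultilinearMap (tens k (RatK k σ) n) =
      (MultilinearMap.mkPiAlgebra (RatK k σ) (Fin n) (RatK k σ)).compLinearMap
        fun a => Finsupp.lapply (J a) := by
    refine multilinear_ext fun J' => ?_
    rw [LinearMap.compMultilinearMap_apply, MultilinearMap.compLinearMap_apply,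
      MultilinearMap.mkPiAlgebra_apply]
    change (ktBasis k (RatK k σ) n).coord J (tens k (RatK k σ) n fun a => Finsupp.single (J' a) 1) =
      ∏ a, (Finsupp.single (J' a) 1 : StdV (RatK k σ)) (J a)
    rw [tens_single, Module.Basis.coord_apply, Module.Basis.repr_self, Finsupp.single_apply]
    split_ifs with hJ
    · subst hJ
      simp
    · obtain ⟨a, ha⟩ := Function.ne_iff.1 hJ
      rw [Finset.prod_eq_zero (Finset.mem_univ a)]
      exact Finsupp.single_eq_of_ne (Ne.symm ha)
  have h1 := congrArg (fun f => f v) h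
  simp only [LinearMap.compMultilinearMap_apply, MultilinearMap.compLinearMap_apply,
      MultilinearMap.mkPiAlgebra_apply] at h1
  exact h1

theorem act_apply (n : ℕ) (z : MonoidAlgebra (RatK k σ) (Perm (Fin n))) (y : KTensor k σ n) :
    act k σ n z y = ∑ τ, z.coeff τ • permKTensor k σ n τ y := by
  induction z using MonoidAlgebra.induction_linear with
  | zero => simp
  | add z w hz hw =>
    rw [map_add, LinearMap.add_apply, hz, hw, ← Finset.sum_add_distrib]
    refine Finset.sum_congr rfl fun τ _ => ?_
    rw [MonoidAlgebra.coeff_add, Finsupp.add_apply, add_smul]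
  | single τ a =>
    rw [act_single, Finset.sum_eq_single τ]
    · rw [MonoidAlgebra.coeff_single, Finsupp.single_eq_same]
    · intro τ' _ h
      rw [MonoidAlgebra.coeff_single, Finsupp.single_eq_of_ne h, zero_smul]
    · intro h; exact absurd (Finset.mem_univ _) h

/-- A pure tensor in nonzero vectors on which all the forms vanish is traceless; if the supports are
disjoint, its permutations involve disjoint sets of basis tensors and are independent. -/
theorem exists_traceless_free (hσ : ∀ i, σ i ≠ ⊥) (n : ℕ) :
    ∃ y ∈ Traceless k σ n, ∀ z : MonoidAlgebra (RatK k σ) (Perm (Fin n)), z ≠ 0 →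
      act k σ n z y ≠ 0 := by
  obtain ⟨v, hv0, hvd, hv⟩ := exists_disjoint_vectors (k := k) σ hσ n
  refine ⟨tens k (RatK k σ) n v, mem_traceless σ fun i m' e => ?_, fun z hz h0 => ?_⟩
  · rw [contract_tens, formAt_tens,
      hv i (fun j => e (Sum.inl j)) (e.injective.comp Sum.inl_injective), zero_smul]
  · obtain ⟨τ, hτ⟩ : ∃ τ, z.coeff τ ≠ 0 := by
      by_contra! hcon
      exact hz (MonoidAlgebra.ext (Finsupp.ext hcon))
    have hJ : ∀ a, ∃ j, v a j ≠ 0 := fun a => by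
      by_contra! hcon
      exact hv0 a (Finsupp.ext hcon)
    choose J hJ using hJ
    have h1 := congrArg (fun y => (ktBasis k (RatK k σ) n).repr y fun a => J (τ.symm a)) h0
    simp only [act_apply, map_sum, map_smul, Finsupp.finsetSum_apply, Finsupp.smul_apply,
      permKTensor_tens, repr_tens, map_zero, Finsupp.zero_apply] at h1
    rw [Finset.sum_eq_single τ] at h1
    · exact smul_ne_zero hτ (Finset.prod_ne_zero_iff.2 fun a _ => hJ _) h1
    · intro τ' _ hττ
      obtain ⟨a, ha⟩ : ∃ a, τ.symm a ≠ τ'.symm a := by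
        by_contra! hcon
        exact hττ (Equiv.symm_bijective.1 (Equiv.ext fun a => (hcon a).symm))
      rw [Finset.prod_eq_zero (Finset.mem_univ a), smul_zero]
      exact hvd _ _ _ ha (hJ _)
    · intro h; exact absurd (Finset.mem_univ _) h

theorem act_mem_traceless {n : ℕ} (z : MonoidAlgebra (RatK k σ) (Perm (Fin n)))
    {y : KTensor k σ n} (hy : y ∈ Traceless k σ n) : act k σ n z y ∈ Traceless k σ n := by
  rw [act_apply]
  exact Submodule.sum_mem _ fun τ _ =>
    Submodule.smul_mem _ _ (Traceless_perm_stable σ n τ y hy)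

theorem repr_permKTensor (n : ℕ) (τ : Perm (Fin n)) (y : KTensor k σ n) (J : Fin n → ℕ) :
    (ktBasis k (RatK k σ) n).repr (permKTensor k σ n τ y) J =
      (ktBasis k (RatK k σ) n).repr y fun a => J (τ a) := by
  rw [permKTensor_eq_baseChange]
  refine LinearMap.congr_fun (f := (ktBasis k (RatK k σ) n).coord J ∘ₗ
    LinearMap.baseChange (RatK k σ) (permTPow k n τ))
    (g := (ktBasis k (RatK k σ) n).coord fun a => J (τ a))
    ((ktBasis k (RatK k σ) n).ext fun J' => ?_) y
  rw [LinearMap.comp_apply, ← permKTensor_eq_baseChange, ← tens_single, permKTensor_tens,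
    Module.Basis.coord_apply, Module.Basis.coord_apply, repr_tens, repr_tens]
  exact Fintype.prod_equiv τ.symm _ _ fun a => by rw [Equiv.apply_symm_apply]

theorem SupportedBelow.act {n L : ℕ} (z : MonoidAlgebra (RatK k σ) (Perm (Fin n)))
    {y : KTensor k σ n} (hy : SupportedBelow σ L y) : SupportedBelow σ L (act k σ n z y) := by
  intro J hJ a
  rw [act_apply, map_sum, Finsupp.finsetSum_apply] at hJ
  obtain ⟨τ, -, hτ⟩ := Finset.exists_ne_zero_of_sum_ne_zero hJ
  rw [map_smul, Finsupp.smul_apply, repr_permKTensor] at hτ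
  have := hy _ (right_ne_zero_of_smul hτ) (τ.symm a)
  rwa [Equiv.apply_symm_apply] at this

/-- A stable subspace whose component of the largest degree is nonzero, and consists of images of a
Young symmetrizer, contains the images of the traceless tensors by this symmetrizer. -/
theorem single_act_symmetrizer_mem [CharZero k] [Finite O] (hσ : ∀ i, σ i ≠ ⊥) {o₀ : O}
    (har : ∀ o, o ≠ o₀ → ar o < ar o₀)
    (Q : Submodule (RatK k σ) (PiT k σ ar)) (hQ : ∀ g, ∀ x ∈ Q, glPi k σ ar g x ∈ Q)
    {x : PiT k σ ar} (hx : x ∈ Q) (hx₀ : x o₀ ≠ 0) {mu : YoungDiagram}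
    (t : Fin (ar o₀) ≃ mu.cells)
    (hQt : ∀ x ∈ Q, ∃ w, x o₀ = act k σ _ (rowSum (RatK k σ) t * colSum (RatK k σ) t) w)
    {y : KTensor k σ (ar o₀)} (hy : y ∈ Traceless k σ (ar o₀)) :
    (Pi.single o₀ (act k σ _ (rowSum (RatK k σ) t * colSum (RatK k σ) t) y) : PiT k σ ar) ∈ Q := by
  have : CharZero (RatK k σ) := charZero_of_injective_algebraMap (algebraMap k _).injective
  obtain ⟨κ, hκ, hc, -⟩ := exists_sq_eq_smul (F := RatK k σ) t
  set c := rowSum (RatK k σ) t * colSum (RatK k σ) t with hcdef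
  obtain ⟨u, hu, hfree⟩ := exists_traceless_free (k := k) σ hσ (ar o₀)
  obtain ⟨L₁, hL₁⟩ := exists_supportedBelow σ u
  obtain ⟨L₂, hL₂⟩ := exists_supportedBelow σ y
  -- The element `z` depends on the bound, which therefore has to cover both the test tensor `u` and
  -- `y`. The group algebra does not enlarge supports.
  obtain ⟨z, hz, hzQ⟩ := exists_act_mem σ ar har Q hQ hx hx₀ (max L₁ L₂)
  have key : ∀ y ∈ Traceless k σ (ar o₀), SupportedBelow σ (max L₁ L₂) y →
      act k σ _ (c * z) y = κ • act k σ _ z y := by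
    intro y hy hyL
    obtain ⟨w, hw⟩ := hQt _ (hzQ y hy hyL)
    rw [Pi.single_eq_same] at hw
    rw [map_mul, Module.End.mul_apply, hw, ← Module.End.mul_apply, ← map_mul, hc, map_smul,
      LinearMap.smul_apply]
  -- On traceless tensors of bounded support `c` acts on the image of `z` by `κ`; at the free tensor
  -- `u` that image is not 0.
  have hcz : c * z ≠ 0 := by
    intro h0
    have h1 := key u hu (hL₁.mono σ (le_max_left _ _))
    rw [h0, map_zero, LinearMap.zero_apply] at h1
    exact smul_ne_zero hκ (hfree z hz) h1.symm
  obtain ⟨w, hw⟩ := exists_mul_eq_of_ne_zero t hκ (z := c * z)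
    (by rw [← hcdef, ← mul_assoc, hc, smul_mul_assoc]) hcz
  -- With `c * z * w = c`, the element `c y` is `c z` applied to the traceless tensor `w y`, hence a
  -- multiple of an element already known to lie in `Q`.
  have h2 : act k σ _ c y = κ • act k σ _ z (act k σ _ w y) := by
    rw [← key _ (act_mem_traceless σ w hy) ((hL₂.mono σ (le_max_right _ _)).act σ w),
      ← Module.End.mul_apply, ← map_mul, hw]
  rw [h2, Pi.single_smul]
  exact Q.smul_mem _ (hzQ _ (act_mem_traceless σ w hy)
    ((hL₂.mono σ (le_max_right _ _)).act σ w))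

end Stable

/-! ### Schur functors as subspaces of tensor powers -/

section Conjugation

variable {α : Type*} [Fintype α] [DecidableEq α] (F : Type*) [Field F] {mu : YoungDiagram}

theorem single_mul_sum_conj (f : Perm α → F) (s s' : Finset (Perm α)) (τ : Perm α)
    (hs : ∀ p, p ∈ s ↔ τ * p * τ⁻¹ ∈ s') (hf : ∀ p, f (τ * p * τ⁻¹) = f p) :
    MonoidAlgebra.single τ 1 * ∑ p ∈ s, MonoidAlgebra.single p (f p) =
      (∑ p ∈ s', MonoidAlgebra.single p (f p)) * MonoidAlgebra.single τ 1 := by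
  rw [Finset.mul_sum, Finset.sum_mul]
  refine Finset.sum_equiv (MulAut.conj τ).toEquiv hs fun p _ => ?_
  change _ = MonoidAlgebra.single (τ * p * τ⁻¹) (f (τ * p * τ⁻¹)) * _
  rw [MonoidAlgebra.single_mul_single, MonoidAlgebra.single_mul_single, hf, one_mul, mul_one,
    inv_mul_cancel_right]

open Classical in
-- Conjugation by `τ` carries the row and column groups of `τ.trans t` to those of `t`. So all the
-- tableaux of one shape reduce to the fixed one.
theorem single_mul_symmetrizer_trans (τ : Perm α) (t : α ≃ mu.cells) :
    MonoidAlgebra.single τ 1 * (rowSum F (τ.trans t) * colSum F (τ.trans t)) =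
      rowSum F t * colSum F t * MonoidAlgebra.single τ 1 := by
  have h1 : MonoidAlgebra.single τ 1 * rowSum F (τ.trans t) =
      rowSum F t * MonoidAlgebra.single τ 1 := by
    refine single_mul_sum_conj F (fun _ => 1) _ _ τ (fun p => ?_) fun _ => rfl
    simp only [Finset.mem_filter, Finset.mem_univ, true_and]
    refine ⟨fun h i => ?_, fun h i => ?_⟩
    · have := h (τ⁻¹ i)
      simpa using this
    · have := h (τ i)
      simpa using this
  have h2 : MonoidAlgebra.single τ 1 * colSum F (τ.trans t) =
      colSum F t * MonoidAlgebra.single τ 1 := by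
    refine single_mul_sum_conj F (fun p => ((Equiv.Perm.sign p : ℤ) : F)) _ _ τ (fun p => ?_)
      fun p => ?_
    · simp only [Finset.mem_filter, Finset.mem_univ, true_and]
      refine ⟨fun h i => ?_, fun h i => ?_⟩
      · have := h (τ⁻¹ i)
        simpa using this
      · have := h (τ i)
        simpa using this
    · rw [map_mul, map_mul, map_inv, mul_inv_cancel_comm]
  rw [← mul_assoc, h1, mul_assoc, h2, mul_assoc]

variable {F} in
theorem map_rowSum {K : Type*} [Field K] (f : F →+* K) (t : α ≃ mu.cells) :
    MonoidAlgebra.mapRingHom _ f (rowSum F t) = rowSum K t := by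
  rw [rowSum, map_sum]
  refine Finset.sum_congr rfl fun p _ => ?_
  rw [MonoidAlgebra.mapRingHom_single, map_one]

variable {F} in
theorem map_colSum {K : Type*} [Field K] (f : F →+* K) (t : α ≃ mu.cells) :
    MonoidAlgebra.mapRingHom _ f (colSum F t) = colSum K t := by
  rw [colSum, map_sum]
  refine Finset.sum_congr rfl fun p _ => ?_
  rw [MonoidAlgebra.mapRingHom_single, map_intCast]

end Conjugation

/-! ### The embedding of the Schur functor in the tensor power and its retraction up to a scalar. -/

section SchurInTensor

variable {k : Type u} [Field k]

variable (k) in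
/-- The action of the group algebra of the symmetric group on `V^{⊗ n}`. -/
def actT (n : ℕ) : MonoidAlgebra k (Perm (Fin n)) →ₐ[k] Module.End k (TPow k n) :=
  (permTPow k n).asAlgebraHom

theorem actT_single (n : ℕ) (τ : Perm (Fin n)) (a : k) (w : TPow k n) :
    actT k n (MonoidAlgebra.single τ a) w = a • permTPow k n τ w := by
  rw [actT, Representation.asAlgebraHom_single, LinearMap.smul_apply]

theorem actT_gl (n : ℕ) (z : MonoidAlgebra k (Perm (Fin n))) (g : GLInf k) (w : TPow k n) :
    actT k n z (glTPow k n g w) = glTPow k n g (actT k n z w) := by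
  induction z using MonoidAlgebra.induction_linear with
  | zero => simp
  | add x y hx hy => rw [map_add, LinearMap.add_apply, hx, hy, LinearMap.add_apply, map_add]
  | single τ a => rw [actT_single, actT_single, perm_gl_comm, map_smul]

/-- The underlying element of the group algebra. -/
def spechtVal (μ : YoungDiagram) : Specht k μ →ₗ[k] MonoidAlgebra k (Perm (Fin μ.card)) :=
  (spechtIdeal k μ).subtype.restrictScalars k

theorem spechtVal_injective (μ : YoungDiagram) : Function.Injective (spechtVal (k := k) μ) :=
  Subtype.val_injective

theorem spechtVal_smul {μ : YoungDiagram} (a : MonoidAlgebra k (Perm (Fin μ.card)))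
    (x : Specht k μ) : spechtVal μ (a • x) = a * spechtVal μ x := rfl

theorem spechtVal_rep {μ : YoungDiagram} (τ : Perm (Fin μ.card)) (x : Specht k μ) :
    spechtVal μ (spechtRep k μ τ x) = MonoidAlgebra.single τ 1 * spechtVal μ x := rfl

theorem spechtVal_spGen (μ : YoungDiagram) :
    spechtVal μ (spGen k μ) = colSum k (tableau μ) * rowSum k (tableau μ) := rfl

variable (k) in
/-- The embedding of `S_μ(V)` in `V^{⊗ |μ|}`. -/
def schurEmb (μ : YoungDiagram) : Schur k μ →ₗ[k] TPow k μ.card :=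
  Representation.Coinvariants.lift (diagRep k μ)
    (TensorProduct.lift ((actT k μ.card).toLinearMap ∘ₗ invMap k _ ∘ₗ spechtVal μ)) (by
      intro τ
      refine TensorProduct.ext' fun x w => ?_
      change actT k μ.card (invMap k _ (spechtVal μ (spechtRep k μ τ x)))
        (permTPow k μ.card τ w) = actT k μ.card (invMap k _ (spechtVal μ x)) w
      rw [spechtVal_rep, invMap_mul, invMap_single, map_mul, Module.End.mul_apply, actT_single,
        one_smul, ← Module.End.mul_apply (permTPow k μ.card τ⁻¹), ← map_mul, inv_mul_cancel,
        map_one]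
      rfl)

theorem schurEmb_schurProj {μ : YoungDiagram} (x : Specht k μ) (w : TPow k μ.card) :
    schurEmb k μ (schurProj x w) = actT k μ.card (invMap k _ (spechtVal μ x)) w := rfl

theorem schurEmb_gl (μ : YoungDiagram) (g : GLInf k) (s : Schur k μ) :
    schurEmb k μ (glSchur k μ g s) = glTPow k μ.card g (schurEmb k μ s) := by
  obtain ⟨w, rfl⟩ := schurProj_spGen_surjective μ s
  rw [glSchur_schurProj, schurEmb_schurProj, schurEmb_schurProj, actT_gl]

theorem schurProj_actT {μ : YoungDiagram} (z : MonoidAlgebra k (Perm (Fin μ.card)))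
    (x : Specht k μ) (w : TPow k μ.card) :
    schurProj x (actT k μ.card z w) = schurProj (invMap k _ z • x) w := by
  induction z using MonoidAlgebra.induction_linear with
  | zero =>
    rw [map_zero, map_zero, LinearMap.zero_apply, map_zero, zero_smul]
    have := LinearMap.congr_fun (schurProj_smul (0 : k) (0 : Specht k μ)) w
    rw [zero_smul, zero_smul] at this
    exact this.symm
  | add a b ha hb =>
    rw [map_add, LinearMap.add_apply, map_add, ha, hb, map_add, add_smul, schurProj_add]
    rfl
  | single τ a =>
    rw [actT_single, map_smul, invMap_single, single_smul_specht, schurProj_smul,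
      LinearMap.smul_apply, schurProj_perm', inv_inv]

variable (k) in
/-- The projection of `V^{⊗ |μ|}` on `S_μ(V)` given by the generator of the Specht module. -/
abbrev genProj (μ : YoungDiagram) : TPow k μ.card →ₗ[k] Schur k μ := schurProj (spGen k μ)

theorem schurEmb_genProj (μ : YoungDiagram) (w : TPow k μ.card) :
    schurEmb k μ (genProj k μ w) =
      actT k μ.card (rowSum k (tableau μ) * colSum k (tableau μ)) w := by
  rw [schurEmb_schurProj, spechtVal_spGen, invMap_mul, invMap_rowSum, invMap_colSum]

theorem genProj_schurEmb {μ : YoungDiagram} {κ : k}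
    (hκ : colSum k (tableau μ) * rowSum k (tableau μ) *
      (colSum k (tableau μ) * rowSum k (tableau μ)) =
      κ • (colSum k (tableau μ) * rowSum k (tableau μ))) (s : Schur k μ) :
    genProj k μ (schurEmb k μ s) = κ • s := by
  obtain ⟨w, rfl⟩ := schurProj_spGen_surjective μ s
  rw [schurEmb_genProj, schurProj_actT, invMap_mul, invMap_rowSum, invMap_colSum]
  have : (colSum k (tableau μ) * rowSum k (tableau μ)) • spGen k μ = κ • spGen k μ :=
    spechtVal_injective μ (by
      rw [spechtVal_smul, map_smul, spechtVal_spGen, hκ])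
  rw [this, schurProj_smul, LinearMap.smul_apply]

end SchurInTensor

/-! ### Extension of coefficients -/

section Extension

variable {k : Type u} [Field k] {r : ℕ} (σ : Fin r → YoungDiagram)

theorem glFree_tmul {W : Type u} [AddCommGroup W] [Module k W] (ρ : Representation k (GLInf k) W)
    (g : GLInf k) (a : RatK k σ) (w : W) :
    glFree σ ρ g (a ⊗ₜ w) = glRatK k σ g a ⊗ₜ ρ g w := rfl

theorem glFree_smul {W : Type u} [AddCommGroup W] [Module k W] (ρ : Representation k (GLInf k) W)
    (g : GLInf k) (a : RatK k σ) (x : RatK k σ ⊗[k] W) :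
    glFree σ ρ g (a • x) = glRatK k σ g a • glFree σ ρ g x := by
  induction x using TensorProduct.induction_on with
  | zero => simp
  | tmul b w =>
    rw [TensorProduct.smul_tmul', glFree_tmul, glFree_tmul, TensorProduct.smul_tmul',
      smul_eq_mul, smul_eq_mul, map_mul]
  | add x y hx hy => rw [smul_add, map_add, hx, hy, map_add, smul_add]

theorem baseChange_glFree {W W' : Type u} [AddCommGroup W] [Module k W] [AddCommGroup W']
    [Module k W'] {ρ : Representation k (GLInf k) W} {ρ' : Representation k (GLInf k) W'}
    {f : W →ₗ[k] W'} (hf : ∀ g w, f (ρ g w) = ρ' g (f w)) (g : GLInf k) (x : RatK k σ ⊗[k] W) :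
    LinearMap.baseChange (RatK k σ) f (glFree σ ρ g x) =
      glFree σ ρ' g (LinearMap.baseChange (RatK k σ) f x) := by
  induction x using TensorProduct.induction_on with
  | zero => simp
  | tmul b w =>
    rw [glFree_tmul, LinearMap.baseChange_tmul, LinearMap.baseChange_tmul, glFree_tmul, hf]
  | add x y hx hy => rw [map_add, map_add, hx, hy, map_add, map_add]

variable (k) in
/-- The embedding of `K^{⊕ μ}` in `T^{|μ|}`. -/
def kEmb (μ : YoungDiagram) : KSchur k σ μ →ₗ[RatK k σ] KTensor k σ μ.card :=
  LinearMap.baseChange (RatK k σ) (schurEmb k μ)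

variable (k) in
/-- The projection of `T^{|μ|}` on `K^{⊕ μ}`. -/
def kProj (μ : YoungDiagram) : KTensor k σ μ.card →ₗ[RatK k σ] KSchur k σ μ :=
  LinearMap.baseChange (RatK k σ) (genProj k μ)

theorem kEmb_gl (μ : YoungDiagram) (g : GLInf k) (x : KSchur k σ μ) :
    kEmb k σ μ (glKSchur k σ μ g x) = glKTensor k σ μ.card g (kEmb k σ μ x) :=
  baseChange_glFree σ (fun g w => schurEmb_gl μ g w) g x

theorem kProj_gl (μ : YoungDiagram) (g : GLInf k) (x : KTensor k σ μ.card) :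
    kProj k σ μ (glKTensor k σ μ.card g x) = glKSchur k σ μ g (kProj k σ μ x) :=
  baseChange_glFree σ (fun g w => (glSchur_schurProj g (spGen k μ) w).symm) g x

variable (k) in
/-- The extension of coefficients of the group algebra. -/
abbrev extAlg (n : ℕ) :
    MonoidAlgebra k (Perm (Fin n)) →+* MonoidAlgebra (RatK k σ) (Perm (Fin n)) :=
  MonoidAlgebra.mapRingHom _ (algebraMap k (RatK k σ))

theorem act_extAlg (n : ℕ) (z : MonoidAlgebra k (Perm (Fin n))) (x : KTensor k σ n) :
    act k σ n (extAlg k σ n z) x = LinearMap.baseChange (RatK k σ) (actT k n z) x := by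
  induction z using MonoidAlgebra.induction_linear with
  | zero => simp
  | add y z hy hz =>
    rw [map_add, map_add, LinearMap.add_apply, hy, hz, map_add, LinearMap.baseChange_add,
      LinearMap.add_apply]
  | single τ a =>
    rw [extAlg, MonoidAlgebra.mapRingHom_single, act_single, permKTensor_eq_baseChange]
    have : actT k n (MonoidAlgebra.single τ a) = a • permTPow k n τ :=
      LinearMap.ext fun w => actT_single n τ a w
    rw [this, LinearMap.baseChange_smul, LinearMap.smul_apply, algebraMap_smul]

theorem act_extAlg_gl (n : ℕ) (z : MonoidAlgebra k (Perm (Fin n))) (g : GLInf k)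
    (x : KTensor k σ n) :
    act k σ n (extAlg k σ n z) (glKTensor k σ n g x) =
      glKTensor k σ n g (act k σ n (extAlg k σ n z) x) := by
  rw [act_extAlg, act_extAlg]
  exact baseChange_glFree σ (fun g w => actT_gl n z g w) g x

variable (k) in
/-- The product of the row sum and the column sum of the tableau. -/
abbrev rcSum (μ : YoungDiagram) : MonoidAlgebra (RatK k σ) (Perm (Fin μ.card)) :=
  rowSum (RatK k σ) (tableau μ) * colSum (RatK k σ) (tableau μ)

theorem kEmb_kProj (μ : YoungDiagram) (x : KTensor k σ μ.card) :
    kEmb k σ μ (kProj k σ μ x) = act k σ _ (rcSum k σ μ) x := by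
  rw [rcSum, ← map_rowSum (algebraMap k (RatK k σ)), ← map_colSum (algebraMap k (RatK k σ)),
    ← map_mul]
  refine Eq.trans ?_ (act_extAlg σ _ _ x).symm
  rw [kEmb, kProj, ← LinearMap.comp_apply, ← LinearMap.baseChange_comp]
  congr 2
  exact LinearMap.ext fun w => schurEmb_genProj μ w

theorem exists_kProj_kEmb [CharZero k] (μ : YoungDiagram) :
    ∃ κ : RatK k σ, κ ≠ 0 ∧ ∀ x, kProj k σ μ (kEmb k σ μ x) = κ • x := by
  obtain ⟨κ, hκ, -, h⟩ := exists_sq_eq_smul (F := k) (tableau μ)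
  refine ⟨algebraMap k _ κ, by rwa [Ne, FaithfulSMul.algebraMap_eq_zero_iff], fun x => ?_⟩
  rw [kEmb, kProj, ← LinearMap.comp_apply, ← LinearMap.baseChange_comp]
  have : genProj k μ ∘ₗ schurEmb k μ = κ • LinearMap.id :=
    LinearMap.ext fun s => genProj_schurEmb h s
  rw [this, LinearMap.baseChange_smul, LinearMap.baseChange_id, LinearMap.smul_apply,
    algebraMap_smul]
  rfl

theorem kProj_surjective (μ : YoungDiagram) : Function.Surjective (kProj k σ μ) :=
  LinearMap.lTensor_surjective _ (schurProj_spGen_surjective μ)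

theorem kEmb_injective [CharZero k] (μ : YoungDiagram) : Function.Injective (kEmb k σ μ) := by
  obtain ⟨κ, hκ, h⟩ := exists_kProj_kEmb (k := k) σ μ
  intro x y hxy
  have := congrArg (kProj k σ μ) hxy
  rw [h, h] at this
  exact smul_right_injective _ hκ this

/-- The maps to the Schur functors of the same degree are jointly injective. -/
theorem eq_zero_of_forall_kSchur [CharZero k] {m : ℕ} (v : KTensor k σ m)
    (h : ∀ ν : YoungDiagram, ν.card = m → ∀ ψ : KTensor k σ m →ₗ[RatK k σ] KSchur k σ ν,
      (∀ g x, ψ (glKTensor k σ m g x) = glKSchur k σ ν g (ψ x)) → ψ v = 0) : v = 0 := by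
  -- Each symmetrizer is conjugate to that of the fixed tableau, which is `kEmb ∘ kProj`. So it
  -- factors through an equivariant map to some `K^{⊕ν}` and kills `v`. The unit is a combination of
  -- such elements.
  have h1 : ∀ z ∈ Submodule.span k {z | ∃ (nu : YoungDiagram) (t : Fin m ≃ nu.cells)
      (x y : MonoidAlgebra k (Perm (Fin m))), z = x * (rowSum k t * colSum k t) * y},
      act k σ m (extAlg k σ m z) v = 0 := by
    intro z hz
    induction hz using Submodule.span_induction with
    | mem z hz =>
      obtain ⟨ν, t, x, y, rfl⟩ := hz
      obtain rfl : ν.card = m := by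
        have := Fintype.card_congr t
        rw [Fintype.card_fin, Fintype.card_coe] at this
        exact this.symm
      let τ : Perm (Fin ν.card) := t.trans (tableau ν).symm
      have ht : t = τ.trans (tableau ν) :=
        Equiv.ext fun i => ((tableau ν).apply_symm_apply (t i)).symm
      have h2 : rowSum k t * colSum k t = MonoidAlgebra.single τ⁻¹ 1 *
          (rowSum k (tableau ν) * colSum k (tableau ν)) * MonoidAlgebra.single τ 1 := by
        rw [mul_assoc, ← single_mul_symmetrizer_trans, ← mul_assoc,
          MonoidAlgebra.single_mul_single, inv_mul_cancel, mul_one, ← MonoidAlgebra.one_def,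
          one_mul, ← ht]
      have h3 := h ν rfl (kProj k σ ν ∘ₗ act k σ _ (extAlg k σ _ (MonoidAlgebra.single τ 1 * y)))
        fun g x => by
          rw [LinearMap.comp_apply, act_extAlg_gl, kProj_gl, LinearMap.comp_apply]
      have h4 := congrArg (kEmb k σ ν) h3
      rw [LinearMap.comp_apply, kEmb_kProj, map_zero, rcSum,
        ← map_rowSum (algebraMap k (RatK k σ)), ← map_colSum (algebraMap k (RatK k σ)),
        ← map_mul] at h4
      rw [h2, show x * (MonoidAlgebra.single τ⁻¹ 1 *
          (rowSum k (tableau ν) * colSum k (tableau ν)) * MonoidAlgebra.single τ 1) * y =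
          x * MonoidAlgebra.single τ⁻¹ 1 * ((rowSum k (tableau ν) * colSum k (tableau ν)) *
            (MonoidAlgebra.single τ 1 * y)) by simp only [mul_assoc]]
      have h5 : ∀ A B C : MonoidAlgebra k (Perm (Fin ν.card)),
          act k σ ν.card (extAlg k σ _ (A * (B * C))) v = act k σ ν.card (extAlg k σ _ A)
            (act k σ ν.card (extAlg k σ _ B) (act k σ ν.card (extAlg k σ _ C) v)) := fun A B C => by
        rw [map_mul, map_mul, map_mul, map_mul, Module.End.mul_apply, Module.End.mul_apply]
      rw [h5, h4, map_zero]
    | zero => rw [map_zero, map_zero, LinearMap.zero_apply]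
    | add x y _ _ hx hy => rw [map_add, map_add, LinearMap.add_apply, hx, hy, add_zero]
    | smul c x _ hx =>
      have : c • x = MonoidAlgebra.single 1 c * x := by
        rw [← mul_one c, ← smul_eq_mul, ← MonoidAlgebra.smul_single, smul_mul_assoc,
          ← MonoidAlgebra.one_def, one_mul, smul_eq_mul, mul_one]
      rw [this, map_mul, map_mul, Module.End.mul_apply, hx, map_zero]
  have h2 := h1 1 one_mem_span_symmetrizers
  rwa [map_one, map_one] at h2

end Extension

/-! ### The submodule `L_μ` in terms of traceless tensors -/

section KLTraceless

variable {k : Type u} [Field k] {r : ℕ} (σ : Fin r → YoungDiagram)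

theorem act_rcSum_kEmb [CharZero k] (μ : YoungDiagram) :
    ∃ κ : RatK k σ, κ ≠ 0 ∧ ∀ x, act k σ _ (rcSum k σ μ) (kEmb k σ μ x) = κ • kEmb k σ μ x := by
  obtain ⟨κ, hκ, h⟩ := exists_kProj_kEmb (k := k) σ μ
  exact ⟨κ, hκ, fun x => by rw [← kEmb_kProj, h, map_smul]⟩

theorem exists_act_rcSum_eq_kEmb [CharZero k] (μ : YoungDiagram) (x : KSchur k σ μ) :
    ∃ w, kEmb k σ μ x = act k σ _ (rcSum k σ μ) w := by
  obtain ⟨κ, hκ, h⟩ := act_rcSum_kEmb (k := k) σ μ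
  exact ⟨κ⁻¹ • kEmb k σ μ x, by rw [map_smul, h, inv_smul_smul₀ hκ]⟩

/-- A contraction followed by an equivariant map to `K^{⊕ν}` is one of the maps in the definition of
`L_μ`, its degree having dropped because the partitions `σ i` are non-empty. These maps detect zero
in the target of the contraction. -/
theorem kEmb_mem_traceless [CharZero k] (hσ : ∀ i, σ i ≠ ⊥) {μ : YoungDiagram} {x : KSchur k σ μ}
    (hx : x ∈ KL k σ μ) : kEmb k σ μ x ∈ Traceless k σ μ.card := by
  simp only [KL, Submodule.mem_iInf, LinearMap.mem_ker] at hx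
  simp only [Traceless, Submodule.mem_iInf, LinearMap.mem_ker]
  intro i y S hS
  refine eq_zero_of_forall_kSchur σ _ fun ν hν ψ hψ => ?_
  have hpos : 0 < (σ i).card := by
    rw [Nat.pos_iff_ne_zero]
    intro h
    exact hσ i (YoungDiagram.ext (Finset.card_eq_zero.mp h))
  have hle : (σ i).card ≤ μ.card := by
    rw [← hS]
    exact (Finset.card_le_univ S).trans_eq (Fintype.card_fin _)
  exact hx ν (by omega) (ψ ∘ₗ contraction σ i y S hS ∘ₗ kEmb k σ μ) fun g z => by
    simp only [LinearMap.comp_apply]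
    rw [kEmb_gl, contraction_gl, hψ]

/-- A stable submodule of `K^{⊕ μ}` that is not zero contains every traceless element. -/
theorem mem_of_kEmb_mem_traceless [CharZero k] (hσ : ∀ i, σ i ≠ ⊥) {μ : YoungDiagram}
    (N : Submodule (RatK k σ) (KSchur k σ μ)) (hN : ∀ g, ∀ x ∈ N, glKSchur k σ μ g x ∈ N)
    (hN₀ : N ≠ ⊥) {x : KSchur k σ μ} (hx : kEmb k σ μ x ∈ Traceless k σ μ.card) : x ∈ N := by
  obtain ⟨u, hu, hu₀⟩ := N.exists_mem_ne_zero_of_ne_bot hN₀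
  -- A single component; the condition on the components of lower degree is empty.
  let ar : Unit → ℕ := fun _ => μ.card
  let Q : Submodule (RatK k σ) (PiT k σ ar) :=
    N.map (LinearMap.pi fun _ => kEmb k σ μ : KSchur k σ μ →ₗ[RatK k σ] PiT k σ ar)
  obtain ⟨κ, hκ, h⟩ := act_rcSum_kEmb (k := k) σ μ
  have h1 : Pi.single () (act k σ (ar ()) (rcSum k σ μ) (kEmb k σ μ x)) ∈ Q := by
    refine single_act_symmetrizer_mem σ ar hσ (o₀ := ()) (fun o ho => (ho rfl).elim) Q ?_
      (Submodule.mem_map_of_mem hu) ?_ (tableau μ) ?_ hx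
    · rintro g _ ⟨z, hz, rfl⟩
      refine ⟨glKSchur k σ μ g z, hN g z hz, funext fun o => ?_⟩
      rw [glPi_apply]
      exact kEmb_gl σ μ g z
    · exact fun h => hu₀ (kEmb_injective σ μ (h.trans (map_zero _).symm))
    · rintro _ ⟨z, -, rfl⟩
      exact exists_act_rcSum_eq_kEmb σ μ z
  obtain ⟨z, hz, hz'⟩ := h1
  have h2 := congrFun hz' ()
  rw [Pi.single_eq_same, h] at h2
  have h3 : z = κ • x := kEmb_injective σ μ (h2.trans (map_smul _ _ _).symm)
  rw [h3] at hz
  exact (Submodule.smul_mem_iff _ hκ).mp hz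

/-- The graph of `F` is a stable subspace of the product of `T^{|μ|}` and `T^{|ν|}`, and `|μ|` is
the larger degree. It contains a nonzero multiple of `x` paired with 0, so `F x = 0`. -/
theorem mem_KL_of_kEmb_mem_traceless [CharZero k] (hσ : ∀ i, σ i ≠ ⊥) {μ : YoungDiagram}
    {x : KSchur k σ μ} (hx : kEmb k σ μ x ∈ Traceless k σ μ.card) : x ∈ KL k σ μ := by
  simp only [KL, Submodule.mem_iInf, LinearMap.mem_ker]
  intro ν hν F hF
  by_cases hx₀ : x = 0
  · rw [hx₀, map_zero]
  let ar : Bool → ℕ := fun b => bif b then μ.card else ν.card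
  let J : KSchur k σ μ →ₗ[RatK k σ] PiT k σ ar := LinearMap.pi fun b =>
    match b with
    | true => kEmb k σ μ
    | false => kEmb k σ ν ∘ₗ F
  obtain ⟨κ, hκ, h⟩ := act_rcSum_kEmb (k := k) σ μ
  have h1 : Pi.single true (act k σ (ar true) (rcSum k σ μ) (kEmb k σ μ x)) ∈
      LinearMap.range J := by
    refine single_act_symmetrizer_mem σ ar hσ (o₀ := true) ?_ (LinearMap.range J) ?_
      (LinearMap.mem_range_self J x) ?_ (tableau μ) ?_ hx
    · rintro (_ | _) ho
      · exact hν
      · exact (ho rfl).elim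
    · rintro g _ ⟨z, rfl⟩
      refine ⟨glKSchur k σ μ g z, funext fun o => ?_⟩
      rw [glPi_apply]
      rcases o with _ | _
      · change kEmb k σ ν (F (glKSchur k σ μ g z)) = _
        rw [hF, kEmb_gl]
        rfl
      · exact kEmb_gl σ μ g z
    · exact fun h => hx₀ (kEmb_injective σ μ (h.trans (map_zero _).symm))
    · rintro _ ⟨z, rfl⟩
      exact exists_act_rcSum_eq_kEmb σ μ z
  obtain ⟨z, hz⟩ := h1
  have h2 : kEmb k σ μ z = act k σ μ.card (rcSum k σ μ) (kEmb k σ μ x) :=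
    (congrFun hz true).trans (Pi.single_eq_same _ _)
  have h3 := congrFun hz false
  rw [h] at h2
  rw [Pi.single_eq_of_ne (by decide)] at h3
  have h4 : z = κ • x := kEmb_injective σ μ (h2.trans (map_smul _ _ _).symm)
  have h5 : F z = 0 := kEmb_injective σ ν (h3.trans (map_zero _).symm)
  rw [h4, map_smul] at h5
  exact (smul_eq_zero.mp h5).resolve_left hκ

theorem mem_KL_iff [CharZero k] (hσ : ∀ i, σ i ≠ ⊥) {μ : YoungDiagram} {x : KSchur k σ μ} :
    x ∈ KL k σ μ ↔ kEmb k σ μ x ∈ Traceless k σ μ.card :=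
  ⟨kEmb_mem_traceless σ hσ, mem_KL_of_kEmb_mem_traceless σ hσ⟩

/-- The symmetrizer is not 0, so it does not kill a traceless tensor on which the group algebra acts
freely. -/
theorem KL_ne_bot [CharZero k] (hσ : ∀ i, σ i ≠ ⊥) (μ : YoungDiagram) : KL k σ μ ≠ ⊥ := by
  obtain ⟨y, hy, h⟩ := exists_traceless_free (k := k) σ hσ μ.card
  have h1 : rcSum k σ μ ≠ 0 := fun h0 => by
    have := coeff_one_rowSum_mul_colSum (F := RatK k σ) (tableau μ)
    rw [show rowSum (RatK k σ) (tableau μ) * colSum (RatK k σ) (tableau μ) = 0 from h0] at this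
    exact zero_ne_one this
  refine (Submodule.ne_bot_iff _).mpr ⟨kProj k σ μ y, ?_, fun h0 => h _ h1 ?_⟩
  · rw [mem_KL_iff σ hσ, kEmb_kProj]
    exact act_mem_traceless σ _ hy
  · rw [← kEmb_kProj, h0, map_zero]

theorem KL_eq_bot_or_eq_top [CharZero k] (hσ : ∀ i, σ i ≠ ⊥) (μ : YoungDiagram)
    (N : Submodule (RatK k σ) (KL k σ μ)) (hN : ∀ g, ∀ x ∈ N, glKL k σ μ g x ∈ N) :
    N = ⊥ ∨ N = ⊤ := by
  by_cases h0 : N = ⊥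
  · exact Or.inl h0
  refine Or.inr (eq_top_iff.mpr fun x _ => ?_)
  have h1 : (x : KSchur k σ μ) ∈ N.map (KL k σ μ).subtype := by
    refine mem_of_kEmb_mem_traceless σ hσ _ ?_ ?_ ((mem_KL_iff σ hσ).mp x.2)
    · rintro g _ ⟨z, hz, rfl⟩
      exact ⟨glKL k σ μ g z, hN g z hz, rfl⟩
    · exact fun h => h0 (Submodule.map_injective_of_injective (KL k σ μ).injective_subtype
        (h.trans (Submodule.map_bot _).symm))
  obtain ⟨z, hz, hzx⟩ := h1
  rwa [← Subtype.ext hzx]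

end KLTraceless

/-! ### Polynomiality -/

section Polynomial

variable {k : Type u} [Field k]

/-- The map `Φ` carries the representation generated by `t` onto the one generated by `x`, viewed
inside `W'` through `j`. This exhibits the latter as a quotient of a subrepresentation of a sum of
tensor powers. -/
theorem isPolynomialElt_of_intertwining {W W' : Type u} [AddCommGroup W] [Module k W]
    [AddCommGroup W'] [Module k W'] {ρ : Representation k (GLInf k) W}
    {ρ' : Representation k (GLInf k) W'} (j : W →ₗ[k] W') (hj : Function.Injective j)
    (hjρ : ∀ g w, j (ρ g w) = ρ' g (j w)) {ι : Type u} {d : ι → ℕ}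
    (Φ : (⨁ i, TPow k (d i)) →ₗ[k] W')
    (hΦ : ∀ g t, Φ (Representation.directSum (fun i => glTPow k (d i)) g t) = ρ' g (Φ t))
    {t : ⨁ i, TPow k (d i)} {x : W} (hx : j x = Φ t) : IsPolynomialElt ρ x := by
  let τ : Representation k (GLInf k) (⨁ i, TPow k (d i)) :=
    Representation.directSum fun i => glTPow k (d i)
  let N : Subrepresentation τ := generatedRep τ t
  let G : Subrepresentation ρ := generatedRep ρ x
  let j' : G.toSubmodule →ₗ[k] W' := j ∘ₗ G.toSubmodule.subtype
  have hj' : Function.Injective j' := hj.comp Subtype.val_injective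
  have hmem : ∀ n : N.toSubmodule, Φ n ∈ LinearMap.range j' := by
    rintro ⟨n, hn⟩
    change Φ n ∈ _
    have hn' : n ∈ Submodule.span k (Set.range fun g => τ g t) := hn
    clear hn
    induction hn' using Submodule.span_induction with
    | mem n hn =>
      obtain ⟨g, rfl⟩ := hn
      refine ⟨⟨ρ g x, Submodule.subset_span ⟨g, rfl⟩⟩, ?_⟩
      change j (ρ g x) = Φ (τ g t)
      rw [hjρ, hx, hΦ]
    | zero => rw [map_zero]; exact Submodule.zero_mem _
    | add a b ha hb iha ihb => rw [map_add]; exact Submodule.add_mem _ iha ihb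
    | smul c a ha iha => rw [map_smul]; exact Submodule.smul_mem _ _ iha
  let f : N.toSubmodule →ₗ[k] G.toSubmodule :=
    (LinearEquiv.ofInjective j' hj').symm.toLinearMap ∘ₗ
      LinearMap.codRestrict (LinearMap.range j') (Φ ∘ₗ N.toSubmodule.subtype) hmem
  have hf : ∀ n, j (f n : W) = Φ n := fun n => by
    have := (LinearEquiv.ofInjective j' hj').apply_symm_apply ⟨Φ n, hmem n⟩
    exact congrArg Subtype.val this
  refine ⟨ι, d, N, { toLinearMap := f, isIntertwining' := fun g => LinearMap.ext fun n => ?_ }, ?_⟩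
  · refine Subtype.ext (hj ?_)
    refine (hf _).trans ?_
    change Φ (τ g n) = j (ρ g (f n))
    rw [hjρ, hf, hΦ]
  · have h1 : ∀ y ∈ G.toSubmodule, ∃ n, (f n : W) = y := by
      intro y hy
      have hy' : y ∈ Submodule.span k (Set.range fun g => ρ g x) := hy
      clear hy
      induction hy' using Submodule.span_induction with
      | mem y hy' =>
        obtain ⟨g, rfl⟩ := hy'
        refine ⟨⟨τ g t, Submodule.subset_span ⟨g, rfl⟩⟩, hj ?_⟩
        rw [hf, hjρ, hx]
        exact hΦ g t
      | zero => exact ⟨0, by rw [map_zero]; rfl⟩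
      | add a b ha hb iha ihb =>
        obtain ⟨m, rfl⟩ := iha
        obtain ⟨n, rfl⟩ := ihb
        exact ⟨m + n, by rw [map_add]; rfl⟩
      | smul c a ha iha =>
        obtain ⟨m, rfl⟩ := iha
        exact ⟨c • m, by rw [map_smul]; rfl⟩
    rintro ⟨y, hy⟩
    obtain ⟨n, hn⟩ := h1 y hy
    exact ⟨n, Subtype.ext hn⟩

/-- The linear map on the tensor power given by the values of a multilinear map on `k`-rational
vectors. -/
def tensorEval {K : Type u} [Field K] [Algebra k K] {P : Type*} [Fintype P] {W : Type*}
    [AddCommGroup W] [Module k W] [Module K W] [IsScalarTower k K W]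
    (f : MultilinearMap K (fun _ : P => StdV K) W) : TPow k (Fintype.card P) →ₗ[k] W :=
  PiTensorProduct.lift (((f.restrictScalars k).compLinearMap fun _ => liftV k K).domDomCongr
    (Fintype.equivFin P))

theorem tensorEval_pureTensor {K : Type u} [Field K] [Algebra k K] {P : Type*} [Fintype P]
    {W : Type*} [AddCommGroup W] [Module k W] [Module K W] [IsScalarTower k K W]
    (f : MultilinearMap K (fun _ : P => StdV K) W) (v : Fin (Fintype.card P) → StdV k) :
    tensorEval f (pureTensor v) = f fun p => liftV k K (v (Fintype.equivFin P p)) :=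
  PiTensorProduct.lift.tprod v

theorem tensorEval_pureTensor_single {K : Type u} [Field K] [Algebra k K] {P : Type*} [Fintype P]
    {W : Type*} [AddCommGroup W] [Module k W] [Module K W] [IsScalarTower k K W]
    (f : MultilinearMap K (fun _ : P => StdV K) W) (I : P → ℕ) :
    tensorEval f (pureTensor fun p =>
      Finsupp.single (I ((Fintype.equivFin P).symm p)) (1 : k)) = f fun p => stdB K (I p) := by
  rw [tensorEval_pureTensor]
  simp only [Equiv.symm_apply_apply, liftV_single_eq]

variable {r : ℕ} (σ : Fin r → YoungDiagram)

/-- After clearing denominators, the element is a `k`-combination of images of monomials. Each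
monomial is the image of a pure tensor under an equivariant map from a tensor power whose degree is
the number of its arguments. The module `W` is any one that embeds in `K^{⊕ μ}`, so that `L_μ` is
covered. -/
theorem kSchur_exists_polynomial {W : Type u} [AddCommGroup W] [Module k W] [Module (RatK k σ) W]
    [IsScalarTower k (RatK k σ) W]
    {ρ : Representation k (GLInf k) W} {μ : YoungDiagram} (j : W →ₗ[RatK k σ] KSchur k σ μ)
    (hj : Function.Injective j) (hjρ : ∀ g w, j (ρ g w) = glKSchur k σ μ g (j w)) (m : W) :
    ∃ (a : RatK k σ) (x : W), IsPolynomialElt ρ x ∧ m = a • x := by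
  classical
  obtain ⟨u, hu⟩ := kProj_surjective σ μ (j m)
  let ar : Unit → ℕ := fun _ => μ.card
  obtain ⟨a, ha, X, hX⟩ := exists_smul_mem_monSpan σ ar (fun _ => u : PiT k σ ar)
  refine ⟨a⁻¹, a • m, ?_, (inv_smul_smul₀ ha m).symm⟩
  let ι : Type u := ULift X.support
  let pr : PiT k σ ar →ₗ[RatK k σ] KSchur k σ μ := kProj k σ μ ∘ₗ LinearMap.proj ()
  have hpr : ∀ g z, pr (glPi k σ ar g z) = glKSchur k σ μ g (pr z) := fun g z => by
    change kProj k σ μ (glPi k σ ar g z ()) = _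
    rw [glPi_apply, kProj_gl]
    rfl
  let sh : ι → Shape r Unit := fun i => i.down.1.1
  let d : ι → ℕ := fun i => Fintype.card (Shape.Pos σ ar (sh i))
  let ev : ∀ i, TPow k (d i) →ₗ[k] KSchur k σ μ := fun i =>
    (pr.restrictScalars k) ∘ₗ tensorEval (shapeEval k σ ar (sh i))
  have hev : ∀ i g t, ev i (glTPow k (d i) g t) = glKSchur k σ μ g (ev i t) := by
    intro i g t
    refine LinearMap.congr_fun (f := ev i ∘ₗ glTPow k (d i) g) (g := glKSchur k σ μ g ∘ₗ ev i)
      (pure_ext fun v => ?_) t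
    change pr (tensorEval _ (glTPow k (d i) g (pureTensor v))) =
      glKSchur k σ μ g (pr (tensorEval _ (pureTensor v)))
    rw [glTPow_pure, tensorEval_pureTensor, tensorEval_pureTensor, ← hpr]
    exact congrArg pr (glPi_shapeEval σ ar (sh i) g _).symm
  let Φ : (⨁ i, TPow k (d i)) →ₗ[k] KSchur k σ μ := DirectSum.toModule k ι _ ev
  have hΦ : ∀ g t, Φ (Representation.directSum (fun i => glTPow k (d i)) g t) =
      glKSchur k σ μ g (Φ t) := by
    intro g t
    refine LinearMap.congr_fun
      (f := Φ ∘ₗ Representation.directSum (fun i => glTPow k (d i)) g)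
      (g := glKSchur k σ μ g ∘ₗ Φ) (DirectSum.linearMap_ext _ fun i => LinearMap.ext fun w => ?_) t
    change Φ (Representation.directSum (fun i => glTPow k (d i)) g (DirectSum.lof k ι _ i w)) =
      glKSchur k σ μ g (Φ (DirectSum.lof k ι _ i w))
    have h1 : Representation.directSum (fun i => glTPow k (d i)) g (DirectSum.lof k ι _ i w) =
        DirectSum.lof k ι (fun i => TPow k (d i)) i (glTPow k (d i) g w) :=
      DirectSum.lmap_lof _ _ _
    rw [h1, DirectSum.toModule_lof, DirectSum.toModule_lof, hev]
  let t : ⨁ i, TPow k (d i) := ∑ i : ι, DirectSum.lof k ι (fun i => TPow k (d i)) i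
    (X i.down.1 • pureTensor fun p =>
      Finsupp.single (i.down.1.2 ((Fintype.equivFin _).symm p)) (1 : k))
  refine isPolynomialElt_of_intertwining (j.restrictScalars k) hj hjρ Φ hΦ (t := t) ?_
  have h1 : j (a • m) = pr (a • (fun _ => u : PiT k σ ar)) := by
    rw [map_smul, map_smul, ← hu]
    rfl
  change j (a • m) = Φ t
  rw [h1, ← hX, theta_apply, map_sum, map_sum, ← Finset.sum_coe_sort,
    ← Equiv.sum_comp (Equiv.ulift : ι ≃ X.support)]
  refine Finset.sum_congr rfl fun i _ => ?_
  rw [DirectSum.toModule_lof, LinearMap.map_smul_of_tower, map_smul]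
  refine congrArg (X i.down.1 • pr ·) ?_
  exact (tensorEval_pureTensor_single (shapeEval k σ ar (sh i)) i.down.1.2).symm

theorem isSimpleKModule_KL [CharZero k] (hσ : ∀ i, σ i ≠ ⊥) (μ : YoungDiagram) :
    IsSimpleKModule (M := KL k σ μ) σ (glKL k σ μ) where
  isKModule :=
    { semilinear := fun g a m => Subtype.ext (glFree_smul σ (glSchur k μ) g a m)
      polynomial := kSchur_exists_polynomial σ (KL k σ μ).subtype (KL k σ μ).injective_subtype
        fun _ _ => rfl }
  nontrivial := Submodule.nontrivial_iff_ne_bot.mpr (KL_ne_bot σ hσ μ)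
  eq_bot_or_eq_top := KL_eq_bot_or_eq_top σ hσ μ

end Polynomial

/-! ### The isotypic pieces -/

/-- Negatives are multiples by `-1`, so no group structure on the modules has to be given. -/
theorem injective_of_forall_eq_zero {K M N : Type*} [Ring K] [AddCommMonoid M] [Module K M]
    [AddCommMonoid N] [Module K N] (f : M →ₗ[K] N) (h : ∀ x, f x = 0 → x = 0) :
    Function.Injective f :=
  let _ := Module.addCommMonoidToAddCommGroup K (M := M)
  let _ := Module.addCommMonoidToAddCommGroup K (M := N)
  (injective_iff_map_eq_zero f).mpr h

/-- A criterion for the injectivity of a map on `L ⊗ S`, in terms of operators on `S` and on the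
target that map `S` to a line. -/
theorem injective_of_operators {F L S N ι : Type*} [Field F] [AddCommMonoid L] [Module F L]
    [AddCommGroup S] [Module F S] [AddCommMonoid N] [Module F N] (f : L ⊗[F] S →ₗ[F] N)
    (P : ι → N →ₗ[F] N) (Q : ι → S →ₗ[F] S) (hPQ : ∀ z l x, P z (f (l ⊗ₜ x)) = f (l ⊗ₜ Q z x))
    {g : S} (hQ : ∀ z x, ∃ s : F, Q z x = s • g) (hg : ∀ l, f (l ⊗ₜ g) = 0 → l = 0)
    (h₀ : ∀ x, (∀ z, Q z x = 0) → x = 0) : Function.Injective f := by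
  classical
  refine injective_of_forall_eq_zero f fun T hT => ?_
  let _ := Module.addCommMonoidToAddCommGroup F (M := L)
  let B := Module.Basis.ofVectorSpace F S
  obtain ⟨b, rfl⟩ := TensorProduct.eq_repr_basis_right B T
  rw [Finsupp.sum] at hT ⊢
  -- Applying `P z` to the relation moves all of it to the line of `g`, and gives a relation between
  -- the coefficients `b i` in `L`. Read through a linear form `φ`, it says that the operators `Q z`
  -- kill the element of `S` with coordinates `φ (b i)`.
  have h1 : ∀ (φ : L →ₗ[F] F) z, Q z (∑ i ∈ b.support, φ (b i) • B i) = 0 := by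
    intro φ z
    choose s hs using fun i => hQ z (B i)
    have h2 : ∑ i ∈ b.support, s i • b i = 0 := by
      have h3 := congrArg (P z) hT
      rw [map_sum, map_sum, map_zero] at h3
      refine hg _ ?_
      rw [TensorProduct.sum_tmul, map_sum]
      refine Eq.trans (Finset.sum_congr rfl fun i _ => ?_) h3
      rw [hPQ, hs, TensorProduct.smul_tmul]
    have h4 := congrArg φ h2
    simp only [map_sum, map_smul, map_zero, smul_eq_mul] at h4
    rw [map_sum, ← zero_smul F g, ← h4, Finset.sum_smul]
    refine Finset.sum_congr rfl fun i _ => ?_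
    rw [map_smul, hs, smul_smul, mul_comm]
  refine Finset.sum_eq_zero fun i hi => ?_
  have h2 : b i = 0 := (Module.forall_dual_apply_eq_zero_iff F (b i)).mp fun φ =>
    linearIndependent_iff'.mp B.linearIndependent b.support (fun i => φ (b i)) (h₀ _ (h1 φ)) i hi
  rw [h2, TensorProduct.zero_tmul]

/-! ### Young symmetrizers acting on the Specht module. -/

section SpechtModule

variable {k : Type u} [Field k] [CharZero k]

/-- Sandwiching an element between two copies of `ba` gives a multiple of `ba`. This plays the role
of Schur's lemma over an arbitrary field of characteristic 0. -/
theorem exists_symmetrizer_mul_smul {μ : YoungDiagram} (z : MonoidAlgebra k (Perm (Fin μ.card)))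
    (x : Specht k μ) :
    ∃ s : k, (colSum k (tableau μ) * rowSum k (tableau μ) * z) • x = s • spGen k μ := by
  obtain ⟨a, rfl⟩ := exists_smul_spGen x
  obtain ⟨s, hs⟩ := colSum_rowSum_mul_mul (F := k) (tableau μ) (z * a)
  refine ⟨s, spechtVal_injective μ ?_⟩
  rw [spechtVal_smul, spechtVal_smul, map_smul, spechtVal_spGen, ← hs]
  simp only [mul_assoc]

theorem eq_zero_of_forall_symmetrizer_smul {μ : YoungDiagram} {x : Specht k μ}
    (h : ∀ z : MonoidAlgebra k (Perm (Fin μ.card)),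
      (colSum k (tableau μ) * rowSum k (tableau μ) * z) • x = 0) : x = 0 := by
  obtain ⟨a, ha⟩ := exists_smul_spGen x
  refine spechtVal_injective μ ((eq_zero_of_forall_mul_eq_zero (tableau μ) (y := a) ?_
    fun z => ?_).trans (map_zero _).symm)
  · rw [ha, spechtVal_smul, spechtVal_spGen]
  · rw [← spechtVal_smul, h, map_zero]

end SpechtModule

/-! ### Homomorphisms from the Specht module, and the isotypic component. -/

section Isotypic

variable {k : Type u} [Field k] {r : ℕ} (σ : Fin r → YoungDiagram)

theorem map_smul_of_equivariant {μ : YoungDiagram} (f : Specht k μ →ₗ[k] KTensor k σ μ.card)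
    (hf : ∀ τ x, f (spechtRep k μ τ x) = permKTensor k σ _ τ (f x))
    (z : MonoidAlgebra k (Perm (Fin μ.card))) (x : Specht k μ) :
    f (z • x) = act k σ _ (extAlg k σ _ z) (f x) := by
  induction z using MonoidAlgebra.induction_linear with
  | zero => rw [zero_smul, map_zero, map_zero, map_zero, LinearMap.zero_apply]
  | add a b ha hb => rw [add_smul, map_add, map_add, map_add, LinearMap.add_apply, ha, hb]
  | single τ c =>
    rw [single_smul_specht, map_smul, hf, extAlg, MonoidAlgebra.mapRingHom_single, act_single,
      algebraMap_smul]

theorem isotypicPiece_smul {μ : YoungDiagram} (f : isotypicPiece k σ μ)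
    (z : MonoidAlgebra k (Perm (Fin μ.card))) (x : Specht k μ) :
    (f.1 (z • x) : KTensor k σ μ.card) = act k σ _ (extAlg k σ _ z) (f.1 x) :=
  map_smul_of_equivariant σ ((Traceless k σ μ.card).subtype.restrictScalars k ∘ₗ f.1)
    (fun τ x => congrArg Subtype.val (f.2 τ x)) z x

variable (k) in
/-- Evaluation at the generator of the Specht module, as a map to `K^{⊕ μ}`. -/
def isotypicEval (μ : YoungDiagram) : isotypicPiece k σ μ →ₗ[RatK k σ] KSchur k σ μ :=
  kProj k σ μ ∘ₗ act k σ _ (extAlg k σ _ (rowSum k (tableau μ))) ∘ₗ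
    (Traceless k σ μ.card).subtype ∘ₗ
      { toFun := fun f => f.1 (spGen k μ), map_add' := fun _ _ => rfl, map_smul' := fun _ _ => rfl }

theorem isotypicEval_apply {μ : YoungDiagram} (f : isotypicPiece k σ μ) :
    isotypicEval k σ μ f =
      kProj k σ μ (act k σ _ (extAlg k σ _ (rowSum k (tableau μ))) (f.1 (spGen k μ))) := rfl

theorem kEmb_kProj_extAlg (μ : YoungDiagram) (x : KTensor k σ μ.card) :
    kEmb k σ μ (kProj k σ μ x) =
      act k σ _ (extAlg k σ _ (rowSum k (tableau μ) * colSum k (tableau μ))) x := by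
  rw [kEmb_kProj, rcSum, map_mul (extAlg k σ μ.card), map_rowSum, map_colSum]

theorem isotypicEval_mem [CharZero k] (hσ : ∀ i, σ i ≠ ⊥) {μ : YoungDiagram}
    (f : isotypicPiece k σ μ) : isotypicEval k σ μ f ∈ KL k σ μ := by
  rw [mem_KL_iff σ hσ, isotypicEval_apply, kEmb_kProj]
  exact act_mem_traceless σ _ (act_mem_traceless σ _ (f.1 (spGen k μ)).2)

theorem eq_zero_of_apply_spGen {μ : YoungDiagram} (f : isotypicPiece k σ μ)
    (h : f.1 (spGen k μ) = 0) : f = 0 := by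
  refine Subtype.ext (LinearMap.ext fun x => Subtype.ext ?_)
  obtain ⟨a, rfl⟩ := exists_smul_spGen x
  rw [isotypicPiece_smul, h]
  exact map_zero _

/-- Embedding the value in the tensor power and applying the column sum b gives f((ba)(ba) · gen),
where gen = ba. This is κ² f(gen), and f is determined by f(gen). -/
theorem isotypicEval_injective [CharZero k] (μ : YoungDiagram) :
    Function.Injective (isotypicEval k σ μ) := by
  refine injective_of_forall_eq_zero _ fun f hf => ?_
  obtain ⟨κ, hκ, -, h⟩ := exists_sq_eq_smul (F := k) (tableau μ)
  have h1 := congrArg (fun x => act k σ _ (extAlg k σ _ (colSum k (tableau μ))) (kEmb k σ μ x)) hf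
  simp only [isotypicEval_apply, kEmb_kProj_extAlg, map_zero] at h1
  simp only [← Module.End.mul_apply, ← map_mul] at h1
  rw [← isotypicPiece_smul] at h1
  have h2 : (colSum k (tableau μ) * (rowSum k (tableau μ) * colSum k (tableau μ) *
      rowSum k (tableau μ))) • spGen k μ = (κ * κ) • spGen k μ := by
    refine spechtVal_injective μ ?_
    rw [spechtVal_smul, map_smul, spechtVal_spGen, mul_smul, ← h, ← mul_smul_comm, ← h]
    simp only [mul_assoc]
  rw [h2, map_smul] at h1
  refine eq_zero_of_apply_spGen σ f ?_
  exact (smul_eq_zero.mp (Subtype.ext h1 : (κ * κ) • f.1 (spGen k μ) = 0)).resolve_left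
    (mul_ne_zero hκ hκ)

/-- The equivariant map from the Specht module that is given by a traceless tensor. -/
def isotypicOf (μ : YoungDiagram) (y : Traceless k σ μ.card) : isotypicPiece k σ μ where
  val :=
    { toFun := fun x => ⟨act k σ _ (extAlg k σ _ (spechtVal μ x)) y,
        act_mem_traceless σ _ y.2⟩
      map_add' := fun x x' => Subtype.ext (by
        change act k σ _ (extAlg k σ _ (spechtVal μ (x + x'))) y.1 =
          act k σ _ (extAlg k σ _ (spechtVal μ x)) y.1 +
            act k σ _ (extAlg k σ _ (spechtVal μ x')) y.1
        rw [map_add, map_add, map_add, LinearMap.add_apply])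
      map_smul' := fun c x => Subtype.ext (by
        change act k σ _ (extAlg k σ _ (spechtVal μ (c • x))) y.1 =
          c • act k σ _ (extAlg k σ _ (spechtVal μ x)) y.1
        rw [act_extAlg, act_extAlg, map_smul, map_smul, LinearMap.baseChange_smul]
        rfl) }
  property := fun τ x => Subtype.ext (by
    change act k σ _ (extAlg k σ _ (spechtVal μ (spechtRep k μ τ x))) y.1 =
      permKTensor k σ _ τ (act k σ _ (extAlg k σ _ (spechtVal μ x)) y.1)
    rw [spechtVal_rep, map_mul, map_mul, Module.End.mul_apply, extAlg,
      MonoidAlgebra.mapRingHom_single, map_one, act_single, one_smul])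

/-- The homomorphism x ↦ x · (b l) has value (ba) b l at the generator. Applying a gives (ab)(ab) l
= κ² l, and the projection contributes a third factor κ. -/
theorem exists_isotypicEval_eq [CharZero k] (hσ : ∀ i, σ i ≠ ⊥) {μ : YoungDiagram}
    {l : KSchur k σ μ} (hl : l ∈ KL k σ μ) : ∃ f, isotypicEval k σ μ f = l := by
  obtain ⟨κ, hκ, h⟩ := exists_kProj_kEmb (k := k) σ μ
  have h' : ∀ x, act k σ _ (extAlg k σ _ (rowSum k (tableau μ) * colSum k (tableau μ)))
      (kEmb k σ μ x) = κ • kEmb k σ μ x := fun x => by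
    rw [← kEmb_kProj_extAlg, h, map_smul]
  have hy := act_mem_traceless σ (extAlg k σ _ (colSum k (tableau μ)))
    (kEmb_mem_traceless σ hσ hl)
  have h1 : isotypicEval k σ μ (isotypicOf σ μ ⟨_, hy⟩) = (κ * κ * κ) • l := by
    rw [isotypicEval_apply]
    change kProj k σ μ (act k σ _ (extAlg k σ _ (rowSum k (tableau μ)))
      (act k σ _ (extAlg k σ _ (spechtVal μ (spGen k μ)))
        (act k σ _ (extAlg k σ _ (colSum k (tableau μ))) (kEmb k σ μ l)))) = _
    have h2 : act k σ _ (extAlg k σ _ (rowSum k (tableau μ)))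
      (act k σ _ (extAlg k σ _ (spechtVal μ (spGen k μ)))
        (act k σ _ (extAlg k σ _ (colSum k (tableau μ))) (kEmb k σ μ l))) =
        act k σ _ (extAlg k σ _ (rowSum k (tableau μ) * colSum k (tableau μ)))
          (act k σ _ (extAlg k σ _ (rowSum k (tableau μ) * colSum k (tableau μ)))
            (kEmb k σ μ l)) := by
      simp only [← Module.End.mul_apply, ← map_mul, spechtVal_spGen, mul_assoc]
    rw [h2, h', map_smul, h', map_smul, map_smul, h, smul_smul, smul_smul]
  exact ⟨(κ * κ * κ)⁻¹ • isotypicOf σ μ ⟨_, hy⟩, by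
    rw [map_smul, h1, inv_smul_smul₀ (mul_ne_zero (mul_ne_zero hκ hκ) hκ)]⟩

variable (k) {σ} in
/-- The `S^μ`-isotypic piece of the traceless tensors is `L_μ`. -/
def isotypicEquiv [CharZero k] (hσ : ∀ i, σ i ≠ ⊥) (μ : YoungDiagram) :
    isotypicPiece k σ μ ≃ₗ[RatK k σ] KL k σ μ :=
  LinearEquiv.ofBijective (LinearMap.codRestrict (KL k σ μ) (isotypicEval k σ μ)
    (isotypicEval_mem σ hσ))
    ⟨fun _ _ h => isotypicEval_injective σ μ (congrArg Subtype.val h), fun l => by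
      obtain ⟨f, hf⟩ := exists_isotypicEval_eq σ hσ l.2
      exact ⟨f, Subtype.ext hf⟩⟩

theorem isotypicEquiv_gl [CharZero k] (hσ : ∀ i, σ i ≠ ⊥) (μ : YoungDiagram) (g : GLInf k)
    (f : isotypicPiece k σ μ) :
    isotypicEquiv k hσ μ (glIsotypicPiece k σ μ g f) = glKL k σ μ g (isotypicEquiv k hσ μ f) := by
  refine Subtype.ext ?_
  change kProj k σ μ (act k σ _ (extAlg k σ _ (rowSum k (tableau μ)))
    (glKTensor k σ _ g (f.1 (spGen k μ)))) = glKSchur k σ μ g (isotypicEval k σ μ f)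
  rw [act_extAlg_gl, kProj_gl]
  rfl

variable (k) {σ} in
/-- The map from `L_μ ⊗ S^μ` to the traceless tensors given by evaluation. -/
def isotypicMap [CharZero k] (hσ : ∀ i, σ i ≠ ⊥) (μ : YoungDiagram) :
    KL k σ μ ⊗[k] Specht k μ →ₗ[RatK k σ] Traceless k σ μ.card :=
  TensorProduct.AlgebraTensorModule.lift
    ((isotypicPiece k σ μ).subtype ∘ₗ (isotypicEquiv k hσ μ).symm.toLinearMap)

theorem isotypicMap_tmul [CharZero k] (hσ : ∀ i, σ i ≠ ⊥) (μ : YoungDiagram) (l : KL k σ μ)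
    (x : Specht k μ) : isotypicMap k hσ μ (l ⊗ₜ x) = ((isotypicEquiv k hσ μ).symm l).1 x := rfl

theorem isotypicMap_gl [CharZero k] (hσ : ∀ i, σ i ≠ ⊥) (μ : YoungDiagram) (g : GLInf k)
    (l : KL k σ μ) (x : Specht k μ) :
    isotypicMap k hσ μ (glKL k σ μ g l ⊗ₜ x) =
      glTraceless k σ μ.card g (isotypicMap k hσ μ (l ⊗ₜ x)) := by
  have h : (isotypicEquiv k hσ μ).symm (glKL k σ μ g l) =
      glIsotypicPiece k σ μ g ((isotypicEquiv k hσ μ).symm l) := by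
    rw [LinearEquiv.symm_apply_eq, isotypicEquiv_gl, LinearEquiv.apply_symm_apply]
  exact congrArg (fun f => f.1 x) h

theorem isotypicMap_perm [CharZero k] (hσ : ∀ i, σ i ≠ ⊥) (μ : YoungDiagram)
    (τ : Perm (Fin μ.card)) (l : KL k σ μ) (x : Specht k μ) :
    isotypicMap k hσ μ (l ⊗ₜ spechtRep k μ τ x) =
      permTraceless k σ μ.card τ (isotypicMap k hσ μ (l ⊗ₜ x)) :=
  ((isotypicEquiv k hσ μ).symm l).2 τ x

theorem isotypicMap_injective [CharZero k] (hσ : ∀ i, σ i ≠ ⊥) (μ : YoungDiagram) :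
    Function.Injective (isotypicMap k hσ μ) := by
  -- The operators are the elements `ba z`: they map the Specht module to the line of its generator
  -- and have no common kernel there.
  have h := injective_of_operators
    ((Traceless k σ μ.card).subtype.restrictScalars k ∘ₗ (isotypicMap k hσ μ).restrictScalars k)
    (fun z : MonoidAlgebra k (Perm (Fin μ.card)) => (act k σ _
      (extAlg k σ _ (colSum k (tableau μ) * rowSum k (tableau μ) * z))).restrictScalars k)
    (fun z => Algebra.lsmul k k (Specht k μ) (colSum k (tableau μ) * rowSum k (tableau μ) * z))
    (fun z l x => ?_) (g := spGen k μ) (fun z x => ?_) (fun l hl => ?_) fun x hx => ?_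
  · exact fun _ _ hab => h (congrArg Subtype.val hab)
  · exact (isotypicPiece_smul σ _ _ x).symm
  · exact exists_symmetrizer_mul_smul z x
  · exact (LinearEquiv.map_eq_zero_iff (isotypicEquiv k hσ μ).symm).mp
      (eq_zero_of_apply_spGen σ _ (Subtype.ext hl))
  · exact eq_zero_of_forall_symmetrizer_smul hx

/-- If f kills x, it kills every ba z x, a multiple of the generator. As f does not kill the
generator, all these multiples are 0, hence x = 0. -/
theorem isotypicPiece_injective [CharZero k] {μ : YoungDiagram} (f : isotypicPiece k σ μ)
    (hf : f ≠ 0) : Function.Injective f.1 := by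
  refine (injective_iff_map_eq_zero _).mpr ?_
  intro x hx
  refine eq_zero_of_forall_symmetrizer_smul fun z => ?_
  obtain ⟨s, hs⟩ := exists_symmetrizer_mul_smul z x
  have h1 := isotypicPiece_smul σ f (colSum k (tableau μ) * rowSum k (tableau μ) * z) x
  rw [hs, hx, map_smul, ZeroMemClass.coe_zero, map_zero] at h1
  rw [hs, (smul_eq_zero.mp (Subtype.ext h1 : s • f.1 (spGen k μ) = 0)).resolve_right
    fun h => hf (eq_zero_of_apply_spGen σ f h), zero_smul]

/-- The image of a nonzero homomorphism is a copy of the Specht module, by injectivity. Conversely,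
an isomorphism with a subrepresentation, composed with the inclusion, is an element of the
multiplicity space. -/
theorem mem_range_isotypicMap [CharZero k] (hσ : ∀ i, σ i ≠ ⊥) (μ : YoungDiagram)
    (t : Traceless k σ μ.card) : t ∈ LinearMap.range (isotypicMap k hσ μ) ↔
      t ∈ isotypicComp (M := Traceless k σ μ.card) (permTraceless k σ μ.card)
        (spechtRep k μ) := by
  constructor
  · rintro ⟨T, rfl⟩
    induction T using TensorProduct.induction_on with
    | zero => rw [map_zero]; exact Submodule.zero_mem _
    | add x y hx hy => rw [map_add]; exact Submodule.add_mem _ hx hy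
    | tmul l x =>
      rw [isotypicMap_tmul]
      set f := (isotypicEquiv k hσ μ).symm l
      by_cases hf : f = 0
      · rw [hf]; exact Submodule.zero_mem _
      let W : Subrepresentation (permTraceless k σ μ.card) :=
        { toSubmodule := LinearMap.range f.1
          apply_mem_toSubmodule := by
            rintro τ _ ⟨y, rfl⟩
            exact ⟨spechtRep k μ τ y, f.2 τ y⟩ }
      let E : (spechtRep k μ).Equiv W.toRepresentation :=
        { toLinearEquiv := LinearEquiv.ofInjective f.1 (isotypicPiece_injective σ f hf)
          isIntertwining' := fun τ => LinearMap.ext fun y => Subtype.ext (f.2 τ y) }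
      exact Submodule.mem_iSup_of_mem W (Submodule.mem_iSup_of_mem ⟨E.symm⟩ ⟨x, rfl⟩)
  · suffices h : isotypicComp (M := Traceless k σ μ.card) (permTraceless k σ μ.card)
        (spechtRep k μ) ≤ (LinearMap.range (isotypicMap k hσ μ)).restrictScalars k from fun ht => h ht
    refine iSup_le fun W => iSup_le fun ⟨E⟩ w hw => ?_
    let f : isotypicPiece k σ μ := ⟨W.toSubmodule.subtype ∘ₗ E.symm.toLinearMap, fun τ x => by
      have := LinearMap.congr_fun (E.symm.isIntertwining' τ) x
      exact congrArg Subtype.val this⟩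
    refine ⟨isotypicEquiv k hσ μ f ⊗ₜ E ⟨w, hw⟩, ?_⟩
    rw [isotypicMap_tmul, LinearEquiv.symm_apply_apply]
    exact congrArg Subtype.val (E.toLinearEquiv.symm_apply_apply ⟨w, hw⟩)

end Isotypic

end WeylConstruction

end

theorem mainTheorem9 {k : Type u} [Field k] [CharZero k] {r : ℕ} (σ : Fin r → YoungDiagram)
    (hσ : ∀ i, σ i ≠ ⊥) (lam : YoungDiagram) :
    -- `L_λ` is a simple `K`-module
    IsSimpleKModule (M := KL k σ lam) σ (glKL k σ lam) ∧
    -- the multiplicity space of `S^λ` in `T^{[n]}`, `n = |λ|`, is `L_λ` as a `K`-module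
    (∃ e : isotypicPiece k σ lam ≃ₗ[RatK k σ] KL k σ lam,
      ∀ (g : GLInf k) (f : isotypicPiece k σ lam),
        e (glIsotypicPiece k σ lam g f) = glKL k σ lam g (e f)) ∧
    -- the `S^λ`-isotypic component of `T^{[n]}` is `L_λ ⊗ S^λ`, compatibly with all actions
    (∃ Θ : (KL k σ lam) ⊗[k] (Specht k lam) →ₗ[RatK k σ] Traceless k σ lam.card,
      Function.Injective Θ ∧
      (∀ (g : GLInf k) (l : KL k σ lam) (x : Specht k lam),
        Θ (glKL k σ lam g l ⊗ₜ[k] x) = glTraceless k σ lam.card g (Θ (l ⊗ₜ[k] x))) ∧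
      (∀ (τ : Perm (Fin lam.card)) (l : KL k σ lam) (x : Specht k lam),
        Θ (l ⊗ₜ[k] spechtRep k lam τ x) =
          permTraceless k σ lam.card τ (Θ (l ⊗ₜ[k] x))) ∧
      (∀ t : Traceless k σ lam.card, t ∈ LinearMap.range Θ ↔
        t ∈ isotypicComp (M := Traceless k σ lam.card) (permTraceless k σ lam.card)
          (spechtRep k lam))) :=
  ⟨isSimpleKModule_KL σ hσ lam, ⟨isotypicEquiv k hσ lam, isotypicEquiv_gl σ hσ lam⟩,
    isotypicMap k hσ lam, isotypicMap_injective σ hσ lam, isotypicMap_gl σ hσ lam,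
    isotypicMap_perm σ hσ lam, mem_range_isotypicMap σ hσ lam⟩
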